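/- **Setting.** Let $(M,g,J_M)$ and $(N,h,J_N)$ be smooth almost Hermitian manifolds without boundary, not necessarily compact, with fundamental forms $\omega(X,Y)=g(JX,Y)$ (resp. $h(JX,Y)$). For a $C^1$ map $f:M\to N$ and a measurable set $\Omega\subseteq M$ put $$E_+(f;\Omega)=\frac14\int_\Omega|Tf+J_N\,Tf\,J_M|^2\,dV_g,\qquad E_+(f)=E_+(f;M).$$ A *compactly supported variation* of $f$ is a family $f_t:M\to N$, $|t|<\varepsilon$, with $f_0=f$, such that $(x,t)\mapsto f_t(x)$ and $(x,t)\mapsto\partial_tf_t(x)\in TN$ are of class $C^2$ and $f_t=f$ outside a compact set $K\subseteq M$ for all $t$. A $C^2$ map $f$ is a *critical point* of $E_+$ if $\frac{d}{dt}\big|_{t=0}E_+(f_t;K)=0$ for all such variations. **Conventions.** Greek indices refer to coordinates on $M$, Roman ones to coordinates on $N$; $f^i_\alpha=\partial_\alpha f^i$. All connections are induced by the Levi-Civita connections, $R(X,Y)=\nabla_X\nabla_Y-\nabla_Y\nabla_X-\nabla_{[X,Y]}$ is the curvature of $N$, $\Delta v=\mathrm{tr}_g\nabla^2v$ and $\tau(f)=\mathrm{tr}_g\nabla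 Tf$. Forms are paired as real tensors, so $\langle a,b\rangle=a_{\alpha\beta}b_{\gamma\delta}g^{\alpha\gamma}g^{\beta\delta}$ on $2$-forms and $\langle a,b\rangle=a_\alpha b_\beta g^{\alpha\beta}$ on $1$-forms; $d$ is normalized by $(d\eta)_{\alpha\beta}=\partial_\alpha\eta_\beta-\partial_\beta\eta_\alpha$ and $(d\omega)_{ijk}=\partial_i\omega_{jk}+\partial_j\omega_{ki}+\partial_k\omega_{ij}$; and $d^*$ is the formal $L^2$-adjoint of $d$ with respect to these pairings, that is, $(d^*\omega)_\beta=-2g^{\alpha\gamma}(\nabla_\alpha\omega)_{\gamma\beta}$ on $2$-forms. Let $A(f)$ be the section of $f^{-1}TN$ with $$2A^l=h^{li}\big\{(d^*\omega_M)_\alpha f^j_\beta(\omega_N)_{ij}g^{\alpha\beta}+(\omega_M)_{\alpha\beta}f^j_\gamma f^k_\delta(d\omega_N)_{ijk}g^{\alpha\gamma}g^{\beta\delta}\big\}.$$ **Proposition 1.3.** Let $f:M\to N$ be a $C^2$ critical point of $E_+$. Then $\tau_+(f):=\tau(f)+A(f)=0$. Moreover, let $(f_t)$ be a compactly supported variation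 of $f$, stationary outside the compact set $K$, and let $v=\partial_tf_t|_{t=0}$. Then $\langle Lv,v\rangle$ is integrable over $M$, and for every measurable $\Omega\supseteq K$ with $E_+(f;\Omega)<\infty$ (for instance $\Omega=K$, or $\Omega=M$ if $E_+(f)<\infty$) the energies $E_+(f_t;\Omega)$ are finite and differentiable in $t\in(-\varepsilon,\varepsilon)$, twice differentiable at $t=0$, and $$\frac{d^2}{dt^2}\Big|_{t=0}E_+(f_t;\Omega)=\int_M\langle Lv,v\rangle\,dV_g,$$ where $L$ is the operator on sections of $f^{-1}TN$ given by $$\begin{aligned}-Lv={}&\Delta v+\mathrm{tr}_gR(v,Tf)Tf+\tfrac12\big\{\langle d^*\omega_M,\omega_N(\cdot,\nabla v)\rangle^\sharp+\langle d^*\omega_M,(\nabla_v\omega_N)(\cdot,Tf)\rangle^\sharp\\&+\langle\omega_M,(d\omega_N)(\cdot,\nabla v,Tf)\rangle^\sharp+\langle\omega_M,(d\omega_N)(\cdot,Tf,\nabla v)\rangle^\sharp+\langle\omega_M,(\nabla_vd\omega_N)(\cdot,Tf,Tf)\rangle^\sharp\big\}.\end{aligned}$$ Here the first slot is left free and the others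 are paired with $d^*\omega_M$ or $\omega_M$ by $g$; for example $\langle d^*\omega_M,\omega_N(\cdot,\nabla v)\rangle_i=(d^*\omega_M)_\alpha(\omega_N)_{ij}(\nabla_\beta v)^jg^{\alpha\beta}$ and $\langle\omega_M,(d\omega_N)(\cdot,Tf,\nabla v)\rangle_i=(\omega_M)_{\alpha\beta}f^j_\gamma(\nabla_\delta v)^k(d\omega_N)_{ijk}g^{\alpha\gamma}g^{\beta\delta}$; and $\sharp:T^*N\to TN$ is the musical isomorphism of $h$. -/

import Mathlib

open Set MeasureTheory Bundle
open scoped Manifold ContDiff Topology ENNReal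

noncomputable section

attribute [-instance] TopCat.of.chartedSpace

namespace PseudoHolo

/-- The model space `ℝᵐ` with its Euclidean norm and Lebesgue measure. -/
abbrev Model (m : ℕ) := EuclideanSpace ℝ (Fin m)

/-! ### Tensor calculus in coordinates

Metrics, forms, maps and sections are given here by their components on (an open part of) `ℝᵐ`. -/

/-- The `i`-th standard basis vector of `ℝᵐ`. -/
def stdVec {m : ℕ} (i : Fin m) : Model m := EuclideanSpace.single i (1 : ℝ)

/-- The partial derivative `∂ᵢ w` of a real function on `ℝᵐ`. -/
def pd {m : ℕ} (i : Fin m) (w : Model m → ℝ) (y : Model m) : ℝ := fderiv ℝ w y (stdVec i)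

/-- Christoffel symbols of the Levi-Civita connection of the metric `G`:
`Γᵏᵢⱼ = ½ Gᵏˡ (∂ᵢ Gⱼₗ + ∂ⱼ Gᵢₗ - ∂ₗ Gᵢⱼ)`. -/
def christoffel {m : ℕ} (G : Model m → Matrix (Fin m) (Fin m) ℝ) (k i j : Fin m) (y : Model m) : ℝ :=
  (1 / 2) * ∑ l, (G y)⁻¹ k l *
    (pd i (fun z => G z j l) y + pd j (fun z => G z i l) y - pd l (fun z => G z i j) y)

/-- The curvature `R(X,Y) = ∇_X ∇_Y - ∇_Y ∇_X - ∇_[X,Y]` of the Levi-Civita connection of `G`: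
`curvature G l i j k` is the `l`-th component of `R(∂ᵢ,∂ⱼ)∂ₖ`. -/
def curvature {m : ℕ} (G : Model m → Matrix (Fin m) (Fin m) ℝ) (l i j k : Fin m) (y : Model m) : ℝ :=
  pd i (christoffel G l j k) y - pd j (christoffel G l i k) y
    + ∑ p, (christoffel G l i p y * christoffel G p j k y
      - christoffel G l j p y * christoffel G p i k y)

/-- The covariant derivative `(∇ₖ w)ᵢⱼ` of a covariant 2-tensor. -/
def covDeriv₂ {m : ℕ} (G : Model m → Matrix (Fin m) (Fin m) ℝ)
    (w : Fin m → Fin m → Model m → ℝ) (k i j : Fin m) (y : Model m) : ℝ :=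
  pd k (w i j) y - ∑ p, (christoffel G p k i y * w p j y + christoffel G p k j y * w i p y)

/-- The covariant derivative `(∇ₗ w)ᵢⱼₖ` of a covariant 3-tensor. -/
def covDeriv₃ {m : ℕ} (G : Model m → Matrix (Fin m) (Fin m) ℝ)
    (w : Fin m → Fin m → Fin m → Model m → ℝ) (l i j k : Fin m) (y : Model m) : ℝ :=
  pd l (w i j k) y - ∑ p, (christoffel G p l i y * w p j k y
    + christoffel G p l j y * w i p k y + christoffel G p l k y * w i j p y)

/-- The exterior derivative of a 2-form: `(dw)ᵢⱼₖ = ∂ₖ wᵢⱼ + ∂ⱼ wₖᵢ + ∂ᵢ wⱼₖ`. -/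
def extDeriv₂ {m : ℕ} (w : Fin m → Fin m → Model m → ℝ) (i j k : Fin m) (y : Model m) : ℝ :=
  pd k (w i j) y + pd j (w k i) y + pd i (w j k) y

/-- The formal adjoint `d*` of the exterior derivative on 2-forms, with respect to the inner
products of forms as real tensors, `⟨a,b⟩ = aₐᵦ bᵧₑ Gᵃᵞ Gᵝᵉ` on 2-forms and
`⟨a,b⟩ = aₐ bᵦ Gᵃᵝ` on 1-forms. As `(dη)ₐᵦ = ∇ₐ ηᵦ - ∇ᵦ ηₐ`, one has
`⟨w, dη⟩ = 2 Gᵃᵞ Gᵝᵉ wᵧₑ ∇ₐ ηᵦ`, so that `(d* w)ᵦ = - 2 Gᵃᵞ (∇ₐ w)ᵧᵦ`. -/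
def codiff {m : ℕ} (G : Model m → Matrix (Fin m) (Fin m) ℝ)
    (w : Fin m → Fin m → Model m → ℝ) (b : Fin m) (y : Model m) : ℝ :=
  -2 * ∑ a, ∑ c, (G y)⁻¹ a c * covDeriv₂ G w a c b y

/-- The covariant derivative `(∇ₐ s)ⁱ = ∂ₐ sⁱ + sʲ ∂ₐuᵏ Γⁱₖⱼ(u)` of a section `s` along the map `u`,
where `H` is the metric on the target. -/
def covDerivAlong {m n : ℕ} (H : Model n → Matrix (Fin n) (Fin n) ℝ) (u : Fin n → Model m → ℝ)
    (s : Fin n → Model m → ℝ) (a : Fin m) (i : Fin n) (y : Model m) : ℝ :=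
  pd a (s i) y
    + ∑ j, ∑ k, s j y * pd a (u k) y * christoffel H i k j (WithLp.toLp 2 fun l => u l y)

/-- The components `((∇²s)(∂ₐ,∂ᵦ))ⁱ` of the second covariant derivative of a section `s` along `u`;
`G` is the metric on the source. -/
def covDeriv₂Along {m n : ℕ} (G : Model m → Matrix (Fin m) (Fin m) ℝ)
    (H : Model n → Matrix (Fin n) (Fin n) ℝ) (u : Fin n → Model m → ℝ)
    (s : Fin n → Model m → ℝ) (a b : Fin m) (i : Fin n) (y : Model m) : ℝ :=
  covDerivAlong H u (fun j => covDerivAlong H u s b j) a i y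
    - ∑ c, christoffel G c a b y * covDerivAlong H u s c i y

/-- The rough Laplacian `Δ s = tr ∇² s` of a section `s` along `u`. -/
def laplacianAlong {m n : ℕ} (G : Model m → Matrix (Fin m) (Fin m) ℝ)
    (H : Model n → Matrix (Fin n) (Fin n) ℝ) (u : Fin n → Model m → ℝ)
    (s : Fin n → Model m → ℝ) (i : Fin n) (y : Model m) : ℝ :=
  ∑ a, ∑ b, (G y)⁻¹ a b * covDeriv₂Along G H u s a b i y

/-- The tension `τⁱ = Gᵃᵝ (∂ₐ∂ᵦ uⁱ - ∂ᵧuⁱ Γᵞₐᵦ + ∂ₐuʲ ∂ᵦuᵏ Γⁱⱼₖ(u))` of the map `u`. -/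
def tensionLoc {m n : ℕ} (G : Model m → Matrix (Fin m) (Fin m) ℝ)
    (H : Model n → Matrix (Fin n) (Fin n) ℝ) (u : Fin n → Model m → ℝ) (i : Fin n)
    (y : Model m) : ℝ :=
  ∑ a, ∑ b, (G y)⁻¹ a b *
    (pd a (pd b (u i)) y - ∑ c, pd c (u i) y * christoffel G c a b y
      + ∑ j, ∑ k, pd a (u j) y * pd b (u k) y *
          christoffel H i j k (WithLp.toLp 2 fun l => u l y))

/-- The vector `A`, where `2 A = ⟨d*ω_M, u^× ω_N⟩^♯ + ⟨ω_M, u^× dω_N⟩^♯`: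
`2 Aˡ = ((d*ω)ₐ ∂ᵦuʲ ωᵢⱼ Gᵃᵝ + ωₐᵦ ∂ᵧuʲ ∂ₑuᵏ (dω)ᵢⱼₖ Gᵃᵞ Gᵝᵉ) Hⁱˡ`.
Here `w` and `o` are the components of `ω_M` and `ω_N`. -/
def aTermLoc {m n : ℕ} (G : Model m → Matrix (Fin m) (Fin m) ℝ)
    (w : Fin m → Fin m → Model m → ℝ) (H : Model n → Matrix (Fin n) (Fin n) ℝ)
    (o : Fin n → Fin n → Model n → ℝ) (u : Fin n → Model m → ℝ) (l : Fin n) (y : Model m) : ℝ :=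
  let z : Model n := WithLp.toLp 2 fun l => u l y
  (1 / 2) * ∑ i, (H z)⁻¹ i l *
    ((∑ a, ∑ b, ∑ j, codiff G w a y * pd b (u j) y * o i j z * (G y)⁻¹ a b)
      + ∑ a, ∑ b, ∑ c, ∑ e, ∑ j, ∑ k, w a b y * pd c (u j) y * pd e (u k) y *
          extDeriv₂ o i j k z * (G y)⁻¹ a c * (G y)⁻¹ b e)

/-- The `i`-th covariant component of the bracket
`⟨d*ω_M, ω_N(·,∇v)⟩ + ⟨d*ω_M, (∇_v ω_N)(·,Tu)⟩ + ⟨ω_M, dω_N(·,∇v,Tu)⟩ + ⟨ω_M, dω_N(·,Tu,∇v)⟩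
  + ⟨ω_M, (∇_v dω_N)(·,Tu,Tu)⟩`
for a section `v` along the map `u`. -/
def bracketLoc {m n : ℕ} (G : Model m → Matrix (Fin m) (Fin m) ℝ)
    (w : Fin m → Fin m → Model m → ℝ) (H : Model n → Matrix (Fin n) (Fin n) ℝ)
    (o : Fin n → Fin n → Model n → ℝ) (u v : Fin n → Model m → ℝ) (i : Fin n) (y : Model m) : ℝ :=
  let z : Model n := WithLp.toLp 2 fun l => u l y
  let D : Fin m → Fin n → ℝ := fun a j => covDerivAlong H u v a j y
  let T : Fin m → Fin n → ℝ := fun a j => pd a (u j) y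
  (∑ a, ∑ b, ∑ j, codiff G w a y * o i j z * D b j * (G y)⁻¹ a b)
  + (∑ a, ∑ b, ∑ j, codiff G w a y * (∑ k, v k y * covDeriv₂ H o k i j z) * T b j * (G y)⁻¹ a b)
  + (∑ a, ∑ b, ∑ c, ∑ e, ∑ j, ∑ k,
      w a b y * extDeriv₂ o i j k z * D c j * T e k * (G y)⁻¹ a c * (G y)⁻¹ b e)
  + (∑ a, ∑ b, ∑ c, ∑ e, ∑ j, ∑ k,
      w a b y * extDeriv₂ o i j k z * T c j * D e k * (G y)⁻¹ a c * (G y)⁻¹ b e)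
  + (∑ a, ∑ b, ∑ c, ∑ e, ∑ j, ∑ k,
      w a b y * (∑ p, v p y * covDeriv₃ H (extDeriv₂ o) p i j k z) * T c j * T e k *
        (G y)⁻¹ a c * (G y)⁻¹ b e)

/-- The components of `L v`, where `-L v = Δ v + tr R(v,Tu)Tu + ½ {bracket}^♯`. -/
def lopLoc {m n : ℕ} (G : Model m → Matrix (Fin m) (Fin m) ℝ)
    (w : Fin m → Fin m → Model m → ℝ) (H : Model n → Matrix (Fin n) (Fin n) ℝ)
    (o : Fin n → Fin n → Model n → ℝ) (u v : Fin n → Model m → ℝ) (l : Fin n) (y : Model m) : ℝ :=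
  let z : Model n := WithLp.toLp 2 fun l => u l y
  (-1) * (laplacianAlong G H u v l y
    + (∑ a, ∑ b, (G y)⁻¹ a b *
        ∑ i, ∑ j, ∑ k, v i y * pd a (u j) y * pd b (u k) y * curvature H l i j k z)
    + (1 / 2) * ∑ i, (H z)⁻¹ i l * bracketLoc G w H o u v i y)

/-! ### Almost Hermitian manifolds -/

/-- An almost Hermitian structure on a manifold `M` without boundary, modelled on `ℝᵐ`: a smooth
Riemannian metric and a smooth almost complex structure that is orthogonal for it. -/
structure AlmostHermitian (m : ℕ) (M : Type*) [TopologicalSpace M] [ChartedSpace (Model m) M]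
    [IsManifold (𝓡 m) ∞ M] where
  /-- the Riemannian metric -/
  metric : ContMDiffRiemannianMetric (𝓡 m) ∞ (Model m) (fun x : M => TangentSpace (𝓡 m) x)
  /-- the almost complex structure -/
  J : ∀ x : M, TangentSpace (𝓡 m) x →L[ℝ] TangentSpace (𝓡 m) x
  contMDiff_J : ContMDiff (𝓡 m) ((𝓡 m).prod 𝓘(ℝ, Model m →L[ℝ] Model m)) ∞
    (fun x : M => TotalSpace.mk' (Model m →L[ℝ] Model m)
      (E := fun x : M => TangentSpace (𝓡 m) x →L[ℝ] TangentSpace (𝓡 m) x) x (J x))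
  J_J : ∀ (x : M) (X : TangentSpace (𝓡 m) x), J x (J x X) = -X
  metric_J : ∀ (x : M) (X Y : TangentSpace (𝓡 m) x),
    metric.inner x (J x X) (J x Y) = metric.inner x X Y

section

variable {m n : ℕ}
  {M : Type*} [TopologicalSpace M] [ChartedSpace (Model m) M] [IsManifold (𝓡 m) ∞ M]
  {N : Type*} [TopologicalSpace N] [ChartedSpace (Model n) N] [IsManifold (𝓡 n) ∞ N]

/-- The fundamental 2-form `ω(X,Y) = g(JX,Y)`. -/
def AlmostHermitian.form (g : AlmostHermitian m M) (x : M) (X Y : TangentSpace (𝓡 m) x) : ℝ :=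
  g.metric.inner x (g.J x X) Y

/-- The coordinate vector field `∂ᵢ` of the chart `e`, at the point with coordinates `y`. -/
def coordVec (e : OpenPartialHomeomorph M (Model m)) (y : Model m) (i : Fin m) :
    TangentSpace (𝓡 m) (e.symm y) :=
  mfderiv (𝓡 m) (𝓡 m) e.symm y (stdVec i : Model m)

/-- The components of the metric in the chart `e`. -/
def AlmostHermitian.metricLoc (g : AlmostHermitian m M) (e : OpenPartialHomeomorph M (Model m))
    (y : Model m) : Matrix (Fin m) (Fin m) ℝ :=
  Matrix.of fun i j => g.metric.inner (e.symm y) (coordVec e y i) (coordVec e y j)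

/-- The components of the fundamental 2-form in the chart `e`. -/
def AlmostHermitian.formLoc (g : AlmostHermitian m M) (e : OpenPartialHomeomorph M (Model m))
    (i j : Fin m) (y : Model m) : ℝ :=
  g.form (e.symm y) (coordVec e y i) (coordVec e y j)

/-- The Riemannian volume measure of the domain of the chart `e`: the measure
`√(det gᵢⱼ) dy¹ ⋯ dyᵐ` on the target of the chart, transported to `M`. -/
def AlmostHermitian.chartVolume [MeasurableSpace M] (g : AlmostHermitian m M)
    (e : OpenPartialHomeomorph M (Model m)) : Measure M :=
  Measure.map e.symm (((volume : Measure (Model m)).restrict e.target).withDensity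
    fun y => ENNReal.ofReal (Real.sqrt (g.metricLoc e y).det))

/-- The Riemannian volume measure `dV_g` of `M`, glued from the volume measures of the domains of
the charts. By the change of variables formula these agree on overlaps, so (on a second countable
manifold) their supremum is the measure that restricts to each of them. -/
def AlmostHermitian.vol [MeasurableSpace M] (g : AlmostHermitian m M) : Measure M :=
  ⨆ x : M, g.chartVolume (chartAt (Model m) x)

/-! ### The pseudo-holomorphic energy -/

/-- The squared norm `|B|² = gᵃᵝ h(B ∂ₐ, B ∂ᵦ)` of a linear map `B : TₓM → T_qN`. It does not
depend on the basis of `TₓM`; we use the standard basis of `ℝᵐ`, which is the underlying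
space of `TₓM`. -/
def normSq (g : AlmostHermitian m M) (h : AlmostHermitian n N) (x : M) (q : N)
    (B : TangentSpace (𝓡 m) x →L[ℝ] TangentSpace (𝓡 n) q) : ℝ :=
  let b : Fin m → TangentSpace (𝓡 m) x := fun a => (stdVec a : Model m)
  ∑ a, ∑ c, (Matrix.of fun a c => g.metric.inner x (b a) (b c))⁻¹ a c *
    h.metric.inner q (B (b a)) (B (b c))

/-- The energy density `¼ |Tf + J_N Tf J_M|²`. -/
def energyDensity (g : AlmostHermitian m M) (h : AlmostHermitian n N) (f : M → N) (x : M) : ℝ :=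
  (1 / 4) * normSq g h x (f x)
    (mfderiv (𝓡 m) (𝓡 n) f x + (h.J (f x)).comp ((mfderiv (𝓡 m) (𝓡 n) f x).comp (g.J x)))

/-- The energy `E₊(f; Ω) = ¼ ∫_Ω |Tf + J_N Tf J_M|² dV_g` over a subset `Ω` of `M`. -/
def energyPlus [MeasurableSpace M] (g : AlmostHermitian m M) (h : AlmostHermitian n N)
    (Ω : Set M) (f : M → N) : ℝ :=
  ∫ x in Ω, energyDensity g h f x ∂g.vol

/-! ### Variations -/

/-- The velocity `∂ₜ F` of a family of maps `F t : M → N`. -/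
def velocity (F : ℝ → M → N) (t : ℝ) (x : M) : TangentSpace (𝓡 n) (F t x) :=
  mfderiv 𝓘(ℝ, ℝ) (𝓡 n) (fun s => F s x) t (1 : ℝ)

/-- `F t`, `-ε < t < ε`, is a one-parameter family of maps that is stationary outside the compact
set `K`. Its regularity is the natural one for families through a map that is only `C²`: both
`(x,t) ↦ F t x ∈ N` and `(x,t) ↦ ∂ₜ F t x ∈ TN` are of class `C²`. -/
structure IsCompactVariation (m n : ℕ)
    {M : Type*} [TopologicalSpace M] [ChartedSpace (Model m) M]
    {N : Type*} [TopologicalSpace N] [ChartedSpace (Model n) N] [IsManifold (𝓡 n) ∞ N]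
    (F : ℝ → M → N) (K : Set M) (ε : ℝ) : Prop where
  pos : 0 < ε
  isCompact : IsCompact K
  stationary : ∀ t ∈ Ioo (-ε) ε, ∀ x ∉ K, F t x = F 0 x
  contMDiffOn : ContMDiffOn ((𝓡 m).prod 𝓘(ℝ, ℝ)) (𝓡 n) 2 (fun p : M × ℝ => F p.2 p.1)
    (univ ×ˢ Ioo (-ε) ε)
  contMDiffOn_velocity : ContMDiffOn ((𝓡 m).prod 𝓘(ℝ, ℝ)) (𝓡 n).tangent 2
    (fun p : M × ℝ => (⟨F p.2 p.1, velocity F p.2 p.1⟩ : TangentBundle (𝓡 n) N))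
    (univ ×ˢ Ioo (-ε) ε)

/-- `f` is a `C²` critical point of `E₊` with respect to all compactly supported variations. The
energy is taken over the compact set outside which the variation is stationary, so that it is
finite even if `M` is not compact. -/
structure IsCriticalPoint [MeasurableSpace M] (g : AlmostHermitian m M) (h : AlmostHermitian n N)
    (f : M → N) : Prop where
  contMDiff : ContMDiff (𝓡 m) (𝓡 n) 2 f
  hasDerivAt : ∀ (F : ℝ → M → N) (K : Set M) (ε : ℝ), IsCompactVariation m n F K ε → F 0 = f →
    HasDerivAt (fun t => energyPlus g h K (F t)) 0 0

/-! ### The operators along a map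

At the point `x` they are computed in the preferred charts around `x` and `f x`. -/

/-- The components of the map `f` in the preferred charts around `x₀` and `f x₀`. -/
def mapLoc (f : M → N) (x₀ : M) (i : Fin n) (y : Model m) : ℝ :=
  (chartAt (Model n) (f x₀) (f ((chartAt (Model m) x₀).symm y)) : Model n) i

/-- The components of a section `v` of `f⁻¹TN` in the preferred charts around `x₀` and `f x₀`. -/
def sectionLoc (f : M → N) (v : ∀ x, TangentSpace (𝓡 n) (f x)) (x₀ : M) (i : Fin n)
    (y : Model m) : ℝ :=
  let w : Model n := mfderiv (𝓡 n) (𝓡 n) (chartAt (Model n) (f x₀))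
    (f ((chartAt (Model m) x₀).symm y)) (v ((chartAt (Model m) x₀).symm y))
  w i

/-- The tangent vector at `q` with the given components in the preferred chart around `q`. -/
def ofComponents (q : N) (c : Fin n → ℝ) : TangentSpace (𝓡 n) q :=
  mfderiv (𝓡 n) (𝓡 n) (chartAt (Model n) q).symm (chartAt (Model n) q q)
    (WithLp.toLp 2 c : Model n)

/-- `τ₊(f) = τ(f) + A(f)`, a section of `f⁻¹TN`. -/
def tensionPlus (g : AlmostHermitian m M) (h : AlmostHermitian n N) (f : M → N) (x : M) :
    TangentSpace (𝓡 n) (f x) :=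
  let e := chartAt (Model m) x
  let e' := chartAt (Model n) (f x)
  ofComponents (f x) fun l =>
    tensionLoc (g.metricLoc e) (h.metricLoc e') (mapLoc f x) l (e x)
      + aTermLoc (g.metricLoc e) (g.formLoc e) (h.metricLoc e') (h.formLoc e') (mapLoc f x) l (e x)

/-- The operator `L` on sections of `f⁻¹TN`:
`-L v = Δ v + tr_g R(v,Tf)Tf + ½ {⟨d*ω_M, ω_N(·,∇v)⟩^♯ + ⟨d*ω_M, (∇_v ω_N)(·,Tf)⟩^♯
  + ⟨ω_M, dω_N(·,∇v,Tf)⟩^♯ + ⟨ω_M, dω_N(·,Tf,∇v)⟩^♯ + ⟨ω_M, (∇_v dω_N)(·,Tf,Tf)⟩^♯}`. -/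
def lop (g : AlmostHermitian m M) (h : AlmostHermitian n N) (f : M → N)
    (v : ∀ x, TangentSpace (𝓡 n) (f x)) (x : M) : TangentSpace (𝓡 n) (f x) :=
  let e := chartAt (Model m) x
  let e' := chartAt (Model n) (f x)
  ofComponents (f x) fun l =>
    lopLoc (g.metricLoc e) (g.formLoc e) (h.metricLoc e') (h.formLoc e')
      (mapLoc f x) (sectionLoc f v x) l (e x)

end

end PseudoHolo

end

/-!
# The first and second variation of the pseudo-holomorphic energy

In charts `E₊` is the integral of a density that is quadratic in `∂u`, with coefficients depending
on the point and on the value `u`. Its first variation in the direction `W` is linear in `W` and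
`∂W`, and integration by parts against a compactly supported `W` turns it into
`-∫ ⟨τ₊(u), W⟩ √det G` (`integral_firstVarLoc`). The Dirichlet part of the density gives the
tension `τ(u)`. The remaining part is the contraction of `ω_M` with `u^* ω_N`; there the second
derivatives of `u` drop out by antisymmetry, and what is left is `A(u)`: the terms in which the
derivative falls on `ω_M` and the volume density give `d^* ω_M`, and those in which it falls on
`ω_N` give `dω_N`.

On the manifold the formula is localized by a partition of unity near `K`, which is finite since
`K` is compact (`IsCompactVariation.integral_deriv_energyDensity`). The first variation of the
energy density is defined without charts, so by the fundamental lemma of the calculus of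
variations the local expressions `⟨τ₊(F t), ∂ₜF⟩` agree on overlaps
(`IsCompactVariation.pairAt_eq`). This replaces the verification that `τ₊` and `L` transform as
tensors. If `f` is critical, the variation that moves `f` in a chart in a fixed direction `c`, cut
off near a point `x₀`, gives `τ₊(f)(x₀) = 0`, on choosing `c = τ₊(f)(x₀)`
(`IsCriticalPoint.tensionPlus_eq_zero`).

For the second variation, `E₊(F t)` has derivative `-∫ ⟨τ₊(F t), ∂ₜF⟩` for `t` near zero, and as
`τ₊(F 0) = 0` only the derivative of `τ₊(F t)` contributes to the derivative of that integral at
zero. In coordinates this derivative is `-Lv` up to a Christoffel term that is linear in `τ₊(F 0)`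
(`hasDerivAt_tensionPlusLoc`), hence the integral `∫ ⟨Lv, v⟩`. All derivatives are taken under an
integral over a compact set. Off `K` the energy density does not depend on `t`, which passes from
`K` to larger sets `Ω`.
-/

noncomputable section

attribute [-instance] TopCat.of.chartedSpace

namespace PseudoHolo

/-! ### Partial derivatives -/

section Calculus

variable {m n : ℕ}

theorem pd_congr {w₁ w₂ : Model m → ℝ} {y : Model m} (h : w₁ =ᶠ[𝓝 y] w₂) (i : Fin m) :
    pd i w₁ y = pd i w₂ y := by
  simp only [pd, h.fderiv_eq]

@[simp] theorem pd_const (i : Fin m) (c : ℝ) (y : Model m) : pd i (fun _ => c) y = 0 := by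
  simp [pd]

theorem pd_add {w₁ w₂ : Model m → ℝ} {y : Model m} (h₁ : DifferentiableAt ℝ w₁ y)
    (h₂ : DifferentiableAt ℝ w₂ y) (i : Fin m) :
    pd i (fun z => w₁ z + w₂ z) y = pd i w₁ y + pd i w₂ y := by
  simp only [pd, fderiv_fun_add h₁ h₂, add_apply]

theorem pd_sub {w₁ w₂ : Model m → ℝ} {y : Model m} (h₁ : DifferentiableAt ℝ w₁ y)
    (h₂ : DifferentiableAt ℝ w₂ y) (i : Fin m) :
    pd i (fun z => w₁ z - w₂ z) y = pd i w₁ y - pd i w₂ y := by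
  simp only [pd, fderiv_fun_sub h₁ h₂, sub_apply]

theorem pd_mul {w₁ w₂ : Model m → ℝ} {y : Model m} (h₁ : DifferentiableAt ℝ w₁ y)
    (h₂ : DifferentiableAt ℝ w₂ y) (i : Fin m) :
    pd i (fun z => w₁ z * w₂ z) y = pd i w₁ y * w₂ y + w₁ y * pd i w₂ y := by
  simp only [pd, fderiv_fun_mul h₁ h₂, add_apply, smul_apply, smul_eq_mul]
  ring

theorem pd_sum {ι : Type*} {s : Finset ι} {w : ι → Model m → ℝ} {y : Model m}
    (h : ∀ k ∈ s, DifferentiableAt ℝ (w k) y) (i : Fin m) :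
    pd i (fun z => ∑ k ∈ s, w k z) y = ∑ k ∈ s, pd i (w k) y := by
  simp only [pd, fderiv_fun_sum h, sum_apply]

theorem fderiv_apply_eq_sum_pd {c : Model n → ℝ} {z : Model n} (v : Model n) :
    fderiv ℝ c z v = ∑ p, pd p c z * v p := by
  conv_lhs => rw [← (EuclideanSpace.basisFun (Fin n) ℝ).sum_repr v]
  simp [pd, stdVec, mul_comm]

theorem hasFDerivAt_toLp {E : Type*} [NormedAddCommGroup E] [NormedSpace ℝ E]
    {u : Fin n → E → ℝ} {u' : Fin n → E →L[ℝ] ℝ} {y : E} (hu : ∀ j, HasFDerivAt (u j) (u' j) y) :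
    HasFDerivAt (fun y => (WithLp.toLp 2 fun l => u l y : Model n))
      ((EuclideanSpace.equiv (Fin n) ℝ).symm.toContinuousLinearMap.comp
        (ContinuousLinearMap.pi u')) y :=
  (EuclideanSpace.equiv (Fin n) ℝ).symm.toContinuousLinearMap.hasFDerivAt.comp y
    (hasFDerivAt_pi.2 hu)

theorem differentiableAt_toLp {E : Type*} [NormedAddCommGroup E] [NormedSpace ℝ E]
    {u : Fin n → E → ℝ} {y : E} (hu : ∀ j, DifferentiableAt ℝ (u j) y) :
    DifferentiableAt ℝ (fun y => (WithLp.toLp 2 fun l => u l y : Model n)) y :=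
  (hasFDerivAt_toLp fun j => (hu j).hasFDerivAt).differentiableAt

theorem pd_comp {c : Model n → ℝ} {u : Fin n → Model m → ℝ} {y : Model m}
    (hc : DifferentiableAt ℝ c (WithLp.toLp 2 fun l => u l y))
    (hu : ∀ j, DifferentiableAt ℝ (u j) y) (a : Fin m) :
    pd a (fun y => c (WithLp.toLp 2 fun l => u l y)) y
      = ∑ p, pd p c (WithLp.toLp 2 fun l => u l y) * pd a (u p) y := by
  have h := hc.hasFDerivAt.comp y (hasFDerivAt_toLp fun j => (hu j).hasFDerivAt)
  have h2 : fderiv ℝ (fun y => c (WithLp.toLp 2 fun l => u l y)) y = _ := h.fderiv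
  rw [pd, h2, ContinuousLinearMap.comp_apply, fderiv_apply_eq_sum_pd]
  rfl

theorem hasDerivAt_comp_toLp {c : Model n → ℝ} {u : Fin n → ℝ → ℝ} {u' : Fin n → ℝ} {t : ℝ}
    (hc : DifferentiableAt ℝ c (WithLp.toLp 2 fun l => u l t))
    (hu : ∀ j, HasDerivAt (u j) (u' j) t) :
    HasDerivAt (fun t => c (WithLp.toLp 2 fun l => u l t))
      (∑ p, pd p c (WithLp.toLp 2 fun l => u l t) * u' p) t := by
  have h := hc.hasFDerivAt.comp_hasDerivAt t
    (hasFDerivAt_toLp fun j => (hu j).hasFDerivAt).hasDerivAt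
  refine h.congr_deriv ?_
  rw [fderiv_apply_eq_sum_pd]
  simp

theorem contDiffOn_pd {w : Model m → ℝ} {s : Set (Model m)} {k l : WithTop ℕ∞} (hs : IsOpen s)
    (hw : ContDiffOn ℝ k w s) (hl : l + 1 ≤ k) (i : Fin m) : ContDiffOn ℝ l (pd i w) s :=
  (hw.fderiv_of_isOpen hs hl).clm_apply contDiffOn_const

theorem pd_comm {w : Model m → ℝ} {s : Set (Model m)} (hs : IsOpen s)
    (hw : ContDiffOn ℝ 2 w s) {y : Model m} (hy : y ∈ s) (i j : Fin m) :
    pd i (pd j w) y = pd j (pd i w) y := by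
  have h : ContDiffAt ℝ 2 w y := (hw y hy).contDiffAt (hs.mem_nhds hy)
  have hd : DifferentiableAt ℝ (fderiv ℝ w) y :=
    (h.fderiv_right (m := 1) (by norm_num)).differentiableAt (by norm_num)
  have key : ∀ i j : Fin m, pd i (pd j w) y = fderiv ℝ (fderiv ℝ w) y (stdVec i) (stdVec j) := by
    intro i j
    change fderiv ℝ (fun z => fderiv ℝ w z (stdVec j)) y (stdVec i) = _
    rw [fderiv_clm_apply hd (by fun_prop)]
    simp
  rw [key, key]
  exact h.isSymmSndFDerivAt (by simp) _ _

end Calculus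

/-! ### Derivatives of determinants and inverse matrices -/

section MatrixCalculus

variable {m : ℕ}

/-- The matrix of the partial derivatives `∂_c G i j`. -/
def pdMat (G : Model m → Matrix (Fin m) (Fin m) ℝ) (c : Fin m) (y : Model m) :
    Matrix (Fin m) (Fin m) ℝ :=
  Matrix.of fun i j => pd c (fun z => G z i j) y

/-- The matrix `(Γˡ_{ci})_{li}` of the connection in the direction `∂_c`. -/
def connMat (G : Model m → Matrix (Fin m) (Fin m) ℝ) (c : Fin m) (y : Model m) :
    Matrix (Fin m) (Fin m) ℝ :=
  Matrix.of fun l i => christoffel G l c i y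

theorem differentiableAt_det {G : Model m → Matrix (Fin m) (Fin m) ℝ} {y : Model m}
    (hG : ∀ i j, DifferentiableAt ℝ (fun z => G z i j) y) :
    DifferentiableAt ℝ (fun z => (G z).det) y := by
  simp only [Matrix.det_apply]
  fun_prop

/-- Jacobi's formula. -/
theorem pd_det {G : Model m → Matrix (Fin m) (Fin m) ℝ} {y : Model m}
    (hG : ∀ i j, DifferentiableAt ℝ (fun z => G z i j) y) (c : Fin m) :
    pd c (fun z => (G z).det) y = ((G y).adjugate * pdMat G c y).trace := by
  let D : ContinuousMultilinearMap ℝ (fun _ : Fin m => Fin m → ℝ) ℝ :=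
    { Matrix.detRowAlternating.toMultilinearMap with
      cont := by
        change Continuous fun A : Matrix (Fin m) (Fin m) ℝ => A.det
        exact Continuous.matrix_det continuous_id }
  have hG' : HasFDerivAt (fun z => (fun i j => G z i j : Fin m → Fin m → ℝ))
      (ContinuousLinearMap.pi fun i => ContinuousLinearMap.pi fun j =>
        fderiv ℝ (fun z => G z i j) y) y :=
    hasFDerivAt_pi.2 fun i => hasFDerivAt_pi.2 fun j => (hG i j).hasFDerivAt
  have h := (D.hasFDerivAt (fun i j => G y i j)).comp y hG'
  have h2 : fderiv ℝ (fun z => (G z).det) y = _ := h.fderiv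
  rw [pd, h2, ContinuousLinearMap.comp_apply, ContinuousMultilinearMap.linearDeriv_apply]
  rw [Matrix.trace_mul_comm, Matrix.trace]
  refine Finset.sum_congr rfl fun i _ => ?_
  have : D (Function.update (fun i j => G y i j) i (fun j => pdMat G c y i j))
      = ((G y).updateRow i (fun j => pdMat G c y i j)).det := rfl
  rw [Matrix.diag_apply, Matrix.mul_apply]
  refine this.trans ?_
  rw [← Matrix.cramer_transpose_apply, Matrix.cramer_eq_adjugate_mulVec, Matrix.mulVec,
    dotProduct]
  refine Finset.sum_congr rfl fun j _ => ?_
  rw [← Matrix.adjugate_transpose, Matrix.transpose_apply, mul_comm]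

theorem differentiableAt_inv {G : Model m → Matrix (Fin m) (Fin m) ℝ} {y : Model m}
    (hG : ∀ i j, DifferentiableAt ℝ (fun z => G z i j) y) (h0 : (G y).det ≠ 0) (i j : Fin m) :
    DifferentiableAt ℝ (fun z => (G z)⁻¹ i j) y := by
  have h : (fun z => (G z)⁻¹ i j) = fun z =>
      ((G z).det)⁻¹ * ((G z).updateRow j (Pi.single i 1)).det := by
    ext z
    rw [Matrix.inv_def, Matrix.smul_apply, Matrix.adjugate_apply, Ring.inverse_eq_inv', smul_eq_mul]
  rw [h]
  refine ((differentiableAt_det hG).inv h0).mul (differentiableAt_det fun k l => ?_)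
  simp only [Matrix.updateRow_apply]
  split_ifs
  · fun_prop
  · exact hG k l

theorem pdMat_inv {G : Model m → Matrix (Fin m) (Fin m) ℝ} {y : Model m}
    (hG : ∀ i j, DifferentiableAt ℝ (fun z => G z i j) y) (h0 : (G y).det ≠ 0) (c : Fin m) :
    pdMat (fun z => (G z)⁻¹) c y = -((G y)⁻¹ * pdMat G c y * (G y)⁻¹) := by
  have hu : IsUnit (G y).det := h0.isUnit
  have hev : ∀ᶠ z in 𝓝 y, (G z).det ≠ 0 := (differentiableAt_det hG).continuousAt.eventually_ne h0
  have key : pdMat G c y * (G y)⁻¹ + G y * pdMat (fun z => (G z)⁻¹) c y = 0 := by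
    ext i j
    have h1 : pd c (fun z => ∑ k, G z i k * (G z)⁻¹ k j) y = 0 := by
      rw [pd_congr (w₂ := fun _ => (1 : Matrix (Fin m) (Fin m) ℝ) i j), pd_const]
      filter_upwards [hev] with z hz
      rw [← Matrix.mul_apply, Matrix.mul_nonsing_inv _ hz.isUnit]
    rw [pd_sum fun k _ => (hG i k).fun_mul (differentiableAt_inv hG h0 k j)] at h1
    simp only [pd_mul (hG _ _) (differentiableAt_inv hG h0 _ _), Finset.sum_add_distrib] at h1
    simpa [Matrix.add_apply, Matrix.mul_apply, pdMat] using h1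
  have h2 : G y * pdMat (fun z => (G z)⁻¹) c y = -(pdMat G c y * (G y)⁻¹) :=
    eq_neg_of_add_eq_zero_right key
  calc pdMat (fun z => (G z)⁻¹) c y = (G y)⁻¹ * (G y * pdMat (fun z => (G z)⁻¹) c y) := by
        rw [← mul_assoc, Matrix.nonsing_inv_mul _ hu, one_mul]
    _ = _ := by rw [h2, mul_neg, mul_assoc]

end MatrixCalculus

/-! ### Local almost Hermitian data -/

/-- The local data of an almost Hermitian structure on an open set `E ⊆ ℝᵐ`: the components `G` of
a metric and the components `w` of its fundamental 2-form, smooth on `E`. The Euler–Lagrange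
equations use neither the almost complex structure nor the compatibility of `w` with `G`, and of
the positivity of `G` only that its determinant is positive, so nothing more is recorded. -/
structure IsLocalHermitian {m : ℕ} (E : Set (Model m)) (G : Model m → Matrix (Fin m) (Fin m) ℝ)
    (w : Fin m → Fin m → Model m → ℝ) : Prop where
  isOpen : IsOpen E
  contDiffOn_metric : ∀ i j, ContDiffOn ℝ ∞ (fun y => G y i j) E
  contDiffOn_form : ∀ i j, ContDiffOn ℝ ∞ (w i j) E
  symm : ∀ y ∈ E, ∀ i j, G y i j = G y j i
  det_pos : ∀ y ∈ E, 0 < (G y).det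
  antisymm : ∀ y ∈ E, ∀ i j, w i j y = -w j i y

namespace IsLocalHermitian

variable {m : ℕ} {E : Set (Model m)} {G : Model m → Matrix (Fin m) (Fin m) ℝ}
  {w : Fin m → Fin m → Model m → ℝ} {y : Model m}

theorem differentiableAt_metric (h : IsLocalHermitian E G w) (hy : y ∈ E) (i j : Fin m) :
    DifferentiableAt ℝ (fun y => G y i j) y :=
  ((h.contDiffOn_metric i j).contDiffAt (h.isOpen.mem_nhds hy)).differentiableAt (by simp)

theorem differentiableAt_form (h : IsLocalHermitian E G w) (hy : y ∈ E) (i j : Fin m) :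
    DifferentiableAt ℝ (w i j) y :=
  ((h.contDiffOn_form i j).contDiffAt (h.isOpen.mem_nhds hy)).differentiableAt (by simp)

theorem isUnit_det (h : IsLocalHermitian E G w) (hy : y ∈ E) : IsUnit (G y).det :=
  (h.det_pos y hy).ne'.isUnit

theorem transpose_eq (h : IsLocalHermitian E G w) (hy : y ∈ E) : (G y).transpose = G y := by
  ext i j
  exact h.symm y hy j i

theorem inv_symm (h : IsLocalHermitian E G w) (hy : y ∈ E) (i j : Fin m) :
    (G y)⁻¹ i j = (G y)⁻¹ j i := by
  have := congrFun (congrFun (Matrix.transpose_nonsing_inv (G y)) i) j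
  rw [h.transpose_eq hy] at this
  exact this.symm

theorem contDiffOn_det (h : IsLocalHermitian E G w) : ContDiffOn ℝ ∞ (fun y => (G y).det) E := by
  simp only [Matrix.det_apply]
  have := h.contDiffOn_metric
  refine ContDiffOn.sum fun σ _ => ContDiffOn.const_smul _ (contDiffOn_prod fun i _ => this _ _)

theorem contDiffOn_inv (h : IsLocalHermitian E G w) (i j : Fin m) :
    ContDiffOn ℝ ∞ (fun y => (G y)⁻¹ i j) E := by
  have h1 : (fun z => (G z)⁻¹ i j) = fun z =>
      ((G z).det)⁻¹ * ((G z).updateRow j (Pi.single i 1)).det := by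
    ext z
    rw [Matrix.inv_def, Matrix.smul_apply, Matrix.adjugate_apply, Ring.inverse_eq_inv', smul_eq_mul]
  rw [h1]
  refine (h.contDiffOn_det.inv fun y hy => (h.det_pos y hy).ne').mul ?_
  simp only [Matrix.det_apply, Matrix.updateRow_apply]
  refine ContDiffOn.sum fun σ _ => ContDiffOn.const_smul _ (contDiffOn_prod fun i _ => ?_)
  split_ifs
  · exact contDiffOn_const
  · exact h.contDiffOn_metric _ _

theorem differentiableAt_inv (h : IsLocalHermitian E G w) (hy : y ∈ E) (i j : Fin m) :
    DifferentiableAt ℝ (fun y => (G y)⁻¹ i j) y :=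
  PseudoHolo.differentiableAt_inv (h.differentiableAt_metric hy) (h.det_pos y hy).ne' i j

theorem contDiffOn_sqrt_det (h : IsLocalHermitian E G w) :
    ContDiffOn ℝ ∞ (fun y => √(G y).det) E :=
  h.contDiffOn_det.sqrt fun y hy => (h.det_pos y hy).ne'

theorem differentiableAt_sqrt_det (h : IsLocalHermitian E G w) (hy : y ∈ E) :
    DifferentiableAt ℝ (fun y => √(G y).det) y :=
  ((h.contDiffOn_sqrt_det).contDiffAt (h.isOpen.mem_nhds hy)).differentiableAt (by simp)

theorem contDiffOn_christoffel (h : IsLocalHermitian E G w) (k i j : Fin m) :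
    ContDiffOn ℝ ∞ (christoffel G k i j) E := by
  have hp : ∀ a i j, ContDiffOn ℝ ∞ (pd a fun z => G z i j) E := fun a i j =>
    contDiffOn_pd h.isOpen (h.contDiffOn_metric i j) (by simp) a
  exact contDiffOn_const.mul (ContDiffOn.sum fun l _ =>
    (h.contDiffOn_inv k l).mul (((hp _ _ _).add (hp _ _ _)).sub (hp _ _ _)))

theorem contDiffOn_extDeriv₂ (h : IsLocalHermitian E G w) (i j k : Fin m) :
    ContDiffOn ℝ ∞ (extDeriv₂ w i j k) E := by
  have hp : ∀ a i j, ContDiffOn ℝ ∞ (pd a (w i j)) E := fun a i j =>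
    contDiffOn_pd h.isOpen (h.contDiffOn_form i j) (by simp) a
  exact ((hp _ _ _).add (hp _ _ _)).add (hp _ _ _)

theorem contDiffOn_covDeriv₂ (h : IsLocalHermitian E G w) (k i j : Fin m) :
    ContDiffOn ℝ ∞ (covDeriv₂ G w k i j) E :=
  (contDiffOn_pd h.isOpen (h.contDiffOn_form i j) (by simp) k).sub (ContDiffOn.sum fun _ _ =>
    ((h.contDiffOn_christoffel _ _ _).mul (h.contDiffOn_form _ _)).add
      ((h.contDiffOn_christoffel _ _ _).mul (h.contDiffOn_form _ _)))

theorem contDiffOn_codiff (h : IsLocalHermitian E G w) (b : Fin m) :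
    ContDiffOn ℝ ∞ (codiff G w b) E :=
  contDiffOn_const.mul (ContDiffOn.sum fun _ _ => ContDiffOn.sum fun _ _ =>
    (h.contDiffOn_inv _ _).mul (h.contDiffOn_covDeriv₂ _ _ _))

theorem pd_metric_symm (h : IsLocalHermitian E G w) (hy : y ∈ E) (c i j : Fin m) :
    pd c (fun z => G z i j) y = pd c (fun z => G z j i) y :=
  pd_congr (by filter_upwards [h.isOpen.mem_nhds hy] with z hz using h.symm z hz i j) c

theorem pd_form_antisymm (h : IsLocalHermitian E G w) (hy : y ∈ E) (c i j : Fin m) :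
    pd c (w i j) y = -pd c (w j i) y := by
  rw [pd_congr (w₂ := fun z => -w j i z)
    (by filter_upwards [h.isOpen.mem_nhds hy] with z hz using h.antisymm z hz i j) c]
  simp [pd, fderiv_fun_neg]

theorem christoffel_symm (h : IsLocalHermitian E G w) (hy : y ∈ E) (k i j : Fin m) :
    christoffel G k i j y = christoffel G k j i y := by
  simp only [christoffel]
  congr 1
  refine Finset.sum_congr rfl fun l _ => ?_
  rw [h.pd_metric_symm hy l i j]
  ring

/-- The Christoffel symbols of the first kind. -/
theorem sum_metric_mul_christoffel (h : IsLocalHermitian E G w) (hy : y ∈ E) (i j k : Fin m) :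
    ∑ l, G y i l * christoffel G l j k y = (1 / 2) *
      (pd j (fun z => G z k i) y + pd k (fun z => G z j i) y - pd i (fun z => G z j k) y) := by
  have h1 : ∀ f : Fin m → ℝ, ∑ l, G y i l * ((1 / 2) * ∑ p, (G y)⁻¹ l p * f p) = (1 / 2) * f i := by
    intro f
    have h2 := congrFun (congrArg (fun A : Matrix (Fin m) (Fin m) ℝ => A.mulVec f)
      (Matrix.mul_nonsing_inv _ (h.isUnit_det hy))) i
    simp only [← Matrix.mulVec_mulVec, Matrix.one_mulVec] at h2
    rw [← h2]
    simp only [Matrix.mulVec, dotProduct, Finset.mul_sum]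
    refine Finset.sum_congr rfl fun l _ => Finset.sum_congr rfl fun p _ => by ring
  exact h1 _

/-- The Levi-Civita connection is metric: `∂_c G = Cᵀ G + G C` for the connection matrix `C`. -/
theorem pdMat_metric (h : IsLocalHermitian E G w) (hy : y ∈ E) (c : Fin m) :
    pdMat G c y = (connMat G c y).transpose * G y + G y * connMat G c y := by
  ext i j
  have h1 : ∀ i j, (G y * connMat G c y) i j = _ :=
    fun i j => h.sum_metric_mul_christoffel hy i c j
  have h2 : ((connMat G c y).transpose * G y) i j = (G y * connMat G c y) j i := by
    rw [← Matrix.transpose_apply (G y * connMat G c y), Matrix.transpose_mul, h.transpose_eq hy]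
  rw [Matrix.add_apply, h2, h1, h1, pdMat, Matrix.of_apply, h.pd_metric_symm hy c j i,
    h.pd_metric_symm hy j c i, h.pd_metric_symm hy i c j]
  ring

theorem pdMat_inv (h : IsLocalHermitian E G w) (hy : y ∈ E) (c : Fin m) :
    pdMat (fun z => (G z)⁻¹) c y
      = -((G y)⁻¹ * (connMat G c y).transpose + connMat G c y * (G y)⁻¹) := by
  have hu := h.isUnit_det hy
  rw [PseudoHolo.pdMat_inv (h.differentiableAt_metric hy) (h.det_pos y hy).ne', h.pdMat_metric hy,
    mul_add, add_mul]
  congr 2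
  · rw [mul_assoc, mul_assoc, Matrix.mul_nonsing_inv _ hu, mul_one]
  · rw [← mul_assoc, Matrix.nonsing_inv_mul _ hu, one_mul]

theorem pd_inv (h : IsLocalHermitian E G w) (hy : y ∈ E) (c i j : Fin m) :
    pd c (fun z => (G z)⁻¹ i j) y
      = -∑ p, (christoffel G i c p y * (G y)⁻¹ p j + christoffel G j c p y * (G y)⁻¹ i p) := by
  have := congrFun (congrFun (h.pdMat_inv hy c) i) j
  rw [pdMat, Matrix.of_apply] at this
  rw [this]
  simp only [Matrix.neg_apply, Matrix.add_apply, Matrix.mul_apply, connMat, Matrix.of_apply,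
    Matrix.transpose_apply, Finset.sum_add_distrib]
  rw [add_comm]
  congr 2
  exact Finset.sum_congr rfl fun _ _ => mul_comm _ _

theorem pd_sqrt_det (h : IsLocalHermitian E G w) (hy : y ∈ E) (c : Fin m) :
    pd c (fun z => √(G z).det) y = √(G y).det * (connMat G c y).trace := by
  have hu := h.isUnit_det hy
  have hpos := h.det_pos y hy
  have hd := (differentiableAt_det (h.differentiableAt_metric hy))
  have h1 : pd c (fun z => √(G z).det) y = 1 / (2 * √(G y).det) * pd c (fun z => (G z).det) y := by
    rw [pd, (hd.hasFDerivAt.sqrt hpos.ne').fderiv]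
    rfl
  have hadj : (G y).adjugate = (G y).det • (G y)⁻¹ := by
    rw [Matrix.inv_def, smul_smul, Ring.mul_inverse_cancel _ hu, one_smul]
  rw [h1, pd_det (h.differentiableAt_metric hy), h.pdMat_metric hy, hadj, Matrix.smul_mul,
    Matrix.trace_smul, mul_add, Matrix.trace_add, ← mul_assoc _ (G y),
    Matrix.nonsing_inv_mul _ hu, one_mul, Matrix.trace_mul_comm, mul_assoc,
    Matrix.mul_nonsing_inv _ hu, mul_one, Matrix.trace_transpose, smul_eq_mul]
  have h3 : √(G y).det ≠ 0 := (Real.sqrt_pos.2 hpos).ne'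
  have h4 : (G y).det = √(G y).det * √(G y).det := (Real.mul_self_sqrt hpos.le).symm
  field_simp
  rw [sq, ← h4]
  ring

end IsLocalHermitian

/-- The components `w^{ce}` of the 2-form `w` with raised indices. -/
def raise {m : ℕ} (G : Model m → Matrix (Fin m) (Fin m) ℝ) (w : Fin m → Fin m → Model m → ℝ)
    (c e : Fin m) (y : Model m) : ℝ :=
  ∑ a, ∑ b, w a b y * (G y)⁻¹ a c * (G y)⁻¹ b e

namespace IsLocalHermitian

variable {m : ℕ} {E : Set (Model m)} {G : Model m → Matrix (Fin m) (Fin m) ℝ}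
  {w : Fin m → Fin m → Model m → ℝ} {y : Model m}

theorem raise_antisymm (h : IsLocalHermitian E G w) (hy : y ∈ E) (c e : Fin m) :
    raise G w c e y = -raise G w e c y := by
  rw [raise, raise, Finset.sum_comm, ← Finset.sum_neg_distrib]
  refine Finset.sum_congr rfl fun b _ => ?_
  rw [← Finset.sum_neg_distrib]
  refine Finset.sum_congr rfl fun a _ => ?_
  rw [h.antisymm y hy a b]
  ring

theorem contDiffOn_raise (h : IsLocalHermitian E G w) (c e : Fin m) :
    ContDiffOn ℝ ∞ (raise G w c e) E :=
  ContDiffOn.sum fun _ _ => ContDiffOn.sum fun _ _ =>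
    ((h.contDiffOn_form _ _).mul (h.contDiffOn_inv _ _)).mul (h.contDiffOn_inv _ _)

theorem differentiableAt_raise (h : IsLocalHermitian E G w) (hy : y ∈ E) (c e : Fin m) :
    DifferentiableAt ℝ (raise G w c e) y :=
  ((h.contDiffOn_raise c e).contDiffAt (h.isOpen.mem_nhds hy)).differentiableAt (by simp)

/-- Raising indices commutes with covariant differentiation. -/
theorem pd_raise (h : IsLocalHermitian E G w) (hy : y ∈ E) (a c e : Fin m) :
    pd a (raise G w c e) y = (∑ p, ∑ q, covDeriv₂ G w a p q y * (G y)⁻¹ p c * (G y)⁻¹ q e)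
      - ∑ p, (christoffel G c a p y * raise G w p e y + christoffel G e a p y * raise G w c p y) := by
  set W : Matrix (Fin m) (Fin m) ℝ := Matrix.of fun i j => w i j y with hW
  set W' : Matrix (Fin m) (Fin m) ℝ := Matrix.of fun i j => pd a (w i j) y with hW'
  set C := connMat G a y with hC
  set I := (G y)⁻¹ with hI
  have hIt : I.transpose = I := by ext i j; exact h.inv_symm hy j i
  have hr : ∀ (A : Matrix (Fin m) (Fin m) ℝ) (B D : Matrix (Fin m) (Fin m) ℝ) (c e : Fin m),
      ∑ p, ∑ q, A p q * B p c * D q e = (B.transpose * A * D) c e := by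
    intro A B D c e
    simp only [Matrix.mul_apply, Finset.sum_mul, Matrix.transpose_apply]
    rw [Finset.sum_comm]
    exact Finset.sum_congr rfl fun _ _ => Finset.sum_congr rfl fun _ _ => by ring
  have hR : (Matrix.of fun i j => raise G w i j y) = I * W * I := by
    ext i j
    rw [Matrix.of_apply, raise]
    exact (hr W I I i j).trans (by rw [hIt])
  have hI' : pdMat (fun z => (G z)⁻¹) a y = -(I * C.transpose + C * I) := h.pdMat_inv hy a
  have h1 : pd a (raise G w c e) y = (I * W' * I) c e
      + ((pdMat (fun z => (G z)⁻¹) a y).transpose * W * I) c e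
      + (I * W * pdMat (fun z => (G z)⁻¹) a y) c e := by
    have e1 := hr W' I I c e
    have e2 := hr W (pdMat (fun z => (G z)⁻¹) a y) I c e
    have e3 := hr W I (pdMat (fun z => (G z)⁻¹) a y) c e
    rw [hIt] at e1 e3
    rw [← e1, ← e2, ← e3, ← Finset.sum_add_distrib, ← Finset.sum_add_distrib]
    unfold raise
    have hd := h.differentiableAt_inv hy
    have hw := h.differentiableAt_form hy
    have hq : ∀ p q, DifferentiableAt ℝ (fun z => w p q z * (G z)⁻¹ p c * (G z)⁻¹ q e) y :=
      fun p q => ((hw p q).fun_mul (hd p c)).fun_mul (hd q e)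
    rw [pd_sum fun p _ => DifferentiableAt.fun_sum fun q _ => hq p q]
    refine Finset.sum_congr rfl fun p _ => ?_
    rw [pd_sum fun q _ => hq p q, ← Finset.sum_add_distrib, ← Finset.sum_add_distrib]
    refine Finset.sum_congr rfl fun q _ => ?_
    rw [pd_mul ((hw p q).fun_mul (hd p c)) (hd q e), pd_mul (hw p q) (hd p c)]
    simp only [hW, hW', pdMat, Matrix.of_apply, hI]
    ring
  have h2 : (Matrix.of fun p q => covDeriv₂ G w a p q y) = W' - C.transpose * W - W * C := by
    ext p q
    simp only [covDeriv₂, Matrix.sub_apply, Matrix.mul_apply, hW, hW', hC, connMat, Matrix.of_apply,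
      Matrix.transpose_apply, Finset.sum_add_distrib]
    rw [← sub_sub]
    congr 1
    exact Finset.sum_congr rfl fun _ _ => mul_comm _ _
  have h3 := hr (Matrix.of fun p q => covDeriv₂ G w a p q y) I I c e
  simp only [Matrix.of_apply] at h3
  have h4 : ∑ p, (christoffel G c a p y * raise G w p e y + christoffel G e a p y * raise G w c p y)
      = (C * (I * W * I) + I * W * I * C.transpose) c e := by
    rw [← hR]
    simp only [Matrix.add_apply, Matrix.mul_apply, hC, connMat, Matrix.of_apply,
      Matrix.transpose_apply, Finset.sum_add_distrib]
    congr 1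
    exact Finset.sum_congr rfl fun _ _ => mul_comm _ _
  rw [h1, h3, h4, h2, hIt, hI', ← Matrix.add_apply, ← Matrix.add_apply, ← Matrix.sub_apply]
  refine congrFun (congrFun ?_ c) e
  simp only [Matrix.transpose_neg, Matrix.transpose_add, Matrix.transpose_mul, hIt,
    Matrix.transpose_transpose]
  noncomm_ring

/-- The divergence `∂_a (√g gᵃᵇ)`. -/
theorem sum_pd_sqrt_det_mul_inv (h : IsLocalHermitian E G w) (hy : y ∈ E) (b : Fin m) :
    ∑ a, pd a (fun z => √(G z).det * (G z)⁻¹ a b) y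
      = -√(G y).det * ∑ a, ∑ c, (G y)⁻¹ a c * christoffel G b a c y := by
  have h1 : ∀ a, pd a (fun z => √(G z).det * (G z)⁻¹ a b) y = √(G y).det *
      ((∑ p, christoffel G p a p y * (G y)⁻¹ a b) - (∑ p, christoffel G a a p y * (G y)⁻¹ p b)
        - ∑ p, (G y)⁻¹ a p * christoffel G b a p y) := by
    intro a
    rw [pd_mul (h.differentiableAt_sqrt_det hy) (h.differentiableAt_inv hy a b), h.pd_sqrt_det hy,
      h.pd_inv hy, Finset.sum_add_distrib, Matrix.trace, ← Finset.sum_mul]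
    simp only [Matrix.diag_apply, connMat, Matrix.of_apply]
    rw [Finset.sum_congr rfl fun p _ => mul_comm (christoffel G b a p y) _]
    ring
  rw [Finset.sum_congr rfl fun a _ => h1 a, ← Finset.mul_sum, Finset.sum_sub_distrib,
    Finset.sum_sub_distrib, Finset.sum_comm (f := fun a p => christoffel G p a p y * (G y)⁻¹ a b)]
  rw [Finset.sum_congr rfl fun a _ => Finset.sum_congr rfl fun p _ => by
    rw [h.christoffel_symm hy a p a]]
  ring

/-- The divergence `∂_a (√g wᵃᵇ)` is a multiple of `d* w`. -/
theorem sum_pd_sqrt_det_mul_raise (h : IsLocalHermitian E G w) (hy : y ∈ E) (b : Fin m) :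
    ∑ a, pd a (fun z => √(G z).det * raise G w a b z) y
      = -(1 / 2) * √(G y).det * ∑ c, codiff G w c y * (G y)⁻¹ c b := by
  have h1 : ∀ a, pd a (fun z => √(G z).det * raise G w a b z) y = √(G y).det *
      ((∑ p, christoffel G p a p y * raise G w a b y) - (∑ p, christoffel G a a p y * raise G w p b y)
        - (∑ p, raise G w a p y * christoffel G b a p y)
        + ∑ p, ∑ q, covDeriv₂ G w a p q y * (G y)⁻¹ p a * (G y)⁻¹ q b) := by
    intro a
    rw [pd_mul (h.differentiableAt_sqrt_det hy) (h.differentiableAt_raise hy a b), h.pd_sqrt_det hy,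
      h.pd_raise hy, Finset.sum_add_distrib, Matrix.trace, ← Finset.sum_mul]
    simp only [Matrix.diag_apply, connMat, Matrix.of_apply]
    rw [Finset.sum_congr rfl fun p _ => mul_comm (christoffel G b a p y) _]
    ring
  have h2 : ∑ a, ∑ p, raise G w a p y * christoffel G b a p y = 0 := by
    have : ∑ a, ∑ p, raise G w a p y * christoffel G b a p y
        = -∑ a, ∑ p, raise G w a p y * christoffel G b a p y := by
      conv_lhs => rw [Finset.sum_comm]
      rw [← Finset.sum_neg_distrib]
      refine Finset.sum_congr rfl fun a _ => ?_
      rw [← Finset.sum_neg_distrib]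
      refine Finset.sum_congr rfl fun p _ => ?_
      rw [h.raise_antisymm hy, h.christoffel_symm hy b p a]
      ring
    linarith
  rw [Finset.sum_congr rfl fun a _ => h1 a, ← Finset.mul_sum, Finset.sum_add_distrib,
    Finset.sum_sub_distrib,
    Finset.sum_sub_distrib, Finset.sum_comm (f := fun a p => christoffel G p a p y * raise G w a b y),
    h2]
  rw [Finset.sum_congr rfl fun a _ => Finset.sum_congr rfl fun p _ => by
    rw [h.christoffel_symm hy a p a]]
  have h3 : ∑ c, codiff G w c y * (G y)⁻¹ c b = -2 *
      ∑ a, ∑ p, ∑ q, covDeriv₂ G w a p q y * (G y)⁻¹ p a * (G y)⁻¹ q b := by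
    simp only [codiff, Finset.mul_sum, Finset.sum_mul]
    rw [Finset.sum_comm]
    refine Finset.sum_congr rfl fun a _ => ?_
    rw [Finset.sum_comm]
    refine Finset.sum_congr rfl fun p _ => Finset.sum_congr rfl fun q _ => ?_
    rw [h.inv_symm hy p a]
    ring
  rw [h3]
  ring

end IsLocalHermitian

/-! ### The local energy and its Euler–Lagrange operator -/

section Sums

variable {ι κ R : Type*} [CommRing R]

theorem sum_comm_four {s : Finset ι} {t : Finset κ} (F : ι → ι → κ → κ → R) :
    ∑ a ∈ s, ∑ b ∈ s, ∑ c ∈ t, ∑ e ∈ t, F a b c e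
      = ∑ c ∈ t, ∑ e ∈ t, ∑ a ∈ s, ∑ b ∈ s, F a b c e := by
  calc _ = ∑ a ∈ s, ∑ c ∈ t, ∑ e ∈ t, ∑ b ∈ s, F a b c e := by
        refine Finset.sum_congr rfl fun a _ => ?_
        rw [Finset.sum_comm]
        exact Finset.sum_congr rfl fun c _ => Finset.sum_comm
    _ = _ := by
        rw [Finset.sum_comm]
        exact Finset.sum_congr rfl fun c _ => Finset.sum_comm

theorem sum_swap_four {s : Finset ι} {t : Finset κ} (F : ι → ι → κ → κ → R) :
    ∑ a ∈ s, ∑ b ∈ s, ∑ j ∈ t, ∑ k ∈ t, F a b j k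
      = ∑ a ∈ s, ∑ b ∈ s, ∑ j ∈ t, ∑ k ∈ t, F b a k j := by
  rw [Finset.sum_comm]
  exact Finset.sum_congr rfl fun a _ => Finset.sum_congr rfl fun b _ => Finset.sum_comm

end Sums

section EulerLagrange

variable {m n : ℕ}

/-- The coefficients `gᵃᵇ hᵢⱼ - wᵃᵇ oᵢⱼ` of the quadratic form
`¼ |B + J_N B J_M|² = ½ (gᵃᵇ hᵢⱼ - wᵃᵇ oᵢⱼ) Bⁱₐ Bʲᵦ`. -/
def energyCoeff (G : Model m → Matrix (Fin m) (Fin m) ℝ) (w : Fin m → Fin m → Model m → ℝ)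
    (H : Model n → Matrix (Fin n) (Fin n) ℝ) (o : Fin n → Fin n → Model n → ℝ)
    (a b : Fin m) (i j : Fin n) (y : Model m) (z : Model n) : ℝ :=
  (G y)⁻¹ a b * H z i j - raise G w a b y * o i j z

/-- The energy density `¼ |Tu + J_N Tu J_M|²` in coordinates. -/
def energyLoc (G : Model m → Matrix (Fin m) (Fin m) ℝ) (w : Fin m → Fin m → Model m → ℝ)
    (H : Model n → Matrix (Fin n) (Fin n) ℝ) (o : Fin n → Fin n → Model n → ℝ)
    (u : Fin n → Model m → ℝ) (y : Model m) : ℝ :=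
  (1 / 2) * ∑ a, ∑ b, ∑ i, ∑ j, energyCoeff G w H o a b i j y (WithLp.toLp 2 fun l => u l y)
    * pd a (u i) y * pd b (u j) y

/-- The derivative of `energyLoc` at `u` in the direction of the vector field `W` along `u`. -/
def firstVarLoc (G : Model m → Matrix (Fin m) (Fin m) ℝ) (w : Fin m → Fin m → Model m → ℝ)
    (H : Model n → Matrix (Fin n) (Fin n) ℝ) (o : Fin n → Fin n → Model n → ℝ)
    (u W : Fin n → Model m → ℝ) (y : Model m) : ℝ :=
  (∑ a, ∑ b, ∑ i, ∑ j, energyCoeff G w H o a b i j y (WithLp.toLp 2 fun l => u l y)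
      * pd a (W i) y * pd b (u j) y)
    + (1 / 2) * ∑ a, ∑ b, ∑ i, ∑ j,
      (∑ p, pd p (energyCoeff G w H o a b i j y) (WithLp.toLp 2 fun l => u l y) * W p y)
        * pd a (u i) y * pd b (u j) y

/-- The components of `τ₊(u) = τ(u) + A(u)`. -/
def tensionPlusLoc (G : Model m → Matrix (Fin m) (Fin m) ℝ) (w : Fin m → Fin m → Model m → ℝ)
    (H : Model n → Matrix (Fin n) (Fin n) ℝ) (o : Fin n → Fin n → Model n → ℝ)
    (u : Fin n → Model m → ℝ) (l : Fin n) (y : Model m) : ℝ :=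
  tensionLoc G H u l y + aTermLoc G w H o u l y

/-- The covariant components of `2 A(u)`, with the indices of `ω_M` raised and the sums
reordered so that the metric of the target does not occur. -/
def aBracketLoc (G : Model m → Matrix (Fin m) (Fin m) ℝ) (w : Fin m → Fin m → Model m → ℝ)
    (o : Fin n → Fin n → Model n → ℝ) (u : Fin n → Model m → ℝ) (i : Fin n) (y : Model m) : ℝ :=
  (∑ b, ∑ j, (∑ a, codiff G w a y * (G y)⁻¹ a b) * o i j (WithLp.toLp 2 fun l => u l y)
      * pd b (u j) y)
    + ∑ c, ∑ e, ∑ j, ∑ k, raise G w c e y * extDeriv₂ o i j k (WithLp.toLp 2 fun l => u l y)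
      * pd c (u j) y * pd e (u k) y

theorem sum_form_eq_sum_raise (G : Model m → Matrix (Fin m) (Fin m) ℝ)
    (w : Fin m → Fin m → Model m → ℝ) (y : Model m) (X : Fin m → Fin m → Fin n → Fin n → ℝ) :
    ∑ a, ∑ b, ∑ c, ∑ e, ∑ j, ∑ k, w a b y * X c e j k * (G y)⁻¹ a c * (G y)⁻¹ b e
      = ∑ c, ∑ e, ∑ j, ∑ k, raise G w c e y * X c e j k := by
  rw [sum_comm_four]
  refine Finset.sum_congr rfl fun c _ => Finset.sum_congr rfl fun e _ => ?_
  simp only [raise, ← Finset.mul_sum]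
  simp only [Finset.sum_mul]
  refine Finset.sum_congr rfl fun a _ => Finset.sum_congr rfl fun b _ => ?_
  simp only [← Finset.sum_mul, ← Finset.mul_sum]
  ring

theorem sum_codiff_eq (G : Model m → Matrix (Fin m) (Fin m) ℝ)
    (w : Fin m → Fin m → Model m → ℝ) (y : Model m) (X : Fin m → Fin n → ℝ) :
    ∑ a, ∑ b, ∑ j, codiff G w a y * X b j * (G y)⁻¹ a b
      = ∑ b, ∑ j, (∑ a, codiff G w a y * (G y)⁻¹ a b) * X b j := by
  rw [Finset.sum_comm]
  refine Finset.sum_congr rfl fun b _ => ?_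
  rw [Finset.sum_comm]
  refine Finset.sum_congr rfl fun j _ => ?_
  rw [Finset.sum_mul]
  exact Finset.sum_congr rfl fun a _ => by ring

theorem aTermLoc_eq (G : Model m → Matrix (Fin m) (Fin m) ℝ)
    (w : Fin m → Fin m → Model m → ℝ) (H : Model n → Matrix (Fin n) (Fin n) ℝ)
    (o : Fin n → Fin n → Model n → ℝ) (u : Fin n → Model m → ℝ) (l : Fin n) (y : Model m) :
    aTermLoc G w H o u l y
      = (1 / 2) * ∑ i, (H (WithLp.toLp 2 fun l => u l y))⁻¹ i l * aBracketLoc G w o u i y := by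
  simp only [aTermLoc, aBracketLoc]
  congr 1
  refine Finset.sum_congr rfl fun i _ => ?_
  have h1 := sum_codiff_eq G w y fun b j => pd b (u j) y * o i j (WithLp.toLp 2 fun l => u l y)
  have h2 := sum_form_eq_sum_raise G w y fun c e j k => pd c (u j) y * pd e (u k) y *
    extDeriv₂ o i j k (WithLp.toLp 2 fun l => u l y)
  simp only [← mul_assoc] at h1 h2
  rw [h1, h2]
  congr 2
  · exact Finset.sum_congr rfl fun b _ => Finset.sum_congr rfl fun j _ => by ring
  · exact Finset.sum_congr rfl fun b _ => Finset.sum_congr rfl fun j _ =>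
      Finset.sum_congr rfl fun b _ => Finset.sum_congr rfl fun j _ => by ring

variable {E : Set (Model m)} {E' : Set (Model n)}
  {G : Model m → Matrix (Fin m) (Fin m) ℝ} {w : Fin m → Fin m → Model m → ℝ}
  {H : Model n → Matrix (Fin n) (Fin n) ℝ} {o : Fin n → Fin n → Model n → ℝ}
  {u : Fin n → Model m → ℝ} {y : Model m}

theorem IsLocalHermitian.sum_metric_mul_inv {z : Model n} (h : IsLocalHermitian E' H o)
    (hz : z ∈ E') (i : Fin n) (B : Fin n → ℝ) : ∑ l, H z i l * ∑ p, (H z)⁻¹ p l * B p = B i := by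
  have h2 := congrFun (congrArg (fun A : Matrix (Fin n) (Fin n) ℝ => A.mulVec B)
    (Matrix.mul_nonsing_inv _ (h.isUnit_det hz))) i
  simp only [← Matrix.mulVec_mulVec, Matrix.one_mulVec] at h2
  rw [← h2]
  simp only [Matrix.mulVec, dotProduct]
  refine Finset.sum_congr rfl fun l _ => ?_
  congr 1
  exact Finset.sum_congr rfl fun p _ => by rw [h.inv_symm hz]

theorem sum_metric_mul_aTermLoc (h' : IsLocalHermitian E' H o)
    (hz : (WithLp.toLp 2 fun l => u l y : Model n) ∈ E') (i : Fin n) :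
    ∑ l, H (WithLp.toLp 2 fun l => u l y) i l * aTermLoc G w H o u l y
      = (1 / 2) * aBracketLoc G w o u i y := by
  have := h'.sum_metric_mul_inv hz i fun p => (1 / 2) * aBracketLoc G w o u p y
  rw [← this]
  refine Finset.sum_congr rfl fun l _ => ?_
  rw [aTermLoc_eq, Finset.mul_sum]
  congr 1
  exact Finset.sum_congr rfl fun p _ => by ring

theorem sum_metric_mul_tensionLoc (h' : IsLocalHermitian E' H o)
    (hz : (WithLp.toLp 2 fun l => u l y : Model n) ∈ E') (i : Fin n) :
    ∑ l, H (WithLp.toLp 2 fun l => u l y) i l * tensionLoc G H u l y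
      = (∑ a, ∑ b, ∑ j, (G y)⁻¹ a b * H (WithLp.toLp 2 fun l => u l y) i j * pd a (pd b (u j)) y)
        - (∑ c, ∑ j, (∑ a, ∑ b, (G y)⁻¹ a b * christoffel G c a b y)
            * H (WithLp.toLp 2 fun l => u l y) i j * pd c (u j) y)
        + ∑ a, ∑ b, ∑ j, ∑ k, (G y)⁻¹ a b * ((1 / 2) *
            (pd j (fun z => H z k i) (WithLp.toLp 2 fun l => u l y)
              + pd k (fun z => H z j i) (WithLp.toLp 2 fun l => u l y)
              - pd i (fun z => H z j k) (WithLp.toLp 2 fun l => u l y)))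
            * pd a (u j) y * pd b (u k) y := by
  set z : Model n := WithLp.toLp 2 fun l => u l y with hzdef
  have e2 : (∑ c, ∑ j, (∑ a, ∑ b, (G y)⁻¹ a b * christoffel G c a b y) * H z i j * pd c (u j) y)
      = ∑ a, ∑ b, ∑ j, ∑ c, (G y)⁻¹ a b * christoffel G c a b y * H z i j * pd c (u j) y := by
    simp only [Finset.sum_mul]
    calc _ = ∑ c, ∑ a, ∑ b, ∑ j, (G y)⁻¹ a b * christoffel G c a b y * H z i j * pd c (u j) y := by
          refine Finset.sum_congr rfl fun c _ => ?_
          rw [Finset.sum_comm]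
          exact Finset.sum_congr rfl fun a _ => Finset.sum_comm
      _ = _ := by
          rw [Finset.sum_comm]
          refine Finset.sum_congr rfl fun a _ => ?_
          rw [Finset.sum_comm]
          exact Finset.sum_congr rfl fun b _ => Finset.sum_comm
  rw [e2]
  simp only [tensionLoc, Finset.mul_sum]
  rw [Finset.sum_comm, ← Finset.sum_sub_distrib, ← Finset.sum_add_distrib]
  refine Finset.sum_congr rfl fun a _ => ?_
  rw [Finset.sum_comm, ← Finset.sum_sub_distrib, ← Finset.sum_add_distrib]
  refine Finset.sum_congr rfl fun b _ => ?_
  have e3 : ∑ j, ∑ k, (G y)⁻¹ a b * ((1 / 2) * (pd j (fun z => H z k i) z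
      + pd k (fun z => H z j i) z - pd i (fun z => H z j k) z)) * pd a (u j) y * pd b (u k) y
      = ∑ l, H z i l * ((G y)⁻¹ a b * ∑ j, ∑ k, pd a (u j) y * pd b (u k) y
        * christoffel H l j k z) := by
    simp only [← h'.sum_metric_mul_christoffel hz, Finset.mul_sum, Finset.sum_mul]
    refine (Finset.sum_congr rfl fun _ _ => Finset.sum_comm).trans ?_
    rw [Finset.sum_comm]
    exact Finset.sum_congr rfl fun _ _ => Finset.sum_congr rfl fun _ _ =>
      Finset.sum_congr rfl fun _ _ => by ring
  rw [e3, ← Finset.sum_sub_distrib, ← Finset.sum_add_distrib]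
  refine Finset.sum_congr rfl fun l _ => ?_
  rw [← hzdef, mul_add, mul_sub, Finset.mul_sum]
  rw [mul_add, mul_sub, Finset.mul_sum]
  congr 1
  congr 1
  · ring
  · exact Finset.sum_congr rfl fun _ _ => by ring

theorem sum_pd_coeff_mul (A : Fin m → Fin m → Model m → ℝ) (c : Fin n → Model n → ℝ)
    (hA : ∀ a b, DifferentiableAt ℝ (A a b) y)
    (hc : ∀ j, DifferentiableAt ℝ (c j) (WithLp.toLp 2 fun l => u l y))
    (hu : ∀ j, DifferentiableAt ℝ (u j) y) (hu2 : ∀ b j, DifferentiableAt ℝ (pd b (u j)) y) :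
    ∑ a, pd a (fun y => ∑ b, ∑ j, A a b y * c j (WithLp.toLp 2 fun l => u l y) * pd b (u j) y) y
      = (∑ b, ∑ j, (∑ a, pd a (A a b) y) * c j (WithLp.toLp 2 fun l => u l y) * pd b (u j) y)
        + (∑ a, ∑ b, ∑ j, ∑ k, A a b y * pd j (c k) (WithLp.toLp 2 fun l => u l y)
            * pd a (u j) y * pd b (u k) y)
        + ∑ a, ∑ b, ∑ j, A a b y * c j (WithLp.toLp 2 fun l => u l y) * pd a (pd b (u j)) y := by
  have e1 : (∑ b, ∑ j, (∑ a, pd a (A a b) y) * c j (WithLp.toLp 2 fun l => u l y) * pd b (u j) y)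
      = ∑ a, ∑ b, ∑ j, pd a (A a b) y * c j (WithLp.toLp 2 fun l => u l y) * pd b (u j) y := by
    simp only [Finset.sum_mul]
    rw [Finset.sum_comm]
    calc _ = ∑ j, ∑ a, ∑ b, pd a (A a b) y * c j (WithLp.toLp 2 fun l => u l y) * pd b (u j) y :=
          Finset.sum_congr rfl fun _ _ => Finset.sum_comm
      _ = _ := by
          rw [Finset.sum_comm]
          exact Finset.sum_congr rfl fun _ _ => Finset.sum_comm
  have hcu : ∀ j, DifferentiableAt ℝ (fun y => c j (WithLp.toLp 2 fun l => u l y)) y := fun j =>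
    (hc j).comp y (differentiableAt_toLp hu)
  rw [e1, ← Finset.sum_add_distrib, ← Finset.sum_add_distrib]
  refine Finset.sum_congr rfl fun a _ => ?_
  rw [pd_sum fun b _ => DifferentiableAt.fun_sum fun j _ =>
      ((hA a b).fun_mul (hcu j)).fun_mul (hu2 b j),
    ← Finset.sum_add_distrib, ← Finset.sum_add_distrib]
  refine Finset.sum_congr rfl fun b _ => ?_
  rw [pd_sum fun j _ => ((hA a b).fun_mul (hcu j)).fun_mul (hu2 b j),
    Finset.sum_comm (f := fun j k => A a b y * pd j (c k) (WithLp.toLp 2 fun l => u l y)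
            * pd a (u j) y * pd b (u k) y), ← Finset.sum_add_distrib, ← Finset.sum_add_distrib]
  refine Finset.sum_congr rfl fun j _ => ?_
  rw [pd_mul ((hA a b).fun_mul (hcu j)) (hu2 b j), pd_mul (hA a b) (hcu j), pd_comp (hc j) hu a]
  simp only [add_mul, Finset.mul_sum, Finset.sum_mul]
  congr 2
  exact Finset.sum_congr rfl fun _ _ => by ring

theorem pd_energyCoeff {z : Model n} (h' : IsLocalHermitian E' H o) (hz : z ∈ E')
    (a b : Fin m) (i j p : Fin n) :
    pd p (energyCoeff G w H o a b i j y) z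
      = (G y)⁻¹ a b * pd p (fun z => H z i j) z - raise G w a b y * pd p (o i j) z := by
  have h1 := h'.differentiableAt_metric hz i j
  have h2 := h'.differentiableAt_form hz i j
  unfold energyCoeff
  rw [pd_sub (h1.const_mul _) (h2.const_mul _), pd_mul (differentiableAt_const _) h1,
    pd_mul (differentiableAt_const _) h2]
  simp

/-- The Euler–Lagrange identity: the divergence of the momentum `∂e/∂uⁱₐ` differs from the force
`∂e/∂uⁱ` by the covariant components of `τ₊`. -/
theorem sum_pd_momentum (h : IsLocalHermitian E G w) (h' : IsLocalHermitian E' H o) (hy : y ∈ E)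
    (hz : (WithLp.toLp 2 fun l => u l y : Model n) ∈ E')
    {s : Set (Model m)} (hs : IsOpen s) (hys : y ∈ s) (hu : ∀ j, ContDiffOn ℝ 2 (u j) s)
    (i : Fin n) :
    ∑ a, pd a (fun y => ∑ b, ∑ j, √(G y).det *
        energyCoeff G w H o a b i j y (WithLp.toLp 2 fun l => u l y) * pd b (u j) y) y
      = √(G y).det * ((1 / 2) * ∑ a, ∑ b, ∑ j, ∑ k,
          pd i (energyCoeff G w H o a b j k y) (WithLp.toLp 2 fun l => u l y)
            * pd a (u j) y * pd b (u k) y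
        + ∑ l, H (WithLp.toLp 2 fun l => u l y) i l * tensionPlusLoc G w H o u l y) := by
  have hu1 : ∀ j, DifferentiableAt ℝ (u j) y := fun j =>
    ((hu j).contDiffAt (hs.mem_nhds hys)).differentiableAt (by norm_num)
  have hu2 : ∀ b j, DifferentiableAt ℝ (pd b (u j)) y := fun b j =>
    ((contDiffOn_pd hs (hu j) (l := 1) (by norm_num) b).contDiffAt
      (hs.mem_nhds hys)).differentiableAt (by norm_num)
  have hS := h.differentiableAt_sqrt_det hy
  have hI := h.differentiableAt_inv hy
  have hR := h.differentiableAt_raise hy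
  have hHd := fun i j => h'.differentiableAt_metric hz i j
  have hod := fun i j => h'.differentiableAt_form hz i j
  have E1 := sum_pd_coeff_mul (u := u) (y := y) (fun a b y => √(G y).det * (G y)⁻¹ a b)
    (fun j z => H z i j) (fun a b => hS.fun_mul (hI a b)) (hHd i) hu1 hu2
  have E2 := sum_pd_coeff_mul (u := u) (y := y) (fun a b y => √(G y).det * raise G w a b y)
    (fun j z => o i j z) (fun a b => hS.fun_mul (hR a b)) (hod i) hu1 hu2
  have hHu : ∀ i j, DifferentiableAt ℝ (fun y => H (WithLp.toLp 2 fun l => u l y) i j) y :=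
    fun i j => DifferentiableAt.comp (g := fun z => H z i j) y (hHd i j) (differentiableAt_toLp hu1)
  have hou : ∀ i j, DifferentiableAt ℝ (fun y => o i j (WithLp.toLp 2 fun l => u l y)) y :=
    fun i j => (hod i j).comp y (differentiableAt_toLp hu1)
  have hsplit : ∑ a, pd a (fun y => ∑ b, ∑ j, √(G y).det *
        energyCoeff G w H o a b i j y (WithLp.toLp 2 fun l => u l y) * pd b (u j) y) y
      = (∑ a, pd a (fun y => ∑ b, ∑ j, (√(G y).det * (G y)⁻¹ a b)
          * H (WithLp.toLp 2 fun l => u l y) i j * pd b (u j) y) y)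
        - ∑ a, pd a (fun y => ∑ b, ∑ j, (√(G y).det * raise G w a b y)
          * o i j (WithLp.toLp 2 fun l => u l y) * pd b (u j) y) y := by
    rw [← Finset.sum_sub_distrib]
    refine Finset.sum_congr rfl fun a _ => ?_
    rw [← pd_sub (DifferentiableAt.fun_sum fun b _ => DifferentiableAt.fun_sum fun j _ =>
        ((hS.fun_mul (hI a b)).fun_mul (hHu i j)).fun_mul (hu2 b j))
      (DifferentiableAt.fun_sum fun b _ => DifferentiableAt.fun_sum fun j _ =>
        ((hS.fun_mul (hR a b)).fun_mul (hou i j)).fun_mul (hu2 b j))]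
    congr 1
    ext y
    simp only [← Finset.sum_sub_distrib]
    refine Finset.sum_congr rfl fun _ _ => Finset.sum_congr rfl fun _ _ => ?_
    simp only [energyCoeff]
    ring
  rw [hsplit, E1, E2]
  simp only [h.sum_pd_sqrt_det_mul_inv hy, h.sum_pd_sqrt_det_mul_raise hy]
  simp only [tensionPlusLoc, mul_add, Finset.sum_add_distrib]
  rw [sum_metric_mul_tensionLoc h' hz, sum_metric_mul_aTermLoc h' hz]
  simp only [pd_energyCoeff h' hz, aBracketLoc]
  set z : Model n := WithLp.toLp 2 fun l => u l y with hzdef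
  set S := √(G y).det
  -- the second derivatives of `u` are symmetric, so they do not pair with `w`
  have Z1 : ∑ a, ∑ b, ∑ j, S * raise G w a b y * o i j z * pd a (pd b (u j)) y = 0 := by
    have : ∑ a, ∑ b, ∑ j, S * raise G w a b y * o i j z * pd a (pd b (u j)) y
        = -∑ a, ∑ b, ∑ j, S * raise G w a b y * o i j z * pd a (pd b (u j)) y := by
      conv_lhs => rw [Finset.sum_comm]
      simp only [← Finset.sum_neg_distrib]
      refine Finset.sum_congr rfl fun a _ => Finset.sum_congr rfl fun b _ =>
        Finset.sum_congr rfl fun j _ => ?_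
      rw [h.raise_antisymm hy, pd_comm hs (hu j) hys a b]
      ring
    linarith
  -- the derivatives of the metric of the target
  have Z2 : ∑ a, ∑ b, ∑ j, ∑ k, (G y)⁻¹ a b * ((1 / 2) * (pd j (fun z => H z k i) z
        + pd k (fun z => H z j i) z - pd i (fun z => H z j k) z)) * pd a (u j) y * pd b (u k) y
      = (∑ a, ∑ b, ∑ j, ∑ k, (G y)⁻¹ a b * pd j (fun z => H z i k) z * pd a (u j) y * pd b (u k) y)
        - (1 / 2) * ∑ a, ∑ b, ∑ j, ∑ k,
          (G y)⁻¹ a b * pd i (fun z => H z j k) z * pd a (u j) y * pd b (u k) y := by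
    have : ∑ a, ∑ b, ∑ j, ∑ k, (G y)⁻¹ a b * pd j (fun z => H z i k) z * pd a (u j) y * pd b (u k) y
        = (1 / 2) * (∑ a, ∑ b, ∑ j, ∑ k,
            (G y)⁻¹ a b * pd j (fun z => H z i k) z * pd a (u j) y * pd b (u k) y)
          + (1 / 2) * ∑ a, ∑ b, ∑ j, ∑ k,
            (G y)⁻¹ a b * pd k (fun z => H z j i) z * pd a (u j) y * pd b (u k) y := by
      rw [sum_swap_four (fun a b j k => (G y)⁻¹ a b * pd k (fun z => H z j i) z
        * pd a (u j) y * pd b (u k) y)]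
      have : ∑ a, ∑ b, ∑ j, ∑ k, (G y)⁻¹ b a * pd j (fun z => H z k i) z * pd b (u k) y * pd a (u j) y
          = ∑ a, ∑ b, ∑ j, ∑ k,
            (G y)⁻¹ a b * pd j (fun z => H z i k) z * pd a (u j) y * pd b (u k) y := by
        refine Finset.sum_congr rfl fun a _ => Finset.sum_congr rfl fun b _ =>
          Finset.sum_congr rfl fun j _ => Finset.sum_congr rfl fun k _ => ?_
        rw [h.inv_symm hy b a, h'.pd_metric_symm hz j k i]
        ring
      rw [this]
      ring
    rw [this]
    simp only [Finset.mul_sum, ← Finset.sum_add_distrib, ← Finset.sum_sub_distrib]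
    refine Finset.sum_congr rfl fun a _ => Finset.sum_congr rfl fun b _ =>
        Finset.sum_congr rfl fun j _ => Finset.sum_congr rfl fun k _ => ?_
    rw [h'.pd_metric_symm hz j k i]
    ring
  -- the exterior derivative of the form of the target
  have Z3 : ∑ c, ∑ e, ∑ j, ∑ k, raise G w c e y * extDeriv₂ o i j k z * pd c (u j) y * pd e (u k) y
      = -2 * (∑ a, ∑ b, ∑ j, ∑ k, raise G w a b y * pd j (o i k) z * pd a (u j) y * pd b (u k) y)
        + ∑ a, ∑ b, ∑ j, ∑ k, raise G w a b y * pd i (o j k) z * pd a (u j) y * pd b (u k) y := by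
    have : ∑ a, ∑ b, ∑ j, ∑ k, raise G w a b y * pd k (o i j) z * pd a (u j) y * pd b (u k) y
        = -∑ a, ∑ b, ∑ j, ∑ k, raise G w a b y * pd j (o i k) z * pd a (u j) y * pd b (u k) y := by
      rw [sum_swap_four]
      simp only [← Finset.sum_neg_distrib]
      refine Finset.sum_congr rfl fun a _ => Finset.sum_congr rfl fun b _ =>
        Finset.sum_congr rfl fun j _ => Finset.sum_congr rfl fun k _ => ?_
      rw [h.raise_antisymm hy b a]
      ring
    have e3 : -2 * (∑ a, ∑ b, ∑ j, ∑ k,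
          raise G w a b y * pd j (o i k) z * pd a (u j) y * pd b (u k) y)
        = -(∑ a, ∑ b, ∑ j, ∑ k, raise G w a b y * pd j (o i k) z * pd a (u j) y * pd b (u k) y)
          + ∑ a, ∑ b, ∑ j, ∑ k, raise G w a b y * pd k (o i j) z * pd a (u j) y * pd b (u k) y := by
      rw [this]; ring
    rw [e3]
    simp only [← Finset.sum_neg_distrib, ← Finset.sum_add_distrib]
    refine Finset.sum_congr rfl fun a _ => Finset.sum_congr rfl fun b _ =>
        Finset.sum_congr rfl fun j _ => Finset.sum_congr rfl fun k _ => ?_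
    rw [extDeriv₂, h'.pd_form_antisymm hz j k i]
    ring
  rw [Z1, Z2, Z3]
  have W1 : ∑ b, ∑ j, (-S * ∑ a, ∑ c, (G y)⁻¹ a c * christoffel G b a c y) * H z i j * pd b (u j) y
      = -S * ∑ b, ∑ j, (∑ a, ∑ c, (G y)⁻¹ a c * christoffel G b a c y) * H z i j * pd b (u j) y := by
    simp only [Finset.mul_sum, Finset.sum_mul, mul_assoc]
  have W2 : ∑ b, ∑ j, (-(1 / 2) * S * ∑ c, codiff G w c y * (G y)⁻¹ c b) * o i j z * pd b (u j) y
      = -(1 / 2) * S * ∑ b, ∑ j, (∑ c, codiff G w c y * (G y)⁻¹ c b) * o i j z * pd b (u j) y := by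
    simp only [Finset.mul_sum, Finset.sum_mul, mul_assoc]
  have W3 : ∀ (A : Fin m → Fin m → ℝ) (c : Fin n → Fin n → ℝ),
      ∑ a, ∑ b, ∑ j, ∑ k, S * A a b * c j k * pd a (u j) y * pd b (u k) y
        = S * ∑ a, ∑ b, ∑ j, ∑ k, A a b * c j k * pd a (u j) y * pd b (u k) y := by
    intro A c
    simp only [Finset.mul_sum, mul_assoc]
  have W4 : ∑ a, ∑ b, ∑ j, S * (G y)⁻¹ a b * H z i j * pd a (pd b (u j)) y
      = S * ∑ a, ∑ b, ∑ j, (G y)⁻¹ a b * H z i j * pd a (pd b (u j)) y := by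
    simp only [Finset.mul_sum, mul_assoc]
  have W5 : ∑ a, ∑ b, ∑ j, ∑ k, ((G y)⁻¹ a b * pd i (fun z => H z j k) z
        - raise G w a b y * pd i (o j k) z) * pd a (u j) y * pd b (u k) y
      = (∑ a, ∑ b, ∑ j, ∑ k, (G y)⁻¹ a b * pd i (fun z => H z j k) z * pd a (u j) y * pd b (u k) y)
        - ∑ a, ∑ b, ∑ j, ∑ k, raise G w a b y * pd i (o j k) z * pd a (u j) y * pd b (u k) y := by
    simp only [sub_mul, Finset.sum_sub_distrib]
  have W6 := W3 (fun a b => (G y)⁻¹ a b) fun j k => pd j (fun z => H z i k) z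
  have W7 := W3 (fun a b => raise G w a b y) fun j k => pd j (o i k) z
  beta_reduce at W6 W7
  rw [W1, W2, W6, W7, W4, W5]
  ring

end EulerLagrange

/-! ### Families of functions depending on a parameter -/

section Families

variable {m n : ℕ}

/-- The `i`-th spatial partial derivative of a function on `ℝᵐ × ℝ`. -/
def spd (i : Fin m) (U : Model m × ℝ → ℝ) (q : Model m × ℝ) : ℝ := pd i (fun y => U (y, q.2)) q.1

theorem spd_eq_fderiv {U : Model m × ℝ → ℝ} {q : Model m × ℝ} (h : DifferentiableAt ℝ U q)
    (i : Fin m) : spd i U q = fderiv ℝ U q (stdVec i, 0) := by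
  have h1 : HasFDerivAt (fun y : Model m => (y, q.2)) (ContinuousLinearMap.inl ℝ (Model m) ℝ) q.1 :=
    hasFDerivAt_prodMk_left q.1 q.2
  have h2 := (show HasFDerivAt U (fderiv ℝ U q) (q.1, q.2) from h.hasFDerivAt).comp q.1 h1
  have h3 : fderiv ℝ (fun y => U (y, q.2)) q.1 = _ := h2.fderiv
  rw [spd, pd, h3]
  simp

theorem contDiffOn_spd {U : Model m × ℝ → ℝ} {D : Set (Model m × ℝ)} (hD : IsOpen D)
    {k l : WithTop ℕ∞} (hU : ContDiffOn ℝ k U D) (hl : l + 1 ≤ k) (i : Fin m) :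
    ContDiffOn ℝ l (spd i U) D := by
  have hk : k ≠ 0 := by
    rintro rfl
    simp at hl
  refine ContDiffOn.congr (f := fun q => fderiv ℝ U q (stdVec i, 0)) ?_ fun q hq =>
    spd_eq_fderiv (((hU q hq).contDiffAt (hD.mem_nhds hq)).differentiableAt hk) i
  exact (hU.fderiv_of_isOpen hD hl).clm_apply contDiffOn_const

theorem hasDerivAt_line {U : Model m × ℝ → ℝ} {y : Model m} {x s : ℝ} (i : Fin m)
    (h : DifferentiableAt ℝ U (y + x • stdVec i, s)) :
    HasDerivAt (fun x => U (y + x • stdVec i, s)) (spd i U (y + x • stdVec i, s)) x := by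
  have h1 : HasDerivAt (fun x : ℝ => ((y + x • stdVec i, s) : Model m × ℝ)) (stdVec i, 0) x :=
    HasDerivAt.prodMk (by simpa using ((hasDerivAt_id x).smul_const (stdVec i)).const_add y)
      (hasDerivAt_const x s)
  rw [spd_eq_fderiv h]
  exact h.hasFDerivAt.comp_hasDerivAt x h1

/-- Spatial derivatives commute with the derivative in the parameter, for functions that are only
`C¹` but whose derivative in the parameter is again `C¹`. -/
theorem hasDerivAt_spd {U V : Model m × ℝ → ℝ} {D : Set (Model m × ℝ)} (hD : IsOpen D)
    (hU : ContDiffOn ℝ 1 U D) (hV : ContDiffOn ℝ 1 V D)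
    (hUV : ∀ q ∈ D, HasDerivAt (fun s => U (q.1, s)) (V q) q.2) (i : Fin m)
    {q : Model m × ℝ} (hq : q ∈ D) :
    HasDerivAt (fun s => spd i U (q.1, s)) (spd i V q) q.2 := by
  obtain ⟨y, t⟩ := q
  have hVd : ∀ q ∈ D, DifferentiableAt ℝ V q := fun q hq =>
    ((hV q hq).contDiffAt (hD.mem_nhds hq)).differentiableAt (by norm_num)
  have hUd : ∀ q ∈ D, DifferentiableAt ℝ U q := fun q hq =>
    ((hU q hq).contDiffAt (hD.mem_nhds hq)).differentiableAt (by norm_num)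
  have hc : ContinuousAt (fun p : ℝ × ℝ => spd i V (y + p.1 • stdVec i, p.2)) (0, t) := by
    have h1 : ContinuousAt (spd i V) (y + (0 : ℝ) • stdVec i, t) := by
      simpa using ((contDiffOn_spd hD hV (l := 0) (by norm_num) i).continuousOn.continuousAt
        (hD.mem_nhds hq))
    exact ContinuousAt.comp (x := ((0, t) : ℝ × ℝ))
      (f := fun p : ℝ × ℝ => ((y + p.1 • stdVec i, p.2) : Model m × ℝ)) h1 (by fun_prop)
  have hDn : ∀ᶠ p : ℝ × ℝ in 𝓝 (0, t), ((y + p.1 • stdVec i, p.2) : Model m × ℝ) ∈ D := by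
    have : ContinuousAt (fun p : ℝ × ℝ => ((y + p.1 • stdVec i, p.2) : Model m × ℝ)) (0, t) := by
      fun_prop
    exact this.eventually (hD.mem_nhds (by simpa using hq))
  rw [hasDerivAt_iff_isLittleO, Asymptotics.isLittleO_iff]
  intro ε hε
  obtain ⟨δ, hδ, hball⟩ := Metric.eventually_nhds_iff_ball.1
    ((Metric.continuousAt_iff'.1 hc ε hε).and hDn)
  have hmem : ∀ x s : ℝ, x ∈ Metric.ball (0 : ℝ) δ → s ∈ Metric.ball t δ →
      |spd i V (y + x • stdVec i, s) - spd i V (y, t)| ≤ ε ∧ (y + x • stdVec i, s) ∈ D := by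
    intro x s hx hs
    have := hball (x, s) (by rw [← ball_prod_same]; exact ⟨hx, hs⟩)
    simp only [zero_smul, add_zero, Real.dist_eq] at this
    exact ⟨this.1.le, this.2⟩
  have h0 : (0 : ℝ) ∈ Metric.ball (0 : ℝ) δ := Metric.mem_ball_self hδ
  have ht : t ∈ Metric.ball t δ := Metric.mem_ball_self hδ
  filter_upwards [Metric.ball_mem_nhds t hδ] with s hs
  set L := spd i V (y, t) with hL
  -- the mean value inequality in the spatial variable
  have h1 : ∀ x ∈ Metric.ball (0 : ℝ) δ, ∀ r ∈ Metric.ball t δ,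
      ‖V (y + x • stdVec i, r) - V (y, r) - x * L‖ ≤ ε * |x| := by
    intro x hx r hr
    have := (convex_ball (0 : ℝ) δ).norm_image_sub_le_of_norm_hasDerivWithin_le
      (f := fun x => V (y + x • stdVec i, r) - x * L)
      (f' := fun x => spd i V (y + x • stdVec i, r) - L) (C := ε) (x := 0) (y := x)
      (fun x hx => by
        have h := (hasDerivAt_line i (hVd _ (hmem x r hx hr).2)).fun_sub
          ((hasDerivAt_id x).mul_const L)
        simpa using h.hasDerivWithinAt) (fun x hx => (hmem x r hx hr).1) h0 hx
    simpa [sub_right_comm] using this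
  -- the mean value inequality in the parameter
  have h2 : ∀ x ∈ Metric.ball (0 : ℝ) δ,
      ‖(U (y + x • stdVec i, s) - U (y, s) - s * (x * L))
        - (U (y + x • stdVec i, t) - U (y, t) - t * (x * L))‖ ≤ ε * |x| * |s - t| := by
    intro x hx
    refine (convex_ball t δ).norm_image_sub_le_of_norm_hasDerivWithin_le
      (f := fun r => U (y + x • stdVec i, r) - U (y, r) - r * (x * L))
      (f' := fun r => V (y + x • stdVec i, r) - V (y, r) - x * L) (C := ε * |x|)
      (fun r hr => ?_) (fun r hr => h1 x hx r hr) ht hs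
    have a1 := hUV _ (hmem x r hx hr).2
    have a2 := hUV (y, r) (by simpa using (hmem 0 r h0 hr).2)
    have h := (a1.fun_sub a2).fun_sub ((hasDerivAt_id r).mul_const (x * L))
    simpa using h.hasDerivWithinAt
  -- division by `x` and the limit `x → 0`
  have hlim : ∀ r ∈ Metric.ball t δ, Filter.Tendsto
      (fun x : ℝ => x⁻¹ * (U (y + x • stdVec i, r) - U (y, r))) (𝓝[≠] 0) (𝓝 (spd i U (y, r))) := by
    intro r hr
    have hr' := (hmem 0 r h0 hr).2
    have := (hasDerivAt_line i (hUd _ hr')).tendsto_slope_zero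
    simpa using this
  have hfin : Filter.Tendsto (fun x : ℝ => ‖x⁻¹ * (U (y + x • stdVec i, s) - U (y, s))
      - x⁻¹ * (U (y + x • stdVec i, t) - U (y, t)) - (s - t) * L‖) (𝓝[≠] 0)
      (𝓝 ‖spd i U (y, s) - spd i U (y, t) - (s - t) * L‖) :=
    (((hlim s hs).sub (hlim t ht)).sub_const _).norm
  refine le_of_tendsto hfin ?_
  filter_upwards [self_mem_nhdsWithin, mem_nhdsWithin_of_mem_nhds (Metric.ball_mem_nhds 0 hδ)]
    with x hx0 hx
  have hx0' : x ≠ 0 := hx0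
  have e : x⁻¹ * (U (y + x • stdVec i, s) - U (y, s))
      - x⁻¹ * (U (y + x • stdVec i, t) - U (y, t)) - (s - t) * L
      = x⁻¹ * ((U (y + x • stdVec i, s) - U (y, s) - s * (x * L))
        - (U (y + x • stdVec i, t) - U (y, t) - t * (x * L))) := by
    field_simp
    ring
  rw [e, norm_mul, norm_inv]
  have hxp : 0 < ‖x‖ := norm_pos_iff.2 hx0'
  calc ‖x‖⁻¹ * _ ≤ ‖x‖⁻¹ * (ε * |x| * |s - t|) := by gcongr; exact h2 x hx
    _ = ε * ‖s - t‖ := by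
      rw [Real.norm_eq_abs, Real.norm_eq_abs] at *
      field_simp

end Families

/-! ### Functions that are continuously differentiable in a parameter -/

/-- `f` is continuous on `D`, and so is its derivative in the second variable. -/
def IsParamC1 {X : Type*} [TopologicalSpace X] (D : Set (X × ℝ)) (f : X × ℝ → ℝ) : Prop :=
  ContinuousOn f D ∧ ∃ f' : X × ℝ → ℝ, ContinuousOn f' D ∧
    ∀ q ∈ D, HasDerivAt (fun s => f (q.1, s)) (f' q) q.2

namespace IsParamC1

variable {X : Type*} [TopologicalSpace X] {D : Set (X × ℝ)} {f f₁ f₂ : X × ℝ → ℝ}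

theorem of_fst {c : X → ℝ} (h : ContinuousOn (fun q : X × ℝ => c q.1) D) :
    IsParamC1 D fun q => c q.1 :=
  ⟨h, fun _ => 0, continuousOn_const, fun q _ => hasDerivAt_const q.2 (c q.1)⟩

theorem const (c : ℝ) : IsParamC1 D fun _ => c := 
  of_fst (c := fun _ => c) continuousOn_const

theorem add (h₁ : IsParamC1 D f₁) (h₂ : IsParamC1 D f₂) :
    IsParamC1 D fun q => f₁ q + f₂ q := by
  obtain ⟨c₁, f₁', c₁', d₁⟩ := h₁
  obtain ⟨c₂, f₂', c₂', d₂⟩ := h₂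
  exact ⟨c₁.add c₂, _, c₁'.add c₂', fun q hq => (d₁ q hq).add (d₂ q hq)⟩

theorem sub (h₁ : IsParamC1 D f₁) (h₂ : IsParamC1 D f₂) :
    IsParamC1 D fun q => f₁ q - f₂ q := by
  obtain ⟨c₁, f₁', c₁', d₁⟩ := h₁
  obtain ⟨c₂, f₂', c₂', d₂⟩ := h₂
  exact ⟨c₁.sub c₂, _, c₁'.sub c₂', fun q hq => (d₁ q hq).sub (d₂ q hq)⟩

theorem mul (h₁ : IsParamC1 D f₁) (h₂ : IsParamC1 D f₂) :
    IsParamC1 D fun q => f₁ q * f₂ q := by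
  obtain ⟨c₁, f₁', c₁', d₁⟩ := h₁
  obtain ⟨c₂, f₂', c₂', d₂⟩ := h₂
  exact ⟨c₁.mul c₂, fun q => f₁' q * f₂ q + f₁ q * f₂' q,
    (c₁'.mul c₂).add (c₁.mul c₂'), fun q hq => (d₁ q hq).mul (d₂ q hq)⟩

theorem sum {ι : Type*} {s : Finset ι} {f : ι → X × ℝ → ℝ} (h : ∀ k ∈ s, IsParamC1 D (f k)) :
    IsParamC1 D fun q => ∑ k ∈ s, f k q := by
  classical
  induction s using Finset.induction_on with
  | empty => simpa using const 0
  | insert k s hk ih =>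
    simp only [Finset.sum_insert hk]
    exact (h k (by simp)).add (ih fun l hl => h l (by simp [hl]))

theorem comp_toLp {n : ℕ} {E' : Set (Model n)} (hE' : IsOpen E') {c : Model n → ℝ}
    (hc : ContDiffOn ℝ 1 c E') {u : Fin n → X × ℝ → ℝ} (hu : ∀ i, IsParamC1 D (u i))
    (hmap : ∀ q ∈ D, (WithLp.toLp 2 fun i => u i q : Model n) ∈ E') :
    IsParamC1 D fun q => c (WithLp.toLp 2 fun i => u i q) := by
  choose cu u' cu' du using hu
  have hcont : ContinuousOn (fun q => (WithLp.toLp 2 fun i => u i q : Model n)) D :=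
    (PiLp.continuous_toLp 2 _).comp_continuousOn (continuousOn_pi.2 cu)
  refine ⟨hc.continuousOn.comp hcont hmap, fun q =>
    ∑ p, pd p c (WithLp.toLp 2 fun i => u i q) * u' p q, ?_, fun q hq => ?_⟩
  · refine continuousOn_finsetSum _ fun p _ => ContinuousOn.mul ?_ (cu' p)
    exact (contDiffOn_pd hE' hc (l := 0) (by norm_num) p).continuousOn.comp hcont hmap
  · exact hasDerivAt_comp_toLp (u := fun i s => u i (q.1, s))
      (((hc _ (hmap q hq)).contDiffAt (hE'.mem_nhds (hmap q hq))).differentiableAt (by norm_num))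
      fun j => du j q hq

end IsParamC1

/-! ### The first variation formula in coordinates -/

section FirstVariation

variable {m n : ℕ} {E : Set (Model m)} {E' : Set (Model n)}
  {G : Model m → Matrix (Fin m) (Fin m) ℝ} {w : Fin m → Fin m → Model m → ℝ}
  {H : Model n → Matrix (Fin n) (Fin n) ℝ} {o : Fin n → Fin n → Model n → ℝ}

/-- The pairing `h(τ₊(u), W)` in coordinates. -/
def tensionPairLoc (G : Model m → Matrix (Fin m) (Fin m) ℝ) (w : Fin m → Fin m → Model m → ℝ)
    (H : Model n → Matrix (Fin n) (Fin n) ℝ) (o : Fin n → Fin n → Model n → ℝ)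
    (u W : Fin n → Model m → ℝ) (y : Model m) : ℝ :=
  ∑ i, (∑ l, H (WithLp.toLp 2 fun l => u l y) i l * tensionPlusLoc G w H o u l y) * W i y

theorem energyCoeff_symm (h : IsLocalHermitian E G w) (h' : IsLocalHermitian E' H o) {y : Model m}
    {z : Model n} (hy : y ∈ E) (hz : z ∈ E') (a b : Fin m) (i j : Fin n) :
    energyCoeff G w H o a b i j y z = energyCoeff G w H o b a j i y z := by
  rw [energyCoeff, energyCoeff, h.inv_symm hy, h'.symm z hz, h.raise_antisymm hy,
    h'.antisymm z hz i j]
  ring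

theorem differentiableAt_energyCoeff (h' : IsLocalHermitian E' H o) {y : Model m}
    {z : Model n} (hz : z ∈ E') (a b : Fin m) (i j : Fin n) :
    DifferentiableAt ℝ (energyCoeff G w H o a b i j y) z :=
  ((h'.differentiableAt_metric hz i j).const_mul _).sub
    ((h'.differentiableAt_form hz i j).const_mul _)

/-- `firstVarLoc` is the derivative of the local energy density along a family of maps with
velocity `W`. -/
theorem hasDerivAt_energyLoc (h : IsLocalHermitian E G w) (h' : IsLocalHermitian E' H o)
    {u : ℝ → Fin n → Model m → ℝ} {W : Fin n → Model m → ℝ} {y : Model m} {t : ℝ} (hy : y ∈ E)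
    (hz : (WithLp.toLp 2 fun l => u t l y : Model n) ∈ E')
    (hu : ∀ i, HasDerivAt (fun s => u s i y) (W i y) t)
    (hu' : ∀ a i, HasDerivAt (fun s => pd a (u s i) y) (pd a (W i) y) t) :
    HasDerivAt (fun s => energyLoc G w H o (u s) y) (firstVarLoc G w H o (u t) W y) t := by
  have hk : ∀ a b i j, HasDerivAt (fun s =>
      energyCoeff G w H o a b i j y (WithLp.toLp 2 fun l => u s l y)) _ t := fun a b i j =>
    hasDerivAt_comp_toLp (u := fun l s => u s l y) (differentiableAt_energyCoeff h' hz a b i j) hu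
  have hs := HasDerivAt.const_mul (1 / 2 : ℝ) (HasDerivAt.fun_sum (u := Finset.univ) fun a _ =>
    HasDerivAt.fun_sum (u := Finset.univ) fun b _ => HasDerivAt.fun_sum (u := Finset.univ) fun i _ =>
      HasDerivAt.fun_sum (u := Finset.univ) fun j _ => ((hk a b i j).fun_mul (hu' a i)).fun_mul (hu' b j))
  refine hs.congr_deriv ?_
  set z : Model n := WithLp.toLp 2 fun l => u t l y
  have e1 : ∑ a, ∑ b, ∑ i, ∑ j, energyCoeff G w H o a b i j y z * pd a (u t i) y * pd b (W j) y
      = ∑ a, ∑ b, ∑ i, ∑ j, energyCoeff G w H o a b i j y z * pd a (W i) y * pd b (u t j) y := by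
    rw [sum_swap_four]
    refine Finset.sum_congr rfl fun a _ => Finset.sum_congr rfl fun b _ =>
      Finset.sum_congr rfl fun i _ => Finset.sum_congr rfl fun j _ => ?_
    rw [energyCoeff_symm h h' hy hz b a]
    ring
  have e2 : firstVarLoc G w H o (u t) W y
      = (1 / 2) * ∑ a, ∑ b, ∑ i, ∑ j, (∑ p, pd p (energyCoeff G w H o a b i j y) z * W p y)
          * pd a (u t i) y * pd b (u t j) y
        + (1 / 2) * (∑ a, ∑ b, ∑ i, ∑ j,
            energyCoeff G w H o a b i j y z * pd a (W i) y * pd b (u t j) y)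
        + (1 / 2) * ∑ a, ∑ b, ∑ i, ∑ j,
            energyCoeff G w H o a b i j y z * pd a (u t i) y * pd b (W j) y := by
    rw [e1, firstVarLoc]
    ring
  rw [e2, ← mul_add, ← mul_add]
  congr 1
  simp only [← Finset.sum_add_distrib]
  refine Finset.sum_congr rfl fun a _ => Finset.sum_congr rfl fun b _ =>
    Finset.sum_congr rfl fun i _ => Finset.sum_congr rfl fun j _ => ?_
  ring

theorem contDiff_mul_of_tsupport_subset {f φ : Model m → ℝ} {s : Set (Model m)} {k : WithTop ℕ∞}
    (hs : IsOpen s) (hf : ContDiffOn ℝ k f s) (hφ : ContDiff ℝ k φ) (hsub : tsupport φ ⊆ s) :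
    ContDiff ℝ k fun y => f y * φ y := by
  rw [contDiff_iff_contDiffAt]
  intro x
  by_cases hx : x ∈ s
  · exact ((hf x hx).contDiffAt (hs.mem_nhds hx)).mul hφ.contDiffAt
  · have h0 : (fun y => f y * φ y) =ᶠ[𝓝 x] fun _ => 0 := by
      filter_upwards [(isClosed_tsupport φ).isOpen_compl.mem_nhds fun h => hx (hsub h)] with y hy
      rw [image_eq_zero_of_notMem_tsupport hy, mul_zero]
    exact contDiffAt_const.congr_of_eventuallyEq h0

theorem continuous_mul_of_tsupport_subset {X : Type*} [TopologicalSpace X] {f φ : X → ℝ}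
    {s : Set X} (hs : IsOpen s) (hf : ContinuousOn f s) (hφ : ContinuousOn φ s)
    (hsub : tsupport φ ⊆ s) : Continuous fun y => f y * φ y := by
  rw [continuous_iff_continuousAt]
  intro x
  by_cases hx : x ∈ s
  · exact (hf.continuousAt (hs.mem_nhds hx)).mul (hφ.continuousAt (hs.mem_nhds hx))
  · have h0 : (fun y => f y * φ y) =ᶠ[𝓝 x] fun _ => 0 := by
      filter_upwards [(isClosed_tsupport φ).isOpen_compl.mem_nhds fun h => hx (hsub h)] with y hy
      rw [image_eq_zero_of_notMem_tsupport hy, mul_zero]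
    exact continuousAt_const.congr h0.symm

/-- The divergence theorem for compactly supported functions. -/
theorem integral_pd_eq_zero {f : Model m → ℝ} (hf : ContDiff ℝ 1 f) (hc : HasCompactSupport f)
    (a : Fin m) : Integrable (pd a f) ∧ ∫ y, pd a f y = 0 := by
  have hcont : Continuous (pd a f) := (hf.continuous_fderiv (by norm_num)).clm_apply continuous_const
  have hcs : HasCompactSupport (pd a f) := hc.fderiv_apply ℝ (stdVec a)
  have hi := hcont.integrable_of_hasCompactSupport hcs (μ := volume)
  refine ⟨hi, ?_⟩
  have := integral_mul_fderiv_eq_neg_fderiv_mul_of_integrable (μ := (volume : Measure (Model m)))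
    (f := fun _ => (1 : ℝ)) (g := f) (v := stdVec a) (by simp) (by simp only [one_mul]; exact hi)
    (by simpa using hf.continuous.integrable_of_hasCompactSupport hc) (fun _ _ => by fun_prop)
    (fun x _ => (hf.differentiable (by norm_num)) x)
  simpa [pd] using this

theorem IsParamC1.tensionPlusLoc {D : Set (Model m × ℝ)}
    (h : IsLocalHermitian E G w) (h' : IsLocalHermitian E' H o)
    {U : Fin n → Model m × ℝ → ℝ} (hDE : ∀ q ∈ D, q.1 ∈ E)
    (hmap : ∀ q ∈ D, (WithLp.toLp 2 fun i => U i q : Model n) ∈ E')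
    (hU : ∀ i, IsParamC1 D (U i)) (hU1 : ∀ a i, IsParamC1 D (spd a (U i)))
    (hU2 : ∀ a b i, IsParamC1 D (spd a (spd b (U i)))) (l : Fin n) :
    IsParamC1 D fun q => tensionPlusLoc G w H o (fun i y => U i (y, q.2)) l q.1 := by
  have hfst : ∀ {c : Model m → ℝ}, ContDiffOn ℝ ∞ c E → IsParamC1 D fun q => c q.1 := fun hc =>
    .of_fst (hc.continuousOn.comp continuousOn_fst hDE)
  have hsnd : ∀ {c : Model n → ℝ}, ContDiffOn ℝ ∞ c E' →
      IsParamC1 D fun q => c (WithLp.toLp 2 fun i => U i q) := fun hc =>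
    .comp_toLp h'.isOpen (hc.of_le (by simp)) hU hmap
  have hI := fun a b => hfst (h.contDiffOn_inv a b)
  have hΓ := fun a b c => hfst (h.contDiffOn_christoffel a b c)
  have hw := fun a b => hfst (h.contDiffOn_form a b)
  have hδ := fun a => hfst (h.contDiffOn_codiff a)
  have hI' := fun a b => hsnd (h'.contDiffOn_inv a b)
  have hΓ' := fun a b c => hsnd (h'.contDiffOn_christoffel a b c)
  have ho := fun a b => hsnd (h'.contDiffOn_form a b)
  have hdo := fun a b c => hsnd (h'.contDiffOn_extDeriv₂ a b c)
  refine IsParamC1.add ?_ ?_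
  · exact .sum fun a _ => .sum fun b _ => (hI a b).mul (((hU2 a b l).sub
      (.sum fun c _ => (hU1 c l).mul (hΓ c a b))).add
        (.sum fun j _ => .sum fun k _ => ((hU1 a j).mul (hU1 b k)).mul (hΓ' l j k)))
  · exact (IsParamC1.const (1 / 2)).mul (.sum fun i _ => (hI' i l).mul ((IsParamC1.sum fun a _ =>
      .sum fun b _ => .sum fun j _ => (((hδ a).mul (hU1 b j)).mul (ho i j)).mul (hI a b)).add
        (.sum fun a _ => .sum fun b _ => .sum fun c _ => .sum fun e _ => .sum fun j _ =>
          .sum fun k _ => (((((hw a b).mul (hU1 c j)).mul (hU1 e k)).mul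
            (hdo i j k)).mul (hI a c)).mul (hI b e))))

theorem IsParamC1.tensionPairLoc {D : Set (Model m × ℝ)}
    (h : IsLocalHermitian E G w) (h' : IsLocalHermitian E' H o)
    {U W : Fin n → Model m × ℝ → ℝ} (hDE : ∀ q ∈ D, q.1 ∈ E)
    (hmap : ∀ q ∈ D, (WithLp.toLp 2 fun i => U i q : Model n) ∈ E')
    (hU : ∀ i, IsParamC1 D (U i)) (hU1 : ∀ a i, IsParamC1 D (spd a (U i)))
    (hU2 : ∀ a b i, IsParamC1 D (spd a (spd b (U i)))) (hW : ∀ i, IsParamC1 D (W i)) :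
    IsParamC1 D fun q => tensionPairLoc G w H o (fun i y => U i (y, q.2))
      (fun i y => W i (y, q.2)) q.1 :=
  .sum fun i _ => IsParamC1.mul (.sum fun l _ =>
    IsParamC1.mul (.comp_toLp h'.isOpen ((h'.contDiffOn_metric i l).of_le (by simp)) hU hmap)
      (IsParamC1.tensionPlusLoc h h' hDE hmap hU hU1 hU2 l)) (hW i)

theorem continuousOn_tensionPlusLoc (h : IsLocalHermitian E G w) (h' : IsLocalHermitian E' H o)
    {s : Set (Model m)} (hs : IsOpen s) (hsE : s ⊆ E) {u : Fin n → Model m → ℝ}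
    (hu : ∀ i, ContDiffOn ℝ 2 (u i) s)
    (hmap : ∀ y ∈ s, (WithLp.toLp 2 fun i => u i y : Model n) ∈ E') (l : Fin n) :
    ContinuousOn (tensionPlusLoc G w H o u l) s := by
  have hf : ∀ {c : Model m → ℝ}, ContinuousOn c s →
      IsParamC1 (s ×ˢ univ) fun q : Model m × ℝ => c q.1 := fun hc =>
    .of_fst (hc.comp continuousOn_fst fun q hq => hq.1)
  have := (IsParamC1.tensionPlusLoc (D := s ×ˢ (univ : Set ℝ)) h h' (U := fun i q => u i q.1)
    (fun q hq => hsE hq.1) (fun q hq => hmap q.1 hq.1) (fun i => hf (hu i).continuousOn)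
    (fun a i => hf (contDiffOn_pd hs (hu i) (l := 1) (by norm_num) a).continuousOn)
    (fun a b i => hf (contDiffOn_pd hs (contDiffOn_pd hs (hu i) (l := 1) (by norm_num) b) (l := 0)
      (by norm_num) a).continuousOn) l).1
  exact this.comp (f := fun y => ((y, 0) : Model m × ℝ)) (by fun_prop) fun y hy => ⟨hy, mem_univ _⟩

/-- The first variation formula in coordinates. -/
theorem integral_firstVarLoc (h : IsLocalHermitian E G w) (h' : IsLocalHermitian E' H o)
    {s : Set (Model m)} (hs : IsOpen s) (hsE : s ⊆ E) {u W : Fin n → Model m → ℝ}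
    (hu : ∀ i, ContDiffOn ℝ 2 (u i) s)
    (hmap : ∀ y ∈ s, (WithLp.toLp 2 fun i => u i y : Model n) ∈ E')
    (hW : ∀ i, ContDiff ℝ 1 (W i)) (hWc : ∀ i, HasCompactSupport (W i))
    (hWs : ∀ i, tsupport (W i) ⊆ s) :
    ∫ y, √(G y).det * firstVarLoc G w H o u W y
      = -∫ y, √(G y).det * tensionPairLoc G w H o u W y := by
  let P : Fin m → Fin n → Model m → ℝ := fun a i y => ∑ b, ∑ j, √(G y).det *
    energyCoeff G w H o a b i j y (WithLp.toLp 2 fun l => u l y) * pd b (u j) y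
  have hu1 : ∀ b j, ContDiffOn ℝ 1 (pd b (u j)) s := fun b j =>
    contDiffOn_pd hs (hu j) (by norm_num) b
  have huL : ContDiffOn ℝ 1 (fun y => (WithLp.toLp 2 fun l => u l y : Model n)) s :=
    (EuclideanSpace.equiv (Fin n) ℝ).symm.toContinuousLinearMap.contDiff.comp_contDiffOn
      (contDiffOn_pi.2 fun i => (hu i).of_le (by norm_num))
  have hP : ∀ a i, ContDiffOn ℝ 1 (P a i) s := by
    intro a i
    refine ContDiffOn.sum fun b _ => ContDiffOn.sum fun j _ => ContDiffOn.mul (ContDiffOn.mul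
      ((h.contDiffOn_sqrt_det.of_le (by simp)).mono hsE) (ContDiffOn.sub (ContDiffOn.mul
        (((h.contDiffOn_inv a b).of_le (by simp)).mono hsE) ?_) (ContDiffOn.mul
        (((h.contDiffOn_raise a b).of_le (by simp)).mono hsE) ?_))) (hu1 b j)
    · exact ((h'.contDiffOn_metric i j).of_le (by simp)).comp huL hmap
    · exact ((h'.contDiffOn_form i j).of_le (by simp)).comp huL hmap
  have hZ : ∀ a i, ContDiff ℝ 1 fun y => P a i y * W i y := fun a i =>
    contDiff_mul_of_tsupport_subset hs (hP a i) (hW i) (hWs i)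
  have hZc : ∀ a i, HasCompactSupport fun y => P a i y * W i y := fun a i => (hWc i).mul_left
  have hZint := fun a i => integral_pd_eq_zero (hZ a i) (hZc a i) a
  -- the pointwise identity
  have hpt : ∀ y, ∑ a, ∑ i, pd a (fun y => P a i y * W i y) y
      = √(G y).det * firstVarLoc G w H o u W y + √(G y).det * tensionPairLoc G w H o u W y := by
    intro y
    by_cases hy : y ∈ s
    · have hPd : ∀ a i, DifferentiableAt ℝ (P a i) y := fun a i =>
        ((hP a i).contDiffAt (hs.mem_nhds hy)).differentiableAt (by norm_num)
      have hWd : ∀ i, DifferentiableAt ℝ (W i) y := fun i =>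
        (hW i).differentiable (by norm_num) y
      have hEL := fun i => sum_pd_momentum h h' (hsE hy) (hmap y hy) hs hy hu i
      simp only [pd_mul (hPd _ _) (hWd _), Finset.sum_add_distrib]
      rw [Finset.sum_comm]
      simp only [← Finset.sum_mul]
      have e1 : ∑ i, (∑ a, pd a (P a i) y) * W i y
          = √(G y).det * ((1 / 2) * ∑ a, ∑ b, ∑ j, ∑ k,
              (∑ i, pd i (energyCoeff G w H o a b j k y) (WithLp.toLp 2 fun l => u l y) * W i y)
              * pd a (u j) y * pd b (u k) y) + √(G y).det * tensionPairLoc G w H o u W y := by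
        simp only [P, hEL]
        simp only [mul_add, add_mul, Finset.sum_add_distrib]
        congr 1
        · simp only [Finset.mul_sum, Finset.sum_mul]
          rw [Finset.sum_comm]
          refine Finset.sum_congr rfl fun a _ => ?_
          rw [Finset.sum_comm]
          refine Finset.sum_congr rfl fun b _ => ?_
          rw [Finset.sum_comm]
          refine Finset.sum_congr rfl fun j _ => ?_
          rw [Finset.sum_comm]
          refine Finset.sum_congr rfl fun k _ => Finset.sum_congr rfl fun i _ => ?_
          ring
        · rw [tensionPairLoc, Finset.mul_sum]
          exact Finset.sum_congr rfl fun i _ => mul_assoc _ _ _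
      have e2 : ∑ a, ∑ i, P a i y * pd a (W i) y = √(G y).det * ∑ a, ∑ b, ∑ i, ∑ j,
          energyCoeff G w H o a b i j y (WithLp.toLp 2 fun l => u l y)
            * pd a (W i) y * pd b (u j) y := by
        rw [Finset.mul_sum]
        refine Finset.sum_congr rfl fun a _ => ?_
        simp only [P, Finset.sum_mul, Finset.mul_sum]
        rw [Finset.sum_comm]
        refine Finset.sum_congr rfl fun b _ => Finset.sum_congr rfl fun i _ =>
          Finset.sum_congr rfl fun j _ => ?_
        ring
      rw [e1, e2, firstVarLoc]
      ring
    · have hW0 : ∀ i, W i =ᶠ[𝓝 y] fun _ => 0 := fun i => by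
        filter_upwards [(isClosed_tsupport (W i)).isOpen_compl.mem_nhds fun h => hy (hWs i h)]
          with z hz using image_eq_zero_of_notMem_tsupport hz
      have hW1 : ∀ i, W i y = 0 := fun i => (hW0 i).eq_of_nhds
      have hW2 : ∀ a i, pd a (W i) y = 0 := fun a i => by rw [pd_congr (hW0 i), pd_const]
      have hZ0 : ∀ a i, pd a (fun y => P a i y * W i y) y = 0 := fun a i => by
        rw [pd_congr (w₂ := fun _ => 0), pd_const]
        filter_upwards [hW0 i] with z hz
        rw [hz, mul_zero]
      simp [firstVarLoc, tensionPairLoc, hW1, hW2, hZ0]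
  have hB : Integrable fun y => √(G y).det * tensionPairLoc G w H o u W y := by
    have e : (fun y => √(G y).det * tensionPairLoc G w H o u W y) = fun y => ∑ i, (√(G y).det *
        ∑ l, H (WithLp.toLp 2 fun l => u l y) i l * tensionPlusLoc G w H o u l y) * W i y := by
      ext y
      rw [tensionPairLoc, Finset.mul_sum]
      exact Finset.sum_congr rfl fun i _ => (mul_assoc _ _ _).symm
    rw [e]
    refine integrable_finsetSum _ fun i _ => ?_
    refine Continuous.integrable_of_hasCompactSupport ?_ ((hWc i).mul_left)
    refine continuous_mul_of_tsupport_subset hs (ContinuousOn.mul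
      (h.contDiffOn_sqrt_det.continuousOn.mono hsE) (continuousOn_finsetSum _ fun l _ => ?_))
      (hW i).continuous.continuousOn (hWs i)
    exact ((h'.contDiffOn_metric i l).continuousOn.comp huL.continuousOn hmap).mul
      (continuousOn_tensionPlusLoc h h' hs hsE hu hmap l)
  have hsum : ∫ y, ∑ a, ∑ i, pd a (fun y => P a i y * W i y) y = 0 := by
    rw [integral_finsetSum _ fun a _ => integrable_finsetSum _ fun i _ => (hZint a i).1]
    refine Finset.sum_eq_zero fun a _ => ?_
    rw [integral_finsetSum _ fun i _ => (hZint a i).1]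
    exact Finset.sum_eq_zero fun i _ => (hZint a i).2
  have hA : (fun y => √(G y).det * firstVarLoc G w H o u W y)
      = fun y => (∑ a, ∑ i, pd a (fun y => P a i y * W i y) y)
        - √(G y).det * tensionPairLoc G w H o u W y := by
    ext y
    rw [hpt y]
    ring
  rw [hA, integral_sub (integrable_finsetSum _ fun a _ => integrable_finsetSum _ fun i _ =>
    (hZint a i).1) hB, hsum, zero_sub]

end FirstVariation

/-! ### The linearization of `τ₊` -/

section Algebra

variable {n : ℕ}

theorem sum_reverse_three {R ι : Type*} [AddCommMonoid R] [Fintype ι] (F : ι → ι → ι → R) :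
    ∑ a, ∑ b, ∑ c, F a b c = ∑ c, ∑ b, ∑ a, F a b c := by
  rw [Finset.sum_comm]
  refine (Finset.sum_congr rfl fun b _ => Finset.sum_comm).trans ?_
  exact Finset.sum_comm

theorem sum_rotate_three {R ι : Type*} [AddCommMonoid R] [Fintype ι] (F : ι → ι → ι → R) :
    ∑ a, ∑ b, ∑ c, F a b c = ∑ b, ∑ c, ∑ a, F a b c := by
  rw [Finset.sum_comm]
  exact Finset.sum_congr rfl fun b _ => Finset.sum_comm

variable {Γ : Fin n → Fin n → Fin n → ℝ}

theorem sum_mul_connection (hΓ : ∀ l j k, Γ l j k = Γ l k j) (f x v : Fin n → ℝ) :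
    ∑ j, f j * (∑ p, ∑ k, v p * x k * Γ j k p)
      = ∑ j, (∑ k, v k * ∑ p, Γ p k j * f p) * x j := by
  simp only [Finset.mul_sum, Finset.sum_mul]
  rw [sum_reverse_three]
  refine Finset.sum_congr rfl fun k _ => Finset.sum_congr rfl fun p _ =>
    Finset.sum_congr rfl fun j _ => ?_
  rw [hΓ j k p]
  ring

theorem sum_connection_mul (f : Fin n → Fin n → ℝ) (x v : Fin n → ℝ) (i : Fin n) :
    ∑ j, (∑ k, v k * ∑ p, Γ p k i * f p j) * x j
      = ∑ q, ∑ p, Γ q p i * v p * ∑ j, f q j * x j := by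
  simp only [Finset.mul_sum, Finset.sum_mul]
  rw [sum_reverse_three]
  exact Finset.sum_congr rfl fun k _ => Finset.sum_congr rfl fun p _ =>
    Finset.sum_congr rfl fun j _ => by ring

/-- The Leibniz rule for the contraction of a 2-tensor with a vector, with all derivatives taken
along the velocity `v`. -/
theorem leibniz_two (hΓ : ∀ l j k, Γ l j k = Γ l k j) (o : Fin n → Fin n → ℝ)
    (o' : Fin n → Fin n → Fin n → ℝ) (v x x' : Fin n → ℝ) (i : Fin n) :
    ∑ j, ((∑ p, o' p i j * v p) * x j + o i j * x' j)
      = (∑ j, (o i j * (x' j + ∑ p, ∑ k, v p * x k * Γ j k p)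
          + (∑ k, v k * (o' k i j - ∑ p, (Γ p k i * o p j + Γ p k j * o i p))) * x j))
        + ∑ q, ∑ p, Γ q p i * v p * ∑ j, o q j * x j := by
  have h1 := sum_mul_connection hΓ (o i) x v
  have h2 := sum_connection_mul (Γ := Γ) o x v i
  rw [← h2]
  have h3 : ∀ j, (∑ k, v k * (o' k i j - ∑ p, (Γ p k i * o p j + Γ p k j * o i p))) * x j
      = (∑ p, o' p i j * v p) * x j - (∑ k, v k * ∑ p, Γ p k i * o p j) * x j
        - (∑ k, v k * ∑ p, Γ p k j * o i p) * x j := by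
    intro j
    rw [← sub_mul, ← sub_mul, ← Finset.sum_sub_distrib, ← Finset.sum_sub_distrib]
    congr 1
    refine Finset.sum_congr rfl fun k _ => ?_
    rw [Finset.sum_add_distrib]
    ring
  simp only [h3]
  simp only [mul_add, Finset.sum_add_distrib, Finset.sum_sub_distrib]
  rw [h1]
  ring

/-- The Leibniz rule for the contraction of a 3-tensor with two vectors, with all derivatives taken
along the velocity `v`. -/
theorem leibniz_three (hΓ : ∀ l j k, Γ l j k = Γ l k j) (θ : Fin n → Fin n → Fin n → ℝ)
    (θ' : Fin n → Fin n → Fin n → Fin n → ℝ) (v x x' y y' : Fin n → ℝ) (i : Fin n) :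
    ∑ j, ∑ k, ((∑ p, θ' p i j k * v p) * x j * y k + θ i j k * (x' j * y k + x j * y' k))
      = (∑ j, ∑ k, (θ i j k * ((x' j + ∑ p, ∑ k, v p * x k * Γ j k p) * y k
            + x j * (y' k + ∑ p, ∑ j, v p * y j * Γ k j p))
          + (∑ p, v p * (θ' p i j k
              - ∑ r, (Γ r p i * θ r j k + Γ r p j * θ i r k + Γ r p k * θ i j r))) * x j * y k))
        + ∑ q, ∑ p, Γ q p i * v p * ∑ j, ∑ k, θ q j k * x j * y k := by
  have h1 : ∑ j, ∑ k, θ i j k * ((∑ p, ∑ k, v p * x k * Γ j k p) * y k)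
      = ∑ j, ∑ k, (∑ p, v p * ∑ r, Γ r p j * θ i r k) * x j * y k := by
    rw [Finset.sum_comm]
    conv_rhs => rw [Finset.sum_comm]
    refine Finset.sum_congr rfl fun k _ => ?_
    rw [← Finset.sum_mul, ← sum_mul_connection hΓ, Finset.sum_mul]
    exact Finset.sum_congr rfl fun j _ => by ring
  have h2 : ∑ j, ∑ k, θ i j k * (x j * (∑ p, ∑ j, v p * y j * Γ k j p))
      = ∑ j, ∑ k, (∑ p, v p * ∑ r, Γ r p k * θ i j r) * x j * y k := by
    refine Finset.sum_congr rfl fun j _ => ?_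
    calc _ = x j * ∑ k, θ i j k * ∑ p, ∑ j, v p * y j * Γ k j p := by
          rw [Finset.mul_sum]
          exact Finset.sum_congr rfl fun k _ => by ring
      _ = _ := by
          rw [sum_mul_connection hΓ, Finset.mul_sum]
          exact Finset.sum_congr rfl fun k _ => by ring
  have h3 : ∑ q, ∑ p, Γ q p i * v p * ∑ j, ∑ k, θ q j k * x j * y k
      = ∑ j, ∑ k, (∑ p, v p * ∑ r, Γ r p i * θ r j k) * x j * y k := by
    have e : ∀ q, ∑ j, ∑ k, θ q j k * x j * y k = ∑ j, (∑ k, θ q j k * y k) * x j := by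
      intro q
      refine Finset.sum_congr rfl fun j _ => ?_
      rw [Finset.sum_mul]
      exact Finset.sum_congr rfl fun k _ => by ring
    simp only [e]
    rw [← sum_connection_mul]
    refine Finset.sum_congr rfl fun j _ => ?_
    simp only [Finset.mul_sum, Finset.sum_mul]
    rw [sum_rotate_three, sum_rotate_three]
    exact Finset.sum_congr rfl fun k _ => Finset.sum_congr rfl fun p _ =>
      Finset.sum_congr rfl fun q _ => by ring
  have h4 : ∀ j k, (∑ p, v p * (θ' p i j k
        - ∑ r, (Γ r p i * θ r j k + Γ r p j * θ i r k + Γ r p k * θ i j r))) * x j * y k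
      = (∑ p, θ' p i j k * v p) * x j * y k - (∑ p, v p * ∑ r, Γ r p i * θ r j k) * x j * y k
        - (∑ p, v p * ∑ r, Γ r p j * θ i r k) * x j * y k
        - (∑ p, v p * ∑ r, Γ r p k * θ i j r) * x j * y k := by
    intro j k
    simp only [← sub_mul, ← Finset.sum_sub_distrib]
    congr 2
    refine Finset.sum_congr rfl fun p _ => ?_
    rw [Finset.sum_add_distrib, Finset.sum_add_distrib]
    ring
  rw [h3]
  simp only [h4]
  simp only [mul_add, add_mul, Finset.sum_add_distrib, Finset.sum_sub_distrib]
  rw [h1, h2]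
  ring

/-- The commutation rule `∇ₜ ∇ₐ ∂ᵦu = ∇ₐ ∇ᵦ v + R(v, ∂ₐu) ∂ᵦu` in components, without the terms that
involve the connection of the source. -/
theorem curvature_commutation (hΓ : ∀ l j k, Γ l j k = Γ l k j)
    (Γ' : Fin n → Fin n → Fin n → Fin n → ℝ) (hΓ' : ∀ p l j k, Γ' p l j k = Γ' p l k j)
    (v va vb ua ub uab : Fin n → ℝ) (l : Fin n) :
    ∑ j, ∑ k, ((va j * ub k + ua j * vb k) * Γ l j k + ua j * ub k * ∑ p, Γ' p l j k * v p)
      = (∑ j, ∑ k, (va j * ub k * Γ l k j + v j * uab k * Γ l k j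
            + v j * ub k * ∑ p, Γ' p l k j * ua p))
        + (∑ j, ∑ k, (vb j + ∑ p, ∑ q, v p * ub q * Γ j q p) * ua k * Γ l k j)
        + (∑ i, ∑ j, ∑ k, v i * ua j * ub k * (Γ' i l j k - Γ' j l i k
            + ∑ p, (Γ l i p * Γ p j k - Γ l j p * Γ p i k)))
        - ∑ p, ∑ q, Γ l p q * v p * (uab q + ∑ j, ∑ k, ua j * ub k * Γ q j k) := by
  have h1 : ∑ j, ∑ k, va j * ub k * Γ l j k = ∑ j, ∑ k, va j * ub k * Γ l k j :=
    Finset.sum_congr rfl fun j _ => Finset.sum_congr rfl fun k _ => by rw [hΓ]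
  have h2 : ∑ j, ∑ k, ua j * vb k * Γ l j k = ∑ j, ∑ k, vb j * ua k * Γ l k j := by
    rw [Finset.sum_comm]
    exact Finset.sum_congr rfl fun j _ => Finset.sum_congr rfl fun k _ => by ring
  have h3 : ∑ j, ∑ k, ua j * ub k * ∑ p, Γ' p l j k * v p
      = ∑ i, ∑ j, ∑ k, v i * ua j * ub k * Γ' i l j k := by
    simp only [Finset.mul_sum]
    rw [← sum_rotate_three fun p j k => ua j * ub k * (Γ' p l j k * v p)]
    exact Finset.sum_congr rfl fun j _ => Finset.sum_congr rfl fun k _ =>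
      Finset.sum_congr rfl fun k _ => by ring
  have h4 : ∑ j, ∑ k, v j * uab k * Γ l k j = ∑ p, ∑ q, Γ l p q * v p * uab q :=
    Finset.sum_congr rfl fun j _ => Finset.sum_congr rfl fun k _ => by rw [hΓ l k j]; ring
  have h5 : ∑ j, ∑ k, v j * ub k * ∑ p, Γ' p l k j * ua p
      = ∑ i, ∑ j, ∑ k, v i * ua j * ub k * Γ' j l i k := by
    simp only [Finset.mul_sum]
    refine Finset.sum_congr rfl fun i _ => ?_
    rw [Finset.sum_comm]
    exact Finset.sum_congr rfl fun j _ => Finset.sum_congr rfl fun k _ => by rw [hΓ' j l k i]; ring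
  have h6 : ∑ j, ∑ k, (∑ p, ∑ q, v p * ub q * Γ j q p) * ua k * Γ l k j
      = ∑ i, ∑ j, ∑ k, v i * ua j * ub k * ∑ p, Γ l j p * Γ p i k := by
    simp only [Finset.mul_sum, Finset.sum_mul]
    rw [Finset.sum_comm]
    rw [show ∑ i, ∑ j, ∑ k, ∑ p, v i * ua j * ub k * (Γ l j p * Γ p i k)
      = ∑ j, ∑ i, ∑ k, ∑ p, v i * ua j * ub k * (Γ l j p * Γ p i k) from Finset.sum_comm]
    refine Finset.sum_congr rfl fun j _ => ?_
    rw [sum_rotate_three]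
    refine Finset.sum_congr rfl fun i _ => Finset.sum_congr rfl fun k _ =>
      Finset.sum_congr rfl fun p _ => ?_
    rw [hΓ p k i]
    ring
  have h7 : ∑ p, ∑ q, Γ l p q * v p * (∑ j, ∑ k, ua j * ub k * Γ q j k)
      = ∑ i, ∑ j, ∑ k, v i * ua j * ub k * ∑ p, Γ l i p * Γ p j k := by
    simp only [Finset.mul_sum]
    refine Finset.sum_congr rfl fun i _ => ?_
    rw [sum_rotate_three]
    exact Finset.sum_congr rfl fun i _ => Finset.sum_congr rfl fun k _ =>
      Finset.sum_congr rfl fun p _ => by ring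
  have h8 : ∑ i, ∑ j, ∑ k, v i * ua j * ub k * (Γ' i l j k - Γ' j l i k
            + ∑ p, (Γ l i p * Γ p j k - Γ l j p * Γ p i k))
      = (∑ i, ∑ j, ∑ k, v i * ua j * ub k * Γ' i l j k)
        - (∑ i, ∑ j, ∑ k, v i * ua j * ub k * Γ' j l i k)
        + (∑ i, ∑ j, ∑ k, v i * ua j * ub k * ∑ p, Γ l i p * Γ p j k)
        - ∑ i, ∑ j, ∑ k, v i * ua j * ub k * ∑ p, Γ l j p * Γ p i k := by
    simp only [← Finset.sum_sub_distrib, ← Finset.sum_add_distrib]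
    refine Finset.sum_congr rfl fun i _ => Finset.sum_congr rfl fun k _ =>
      Finset.sum_congr rfl fun p _ => ?_
    rw [Finset.sum_sub_distrib]
    ring
  rw [h8]
  simp only [add_mul, mul_add, Finset.sum_add_distrib]
  rw [h1, h2, h3, h4, h5, h6, h7]
  ring

end Algebra

section Linearization

variable {m n : ℕ} {E : Set (Model m)} {E' : Set (Model n)}
  {G : Model m → Matrix (Fin m) (Fin m) ℝ} {w : Fin m → Fin m → Model m → ℝ}
  {H : Model n → Matrix (Fin n) (Fin n) ℝ} {o : Fin n → Fin n → Model n → ℝ}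

theorem IsLocalHermitian.differentiableAt_christoffel {y : Model m} (h : IsLocalHermitian E G w)
    (hy : y ∈ E) (k i j : Fin m) : DifferentiableAt ℝ (christoffel G k i j) y :=
  ((h.contDiffOn_christoffel k i j).contDiffAt (h.isOpen.mem_nhds hy)).differentiableAt (by simp)

theorem IsLocalHermitian.differentiableAt_extDeriv₂ {y : Model m} (h : IsLocalHermitian E G w)
    (hy : y ∈ E) (i j k : Fin m) : DifferentiableAt ℝ (extDeriv₂ w i j k) y :=
  ((h.contDiffOn_extDeriv₂ i j k).contDiffAt (h.isOpen.mem_nhds hy)).differentiableAt (by simp)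

theorem IsLocalHermitian.pd_christoffel_symm {y : Model m} (h : IsLocalHermitian E G w)
    (hy : y ∈ E) (p k i j : Fin m) :
    pd p (christoffel G k i j) y = pd p (christoffel G k j i) y :=
  pd_congr (by filter_upwards [h.isOpen.mem_nhds hy] with z hz using h.christoffel_symm hz k i j) p

theorem pd_covDerivAlong (h' : IsLocalHermitian E' H o) {u v : Fin n → Model m → ℝ} {y : Model m}
    (hz : (WithLp.toLp 2 fun l => u l y : Model n) ∈ E')
    (hu : ∀ j, DifferentiableAt ℝ (u j) y) (hu1 : ∀ b j, DifferentiableAt ℝ (pd b (u j)) y)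
    (hv : ∀ j, DifferentiableAt ℝ (v j) y) (hv1 : ∀ b j, DifferentiableAt ℝ (pd b (v j)) y)
    (a b : Fin m) (l : Fin n) :
    pd a (covDerivAlong H u v b l) y = pd a (pd b (v l)) y
      + ∑ j, ∑ k, (pd a (v j) y * pd b (u k) y * christoffel H l k j (WithLp.toLp 2 fun l => u l y)
        + v j y * pd a (pd b (u k)) y * christoffel H l k j (WithLp.toLp 2 fun l => u l y)
        + v j y * pd b (u k) y * ∑ p, pd p (christoffel H l k j) (WithLp.toLp 2 fun l => u l y)
          * pd a (u p) y) := by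
  have hΓ : ∀ l k j, DifferentiableAt ℝ
      (fun y => christoffel H l k j (WithLp.toLp 2 fun l => u l y)) y := fun l k j =>
    DifferentiableAt.comp (g := christoffel H l k j) y (h'.differentiableAt_christoffel hz l k j)
      (differentiableAt_toLp hu)
  have ht : ∀ j k, DifferentiableAt ℝ (fun y => v j y * pd b (u k) y
      * christoffel H l k j (WithLp.toLp 2 fun l => u l y)) y := fun j k =>
    ((hv j).fun_mul (hu1 b k)).fun_mul (hΓ l k j)
  unfold covDerivAlong
  rw [pd_add (hv1 b l) (DifferentiableAt.fun_sum fun j _ => DifferentiableAt.fun_sum fun k _ =>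
    ht j k), pd_sum fun j _ => DifferentiableAt.fun_sum fun k _ => ht j k]
  congr 1
  refine Finset.sum_congr rfl fun j _ => ?_
  rw [pd_sum fun k _ => ht j k]
  refine Finset.sum_congr rfl fun k _ => ?_
  rw [pd_mul ((hv j).fun_mul (hu1 b k)) (hΓ l k j), pd_mul (hv j) (hu1 b k),
    pd_comp (h'.differentiableAt_christoffel hz l k j) hu]
  ring

theorem bracketLoc_eq (u v : Fin n → Model m → ℝ) (i : Fin n) (y : Model m) :
    bracketLoc G w H o u v i y
      = (∑ b, (∑ a, codiff G w a y * (G y)⁻¹ a b) * ∑ j,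
          (o i j (WithLp.toLp 2 fun l => u l y) * covDerivAlong H u v b j y
          + (∑ k, v k y * covDeriv₂ H o k i j (WithLp.toLp 2 fun l => u l y)) * pd b (u j) y))
        + ∑ c, ∑ e, raise G w c e y * ∑ j, ∑ k,
          (extDeriv₂ o i j k (WithLp.toLp 2 fun l => u l y)
              * (covDerivAlong H u v c j y * pd e (u k) y + pd c (u j) y * covDerivAlong H u v e k y)
            + (∑ p, v p y * covDeriv₃ H (extDeriv₂ o) p i j k (WithLp.toLp 2 fun l => u l y))
              * pd c (u j) y * pd e (u k) y) := by
  set z : Model n := WithLp.toLp 2 fun l => u l y with hz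
  have h1 := sum_codiff_eq G w y fun b j => o i j z * covDerivAlong H u v b j y
  have h2 := sum_codiff_eq G w y fun b j => (∑ k, v k y * covDeriv₂ H o k i j z) * pd b (u j) y
  have h3 := sum_form_eq_sum_raise G w y fun c e j k =>
    extDeriv₂ o i j k z * covDerivAlong H u v c j y * pd e (u k) y
  have h4 := sum_form_eq_sum_raise G w y fun c e j k =>
    extDeriv₂ o i j k z * pd c (u j) y * covDerivAlong H u v e k y
  have h5 := sum_form_eq_sum_raise G w y fun c e j k =>
    (∑ p, v p y * covDeriv₃ H (extDeriv₂ o) p i j k z) * pd c (u j) y * pd e (u k) y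
  simp only [← mul_assoc] at h1 h2 h3 h4 h5
  simp only [bracketLoc, ← hz]
  rw [h1, h2, h3, h4, h5]
  simp only [← Finset.sum_add_distrib, add_assoc]
  refine Finset.sum_congr rfl fun b _ => ?_
  congr 1
  · rw [Finset.mul_sum]
    exact Finset.sum_congr rfl fun j _ => by ring
  · refine Finset.sum_congr rfl fun e _ => ?_
    rw [Finset.mul_sum]
    refine Finset.sum_congr rfl fun j _ => ?_
    rw [Finset.mul_sum]
    exact Finset.sum_congr rfl fun k _ => by ring

variable {u : ℝ → Fin n → Model m → ℝ} {v : Fin n → Model m → ℝ} {y : Model m} {t : ℝ}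

/-- The linearization of the tension field. The last term vanishes when `τ(u) = 0`. -/
theorem hasDerivAt_tensionLoc (h' : IsLocalHermitian E' H o)
    (hz : (WithLp.toLp 2 fun l => u t l y : Model n) ∈ E')
    (hu : ∀ j, DifferentiableAt ℝ (u t j) y) (hu1 : ∀ b j, DifferentiableAt ℝ (pd b (u t j)) y)
    (hv : ∀ j, DifferentiableAt ℝ (v j) y) (hv1 : ∀ b j, DifferentiableAt ℝ (pd b (v j)) y)
    (ht : ∀ i, HasDerivAt (fun s => u s i y) (v i y) t)
    (ht1 : ∀ a i, HasDerivAt (fun s => pd a (u s i) y) (pd a (v i) y) t)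
    (ht2 : ∀ a b i, HasDerivAt (fun s => pd a (pd b (u s i)) y) (pd a (pd b (v i)) y) t)
    (l : Fin n) :
    HasDerivAt (fun s => tensionLoc G H (u s) l y)
      (laplacianAlong G H (u t) v l y
        + (∑ a, ∑ b, (G y)⁻¹ a b * ∑ i, ∑ j, ∑ k, v i y * pd a (u t j) y * pd b (u t k) y
            * curvature H l i j k (WithLp.toLp 2 fun l => u t l y))
        - ∑ p, ∑ q, christoffel H l p q (WithLp.toLp 2 fun l => u t l y) * v p y
            * tensionLoc G H (u t) q y) t := by
  have hΓ : ∀ l j k, HasDerivAt (fun s => christoffel H l j k (WithLp.toLp 2 fun l => u s l y)) _ t :=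
    fun l j k => hasDerivAt_comp_toLp (u := fun l s => u s l y)
      (h'.differentiableAt_christoffel hz l j k) ht
  have hs := HasDerivAt.fun_sum (u := Finset.univ) fun a _ => HasDerivAt.fun_sum (u := Finset.univ)
    fun b _ => HasDerivAt.const_mul ((G y)⁻¹ a b) (((ht2 a b l).fun_sub
      (HasDerivAt.fun_sum (u := Finset.univ) fun c _ =>
        (ht1 c l).mul_const (christoffel G c a b y))).fun_add
      (HasDerivAt.fun_sum (u := Finset.univ) fun j _ => HasDerivAt.fun_sum (u := Finset.univ)
        fun k _ => ((ht1 a j).fun_mul (ht1 b k)).fun_mul (hΓ l j k)))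
  refine hs.congr_deriv ?_
  set z : Model n := WithLp.toLp 2 fun l => u t l y with hzdef
  have e1 : ∑ p, ∑ q, christoffel H l p q z * v p y * tensionLoc G H (u t) q y
      = ∑ a, ∑ b, (G y)⁻¹ a b * ∑ p, ∑ q, christoffel H l p q z * v p y
        * ((pd a (pd b (u t q)) y - ∑ c, pd c (u t q) y * christoffel G c a b y)
          + ∑ j, ∑ k, pd a (u t j) y * pd b (u t k) y * christoffel H q j k z) := by
    simp only [tensionLoc, ← hzdef]
    simp only [Finset.mul_sum]
    rw [sum_comm_four]
    refine Finset.sum_congr rfl fun a _ => Finset.sum_congr rfl fun b _ =>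
      Finset.sum_congr rfl fun p _ => Finset.sum_congr rfl fun q _ => ?_
    ring
  rw [e1, laplacianAlong]
  simp only [← Finset.sum_add_distrib, ← Finset.sum_sub_distrib]
  refine Finset.sum_congr rfl fun a _ => Finset.sum_congr rfl fun b _ => ?_
  rw [← mul_add, ← mul_sub]
  congr 1
  have hc := curvature_commutation (Γ := fun l j k => christoffel H l j k z)
    (h'.christoffel_symm hz) (fun p l j k => pd p (christoffel H l j k) z)
    (h'.pd_christoffel_symm hz) (fun i => v i y) (fun i => pd a (v i) y) (fun i => pd b (v i) y)
    (fun i => pd a (u t i) y) (fun i => pd b (u t i) y)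
    (fun i => pd a (pd b (u t i)) y - ∑ c, pd c (u t i) y * christoffel G c a b y) l
  beta_reduce at hc
  have e2 : covDeriv₂Along G H (u t) v a b l y
      = pd a (pd b (v l)) y - (∑ c, pd c (v l) y * christoffel G c a b y)
        + (∑ j, ∑ k, (pd a (v j) y * pd b (u t k) y * christoffel H l k j z
            + v j y * (pd a (pd b (u t k)) y - ∑ c, pd c (u t k) y * christoffel G c a b y)
              * christoffel H l k j z
            + v j y * pd b (u t k) y * ∑ p, pd p (christoffel H l k j) z * pd a (u t p) y))
        + ∑ j, ∑ k, (pd b (v j) y + ∑ p, ∑ q, v p y * pd b (u t q) y * christoffel H j q p z)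
            * pd a (u t k) y * christoffel H l k j z := by
    have e3 := pd_covDerivAlong h' hz hu hu1 hv hv1 a b l
    have e4 : ∑ c, christoffel G c a b y * covDerivAlong H (u t) v c l y
        = (∑ c, pd c (v l) y * christoffel G c a b y) + ∑ j, ∑ k, v j y
          * (∑ c, pd c (u t k) y * christoffel G c a b y) * christoffel H l k j z := by
      simp only [covDerivAlong, ← hzdef, mul_add, Finset.sum_add_distrib]
      congr 1
      · exact Finset.sum_congr rfl fun c _ => mul_comm _ _
      · simp only [Finset.mul_sum, Finset.sum_mul]
        rw [Finset.sum_comm]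
        refine Finset.sum_congr rfl fun j _ => ?_
        rw [Finset.sum_comm]
        exact Finset.sum_congr rfl fun k _ => Finset.sum_congr rfl fun c _ => by ring
    rw [covDeriv₂Along, e4]
    have e5 : covDerivAlong H (u t) (fun j => covDerivAlong H (u t) v b j) a l y
        = pd a (covDerivAlong H (u t) v b l) y + ∑ j, ∑ k, (pd b (v j) y
          + ∑ p, ∑ q, v p y * pd b (u t q) y * christoffel H j q p z)
            * pd a (u t k) y * christoffel H l k j z := rfl
    rw [e5, e3, ← hzdef]
    simp only [mul_sub, sub_mul, Finset.sum_add_distrib, Finset.sum_sub_distrib]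
    ring
  rw [e2]
  simp only [curvature]
  simp only [hzdef] at hc ⊢
  linear_combination hc

/-- The linearization of the covariant components of `A`. -/
theorem hasDerivAt_aBracketLoc (h' : IsLocalHermitian E' H o)
    (hz : (WithLp.toLp 2 fun l => u t l y : Model n) ∈ E')
    (ht : ∀ i, HasDerivAt (fun s => u s i y) (v i y) t)
    (ht1 : ∀ a i, HasDerivAt (fun s => pd a (u s i) y) (pd a (v i) y) t) (i : Fin n) :
    HasDerivAt (fun s => aBracketLoc G w o (u s) i y)
      (bracketLoc G w H o (u t) v i y
        + ∑ q, ∑ p, christoffel H q p i (WithLp.toLp 2 fun l => u t l y) * v p y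
          * aBracketLoc G w o (u t) q y) t := by
  have ho : ∀ i j, HasDerivAt (fun s => o i j (WithLp.toLp 2 fun l => u s l y)) _ t :=
    fun i j => hasDerivAt_comp_toLp (u := fun l s => u s l y) (h'.differentiableAt_form hz i j) ht
  have hdo : ∀ i j k, HasDerivAt (fun s => extDeriv₂ o i j k (WithLp.toLp 2 fun l => u s l y)) _ t :=
    fun i j k => hasDerivAt_comp_toLp (u := fun l s => u s l y)
      (h'.differentiableAt_extDeriv₂ hz i j k) ht
  have hs := (HasDerivAt.fun_sum (u := Finset.univ) fun b _ => HasDerivAt.fun_sum (u := Finset.univ)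
    fun j _ => ((ho i j).const_mul (∑ a, codiff G w a y * (G y)⁻¹ a b)).fun_mul (ht1 b j)).fun_add
    (HasDerivAt.fun_sum (u := Finset.univ) fun c _ => HasDerivAt.fun_sum (u := Finset.univ) fun e _ =>
      HasDerivAt.fun_sum (u := Finset.univ) fun j _ => HasDerivAt.fun_sum (u := Finset.univ) fun k _ =>
        (((hdo i j k).const_mul (raise G w c e y)).fun_mul (ht1 c j)).fun_mul (ht1 e k))
  refine hs.congr_deriv ?_
  set z : Model n := WithLp.toLp 2 fun l => u t l y with hzdef
  have e1 : ∑ q, ∑ p, christoffel H q p i z * v p y * aBracketLoc G w o (u t) q y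
      = (∑ b, (∑ a, codiff G w a y * (G y)⁻¹ a b) * ∑ q, ∑ p, christoffel H q p i z * v p y
          * ∑ j, o q j z * pd b (u t j) y)
        + ∑ c, ∑ e, raise G w c e y * ∑ q, ∑ p, christoffel H q p i z * v p y
          * ∑ j, ∑ k, extDeriv₂ o q j k z * pd c (u t j) y * pd e (u t k) y := by
    simp only [aBracketLoc, ← hzdef, mul_add, Finset.sum_add_distrib]
    congr 1
    · simp only [Finset.mul_sum _ _ (∑ a, codiff G w a y * (G y)⁻¹ a _)]
      simp only [Finset.mul_sum _ _ (christoffel H _ _ _ _ * _)]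
      refine (Finset.sum_congr rfl fun q _ => Finset.sum_comm).trans ?_
      rw [Finset.sum_comm]
      refine Finset.sum_congr rfl fun b _ => Finset.sum_congr rfl fun q _ =>
        Finset.sum_congr rfl fun p _ => ?_
      rw [Finset.mul_sum]
      exact Finset.sum_congr rfl fun j _ => by ring
    · have : ∀ c e q p, raise G w c e y * (christoffel H q p i z * v p y
            * ∑ j, ∑ k, extDeriv₂ o q j k z * pd c (u t j) y * pd e (u t k) y)
          = christoffel H q p i z * v p y
            * ∑ j, ∑ k, raise G w c e y * extDeriv₂ o q j k z * pd c (u t j) y * pd e (u t k) y := by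
        intro c e q p
        simp only [Finset.mul_sum]
        exact Finset.sum_congr rfl fun j _ => Finset.sum_congr rfl fun k _ => by ring
      simp only [Finset.mul_sum _ _ (raise G w _ _ _), this]
      rw [← sum_comm_four]
      exact Finset.sum_congr rfl fun q _ => Finset.sum_congr rfl fun p _ => by
        rw [Finset.mul_sum]
        exact Finset.sum_congr rfl fun c _ => Finset.mul_sum _ _ _
  have h2 := fun b => leibniz_two (Γ := fun l j k => christoffel H l j k z)
    (h'.christoffel_symm hz) (fun i j => o i j z) (fun p i j => pd p (o i j) z) (fun i => v i y)
    (fun i => pd b (u t i) y) (fun i => pd b (v i) y) i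
  have h3 := fun c e => leibniz_three (Γ := fun l j k => christoffel H l j k z)
    (h'.christoffel_symm hz) (fun i j k => extDeriv₂ o i j k z)
    (fun p i j k => pd p (extDeriv₂ o i j k) z) (fun i => v i y)
    (fun i => pd c (u t i) y) (fun i => pd c (v i) y) (fun i => pd e (u t i) y)
    (fun i => pd e (v i) y) i
  rw [e1, bracketLoc_eq, add_add_add_comm]
  congr 1
  · rw [← Finset.sum_add_distrib]
    refine Finset.sum_congr rfl fun b _ => ?_
    rw [← mul_add]
    refine Eq.trans ?_ (congrArg (fun r => (∑ a, codiff G w a y * (G y)⁻¹ a b) * r) (h2 b))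
    rw [Finset.mul_sum]
    exact Finset.sum_congr rfl fun j _ => by ring
  · rw [← Finset.sum_add_distrib]
    refine Finset.sum_congr rfl fun c _ => ?_
    rw [← Finset.sum_add_distrib]
    refine Finset.sum_congr rfl fun e _ => ?_
    rw [← mul_add]
    refine Eq.trans ?_ (congrArg (fun r => raise G w c e y * r) (h3 c e))
    rw [Finset.mul_sum]
    refine Finset.sum_congr rfl fun j _ => ?_
    rw [Finset.mul_sum]
    exact Finset.sum_congr rfl fun k _ => by ring

/-- The linearization of `A`. -/
theorem hasDerivAt_aTermLoc (h' : IsLocalHermitian E' H o)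
    (hz : (WithLp.toLp 2 fun l => u t l y : Model n) ∈ E')
    (ht : ∀ i, HasDerivAt (fun s => u s i y) (v i y) t)
    (ht1 : ∀ a i, HasDerivAt (fun s => pd a (u s i) y) (pd a (v i) y) t) (l : Fin n) :
    HasDerivAt (fun s => aTermLoc G w H o (u s) l y)
      ((1 / 2) * (∑ i, (H (WithLp.toLp 2 fun l => u t l y))⁻¹ i l
          * bracketLoc G w H o (u t) v i y)
        - ∑ p, ∑ q, christoffel H l p q (WithLp.toLp 2 fun l => u t l y) * v p y
            * aTermLoc G w H o (u t) q y) t := by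
  have hI : ∀ i l, HasDerivAt (fun s => (H (WithLp.toLp 2 fun l => u s l y))⁻¹ i l) _ t :=
    fun i l => hasDerivAt_comp_toLp (c := fun z => (H z)⁻¹ i l) (u := fun l s => u s l y)
      (h'.differentiableAt_inv hz i l) ht
  have hB := hasDerivAt_aBracketLoc (G := G) (w := w) h' hz ht ht1
  simp only [aTermLoc_eq]
  have hs := HasDerivAt.const_mul (1 / 2 : ℝ) (HasDerivAt.fun_sum (u := Finset.univ) fun i _ =>
    (hI i l).fun_mul (hB i))
  refine hs.congr_deriv ?_
  set z : Model n := WithLp.toLp 2 fun l => u t l y with hzdef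
  simp only [h'.pd_inv hz, mul_add, Finset.sum_add_distrib]
  have e1 : ∑ i, (∑ p, -((∑ r, christoffel H i p r z * (H z)⁻¹ r l)
        + ∑ r, christoffel H l p r z * (H z)⁻¹ i r) * v p y) * aBracketLoc G w o (u t) i y
      = -(∑ i, ∑ p, ∑ r, christoffel H i p r z * (H z)⁻¹ r l * v p y * aBracketLoc G w o (u t) i y)
        - ∑ p, ∑ r, christoffel H l p r z * v p y
          * ∑ i, (H z)⁻¹ i r * aBracketLoc G w o (u t) i y := by
    have e2 : ∑ p, ∑ r, christoffel H l p r z * v p y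
          * ∑ i, (H z)⁻¹ i r * aBracketLoc G w o (u t) i y
        = ∑ i, ∑ p, ∑ r, christoffel H l p r z * v p y
          * ((H z)⁻¹ i r * aBracketLoc G w o (u t) i y) := by
      simp only [Finset.mul_sum]
      rw [← sum_rotate_three]
    rw [e2, ← Finset.sum_neg_distrib, ← Finset.sum_sub_distrib]
    refine Finset.sum_congr rfl fun i _ => ?_
    rw [← Finset.sum_neg_distrib, ← Finset.sum_sub_distrib, Finset.sum_mul]
    refine Finset.sum_congr rfl fun p _ => ?_
    rw [← Finset.sum_neg_distrib, ← Finset.sum_sub_distrib, ← Finset.sum_add_distrib,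
      ← Finset.sum_neg_distrib, Finset.sum_mul, Finset.sum_mul]
    exact Finset.sum_congr rfl fun r _ => by ring
  have e3 : ∑ i, (H z)⁻¹ i l * ∑ q, ∑ p, christoffel H q p i z * v p y
        * aBracketLoc G w o (u t) q y
      = ∑ i, ∑ p, ∑ r, christoffel H i p r z * (H z)⁻¹ r l * v p y
        * aBracketLoc G w o (u t) i y := by
    simp only [Finset.mul_sum]
    rw [sum_rotate_three]
    exact Finset.sum_congr rfl fun i _ => Finset.sum_congr rfl fun p _ =>
      Finset.sum_congr rfl fun r _ => by ring
  have e4 : ∑ p, ∑ q, christoffel H l p q z * v p y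
        * (1 / 2 * ∑ i, (H z)⁻¹ i q * aBracketLoc G w o (u t) i y)
      = (1 / 2) * ∑ p, ∑ r, christoffel H l p r z * v p y
          * ∑ i, (H z)⁻¹ i r * aBracketLoc G w o (u t) i y := by
    rw [Finset.mul_sum]
    refine Finset.sum_congr rfl fun p _ => ?_
    rw [Finset.mul_sum]
    exact Finset.sum_congr rfl fun r _ => mul_left_comm _ _ _
  rw [e4]
  linear_combination (1 / 2) * e1 + (1 / 2) * e3

/-- `-L` is the linearization of `τ₊`, up to a term that vanishes where `τ₊(u) = 0`. -/
theorem hasDerivAt_tensionPlusLoc (h' : IsLocalHermitian E' H o)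
    (hz : (WithLp.toLp 2 fun l => u t l y : Model n) ∈ E')
    (hu : ∀ j, DifferentiableAt ℝ (u t j) y) (hu1 : ∀ b j, DifferentiableAt ℝ (pd b (u t j)) y)
    (hv : ∀ j, DifferentiableAt ℝ (v j) y) (hv1 : ∀ b j, DifferentiableAt ℝ (pd b (v j)) y)
    (ht : ∀ i, HasDerivAt (fun s => u s i y) (v i y) t)
    (ht1 : ∀ a i, HasDerivAt (fun s => pd a (u s i) y) (pd a (v i) y) t)
    (ht2 : ∀ a b i, HasDerivAt (fun s => pd a (pd b (u s i)) y) (pd a (pd b (v i)) y) t)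
    (l : Fin n) :
    HasDerivAt (fun s => tensionPlusLoc G w H o (u s) l y)
      (-lopLoc G w H o (u t) v l y - ∑ p, ∑ q,
        christoffel H l p q (WithLp.toLp 2 fun l => u t l y) * v p y
          * tensionPlusLoc G w H o (u t) q y) t := by
  refine ((hasDerivAt_tensionLoc (G := G) h' hz hu hu1 hv hv1 ht ht1 ht2 l).add
    (hasDerivAt_aTermLoc (G := G) (w := w) h' hz ht ht1 l)).congr_deriv ?_
  simp only [tensionPlusLoc, lopLoc, mul_add, Finset.sum_add_distrib]
  ring

/-- The derivative of `h(τ₊(uₛ), Vₛ)` at a parameter where `τ₊(uₛ) = 0`. -/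
theorem hasDerivAt_tensionPairLoc (h' : IsLocalHermitian E' H o)
    (hz : (WithLp.toLp 2 fun l => u t l y : Model n) ∈ E')
    (hu : ∀ j, DifferentiableAt ℝ (u t j) y) (hu1 : ∀ b j, DifferentiableAt ℝ (pd b (u t j)) y)
    (hv : ∀ j, DifferentiableAt ℝ (v j) y) (hv1 : ∀ b j, DifferentiableAt ℝ (pd b (v j)) y)
    (ht : ∀ i, HasDerivAt (fun s => u s i y) (v i y) t)
    (ht1 : ∀ a i, HasDerivAt (fun s => pd a (u s i) y) (pd a (v i) y) t)
    (ht2 : ∀ a b i, HasDerivAt (fun s => pd a (pd b (u s i)) y) (pd a (pd b (v i)) y) t)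
    {V : ℝ → Fin n → Model m → ℝ} (hVt : ∀ i, V t i y = v i y)
    (hV : ∀ i, DifferentiableAt ℝ (fun s => V s i y) t)
    (h0 : ∀ l, tensionPlusLoc G w H o (u t) l y = 0) :
    HasDerivAt (fun s => tensionPairLoc G w H o (u s) (V s) y)
      (-∑ i, ∑ l, H (WithLp.toLp 2 fun l => u t l y) i l * lopLoc G w H o (u t) v l y * v i y) t := by
  have hH : ∀ i l, HasDerivAt (fun s => H (WithLp.toLp 2 fun l => u s l y) i l) _ t :=
    fun i l => hasDerivAt_comp_toLp (c := fun z => H z i l) (u := fun l s => u s l y)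
      (h'.differentiableAt_metric hz i l) ht
  have hs := HasDerivAt.fun_sum (u := Finset.univ) fun i _ => (HasDerivAt.fun_sum (u := Finset.univ)
    fun l _ => (hH i l).fun_mul (hasDerivAt_tensionPlusLoc (G := G) (w := w) h' hz hu hu1 hv hv1 ht ht1
      ht2 l)).fun_mul (hV i).hasDerivAt
  refine hs.congr_deriv ?_
  simp only [h0, mul_zero, Finset.sum_const_zero, sub_zero, zero_add, add_zero, zero_mul, hVt]
  simp only [Finset.sum_mul, ← Finset.sum_neg_distrib]
  exact Finset.sum_congr rfl fun i _ => Finset.sum_congr rfl fun l _ => by ring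

end Linearization

/-! ### Coordinate frames -/

section Frames

variable {m n : ℕ}
  {M : Type*} [TopologicalSpace M] [ChartedSpace (Model m) M] [IsManifold (𝓡 m) ∞ M]
  {N : Type*} [TopologicalSpace N] [ChartedSpace (Model n) N] [IsManifold (𝓡 n) ∞ N]

theorem contMDiffOn_coordVec (x₀ : M) (i : Fin m) :
    ContMDiffOn (𝓡 m) (𝓡 m).tangent ∞ (fun y => (TotalSpace.mk' (Model m)
      ((chartAt (Model m) x₀).symm y) (coordVec (chartAt (Model m) x₀) y i) : TangentBundle (𝓡 m) M))
      (chartAt (Model m) x₀).target := by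
  set e := chartAt (Model m) x₀ with he
  have hsec : ContMDiff (𝓡 m) (𝓡 m).tangent ∞ (fun y : Model m =>
      (⟨y, (stdVec i : Model m)⟩ : TangentBundle (𝓡 m) (Model m))) :=
    contMDiff_vectorSpace_iff_contDiff.2 contDiff_const
  have h := ((contMDiffOn_chart_symm (I := 𝓡 m) (n := ∞)
    (x := x₀)).contMDiffOn_tangentMapWithin (m := ∞) (by simp)
      e.open_target.uniqueMDiffOn).comp (s := e.target) hsec.contMDiffOn (fun y hy => hy)
  refine h.congr fun y hy => ?_
  change (TotalSpace.mk' (Model m) (e.symm y) (coordVec e y i) : TangentBundle (𝓡 m) M)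
    = ⟨e.symm y, mfderivWithin (𝓡 m) (𝓡 m) e.symm e.target y (stdVec i : Model m)⟩
  rw [mfderivWithin_of_isOpen e.open_target hy]
  rfl

variable (g : AlmostHermitian m M) (h : AlmostHermitian n N)

theorem AlmostHermitian.contMDiffOn_inner {b : Model m → M} {s : Set (Model m)}
    {X Y : ∀ y, TangentSpace (𝓡 m) (b y)}
    (hX : ContMDiffOn (𝓡 m) (𝓡 m).tangent ∞
      (fun y => (TotalSpace.mk' (Model m) (b y) (X y) : TangentBundle (𝓡 m) M)) s)
    (hY : ContMDiffOn (𝓡 m) (𝓡 m).tangent ∞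
      (fun y => (TotalSpace.mk' (Model m) (b y) (Y y) : TangentBundle (𝓡 m) M)) s)
    (hb : ContMDiffOn (𝓡 m) (𝓡 m) ∞ b s) :
    ContDiffOn ℝ ∞ (fun y => g.metric.inner (b y) (X y) (Y y)) s := by
  rw [← contMDiffOn_iff_contDiffOn]
  intro y hy
  have : ContMDiffWithinAt (𝓡 m) ((𝓡 m).prod 𝓘(ℝ)) ∞
      (fun y ↦ TotalSpace.mk' ℝ (E := Bundle.Trivial M ℝ) (b y)
        (g.metric.inner (b y) (X y) (Y y))) s y := by
    apply ContMDiffWithinAt.clm_bundle_apply₂ (F₁ := Model m) (F₂ := Model m)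
    · exact ContMDiffAt.comp_contMDiffWithinAt y g.metric.contMDiff.contMDiffAt (hb y hy)
    · exact hX y hy
    · exact hY y hy
  simp only [contMDiffWithinAt_totalSpace] at this
  exact this.2

theorem AlmostHermitian.contDiffOn_metricLoc (x₀ : M) (i j : Fin m) :
    ContDiffOn ℝ ∞ (fun y => g.metricLoc (chartAt (Model m) x₀) y i j)
      (chartAt (Model m) x₀).target :=
  g.contMDiffOn_inner (contMDiffOn_coordVec x₀ i) (contMDiffOn_coordVec x₀ j)
    contMDiffOn_chart_symm

theorem AlmostHermitian.contDiffOn_formLoc (x₀ : M) (i j : Fin m) :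
    ContDiffOn ℝ ∞ (g.formLoc (chartAt (Model m) x₀) i j) (chartAt (Model m) x₀).target := by
  refine g.contMDiffOn_inner ?_ (contMDiffOn_coordVec x₀ j) contMDiffOn_chart_symm
  refine ContMDiffOn.clm_bundle_apply (F₁ := Model m) (F₂ := Model m) ?_ (contMDiffOn_coordVec x₀ i)
  exact g.contMDiff_J.comp_contMDiffOn contMDiffOn_chart_symm

end Frames

/-! ### The energy density as a quadratic form -/

section QuadraticForm

open LinearMap (BilinForm)

variable {m : ℕ} {V W : Type*} [AddCommGroup V] [Module ℝ V] [AddCommGroup W] [Module ℝ W]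

theorem posDef_toMatrix (b : Module.Basis (Fin m) ℝ V) {g : BilinForm ℝ V}
    (hs : ∀ X Y, g X Y = g Y X) (hp : ∀ X, X ≠ 0 → 0 < g X X) :
    (LinearMap.BilinForm.toMatrix b g).PosDef := by
  rw [Matrix.posDef_iff_dotProduct_mulVec]
  refine ⟨?_, fun x hx => ?_⟩
  · ext i j
    simp [LinearMap.BilinForm.toMatrix_apply, hs (b i) (b j)]
  · rw [star_trivial, LinearMap.BilinForm.dotProduct_toMatrix_mulVec]
    exact hp _ fun h => hx (b.equivFun.symm.map_eq_zero_iff.1 h)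

theorem sum_sum_eq_trace {A B : Matrix (Fin m) (Fin m) ℝ} (hA : A.transpose = A) :
    ∑ a, ∑ b, A a b * B a b = (A * B).trace := by
  conv_rhs => rw [← hA]
  rw [Finset.sum_comm]
  simp [Matrix.trace, Matrix.mul_apply]

theorem toMatrix_transpose (b : Module.Basis (Fin m) ℝ V) {g : BilinForm ℝ V}
    (hs : ∀ X Y, g X Y = g Y X) :
    (LinearMap.BilinForm.toMatrix b g).transpose = LinearMap.BilinForm.toMatrix b g := by
  ext i j
  simp [LinearMap.BilinForm.toMatrix_apply, hs (b i) (b j)]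

theorem inv_transpose_of_symm {A : Matrix (Fin m) (Fin m) ℝ} (hA : A.transpose = A) :
    (A⁻¹).transpose = A⁻¹ := by
  rw [Matrix.transpose_nonsing_inv, hA]

/-- The contraction `gᵃᵇ kₐᵦ` does not depend on the basis. -/
theorem trace_inv_mul_toMatrix (b c : Module.Basis (Fin m) ℝ V) (g k : BilinForm ℝ V) :
    ((LinearMap.BilinForm.toMatrix c g)⁻¹ * LinearMap.BilinForm.toMatrix c k).trace
      = ((LinearMap.BilinForm.toMatrix b g)⁻¹ * LinearMap.BilinForm.toMatrix b k).trace := by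
  set S := b.toMatrix c
  have hS : IsUnit S.det := by
    rw [← Matrix.isUnit_iff_isUnit_det]
    have := b.invertibleToMatrix c
    exact isUnit_of_invertible _
  have hST : IsUnit S.transpose.det := by rwa [Matrix.det_transpose]
  rw [← LinearMap.BilinForm.toMatrix_mul_basis_toMatrix b c g,
    ← LinearMap.BilinForm.toMatrix_mul_basis_toMatrix b c k,
    Matrix.mul_inv_rev, Matrix.mul_inv_rev]
  calc _ = (S⁻¹ * (LinearMap.BilinForm.toMatrix b g)⁻¹ * ((S.transpose)⁻¹ * S.transpose)
        * LinearMap.BilinForm.toMatrix b k * S).trace := by simp only [mul_assoc, S]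
    _ = _ := by
      rw [Matrix.nonsing_inv_mul _ hST, mul_one, Matrix.trace_mul_comm, ← mul_assoc, ← mul_assoc,
        Matrix.mul_nonsing_inv _ hS, one_mul]

/-- The identity `¼ |B + J_N B J_M|² = ½ (|B|² - ⟨ω_M, B^* ω_N⟩)`, in a basis of the source. -/
theorem quarter_normSq_add (b : Module.Basis (Fin m) ℝ V) {g : BilinForm ℝ V} {h : BilinForm ℝ W}
    {J : V →ₗ[ℝ] V} {J' : W →ₗ[ℝ] W} (B : V →ₗ[ℝ] W)
    (gs : ∀ X Y, g X Y = g Y X) (gp : ∀ X, X ≠ 0 → 0 < g X X) (gJ : ∀ X Y, g (J X) (J Y) = g X Y)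
    (hs : ∀ X Y, h X Y = h Y X) (hJ : ∀ X Y, h (J' X) (J' Y) = h X Y) (hJJ : ∀ X, J' (J' X) = -X) :
    (1 / 4) * ∑ a, ∑ c, (LinearMap.BilinForm.toMatrix b g)⁻¹ a c
        * h (B (b a) + J' (B (J (b a)))) (B (b c) + J' (B (J (b c))))
      = (1 / 2) * ∑ a, ∑ c, ((LinearMap.BilinForm.toMatrix b g)⁻¹ a c * h (B (b a)) (B (b c))
        - (∑ d, ∑ e, g (J (b d)) (b e) * (LinearMap.BilinForm.toMatrix b g)⁻¹ d a
            * (LinearMap.BilinForm.toMatrix b g)⁻¹ e c) * h (J' (B (b a))) (B (b c))) := by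
  set G := LinearMap.BilinForm.toMatrix b g with hG
  set j := LinearMap.toMatrix b b J with hj
  have hGu : IsUnit G.det := (posDef_toMatrix b gs gp).det_pos.ne'.isUnit
  have hGt : G.transpose = G := toMatrix_transpose b gs
  have hIt : (G⁻¹).transpose = G⁻¹ := inv_transpose_of_symm hGt
  let k : BilinForm ℝ V := h.comp B B
  let o : BilinForm ℝ V := (h.compLeft J').comp B B
  set K := LinearMap.BilinForm.toMatrix b k with hK
  set O := LinearMap.BilinForm.toMatrix b o with hO
  have hanti : ∀ X Y, h (J' X) Y = -h X (J' Y) := fun X Y => by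
    rw [← hJ (J' X) Y, hJJ, map_neg, LinearMap.neg_apply]
  have hOt : O.transpose = -O := by
    ext a c
    simp only [hO, Matrix.transpose_apply, Matrix.neg_apply, LinearMap.BilinForm.toMatrix_apply]
    change h (J' (B (b c))) (B (b a)) = -h (J' (B (b a))) (B (b c))
    rw [hanti, hs]
  have hjG : j.transpose * G * j = G := by
    rw [hj, hG, ← LinearMap.BilinForm.toMatrix_comp b b g J J]
    congr 1
    ext X Y
    exact gJ _ _
  have hju : IsUnit j.det := by
    have h1 := congrArg Matrix.det hjG
    rw [Matrix.det_mul] at h1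
    exact isUnit_of_mul_isUnit_right (h1 ▸ hGu)
  have hjI : j * G⁻¹ * j.transpose = G⁻¹ := by
    have hjtu : IsUnit j.transpose.det := by rwa [Matrix.det_transpose]
    conv_lhs => rw [← hjG]
    rw [Matrix.mul_inv_rev, Matrix.mul_inv_rev, ← mul_assoc, Matrix.mul_nonsing_inv _ hju, one_mul,
      mul_assoc, Matrix.nonsing_inv_mul _ hjtu, mul_one]
  have hw : (Matrix.of fun d e => g (J (b d)) (b e)) = j.transpose * G := by
    rw [hj, hG, ← LinearMap.BilinForm.toMatrix_compLeft b g J]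
    ext d e
    simp [LinearMap.BilinForm.toMatrix_apply]
  have hR : (Matrix.of fun a c => ∑ d, ∑ e, g (J (b d)) (b e) * G⁻¹ d a * G⁻¹ e c)
      = G⁻¹ * j.transpose := by
    have h1 : (Matrix.of fun a c => ∑ d, ∑ e, g (J (b d)) (b e) * G⁻¹ d a * G⁻¹ e c)
        = (G⁻¹).transpose * (Matrix.of fun d e => g (J (b d)) (b e)) * G⁻¹ := by
      ext a c
      simp only [Matrix.mul_apply, Finset.sum_mul, Matrix.transpose_apply, Matrix.of_apply]
      rw [Finset.sum_comm]
      exact Finset.sum_congr rfl fun _ _ => Finset.sum_congr rfl fun _ _ => by ring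
    rw [h1, hw, hIt, mul_assoc, mul_assoc, Matrix.mul_nonsing_inv _ hGu, mul_one]
  -- the four terms of the square
  have hsq : ∀ a c, h (B (b a) + J' (B (J (b a)))) (B (b c) + J' (B (J (b c))))
      = (K + j.transpose * O - O * j + j.transpose * K * j) a c := by
    intro a c
    have e1 : j.transpose * O = LinearMap.BilinForm.toMatrix b (o.compLeft J) :=
      (LinearMap.BilinForm.toMatrix_compLeft b o J).symm
    have e2 : O * j = LinearMap.BilinForm.toMatrix b (o.compRight J) :=
      (LinearMap.BilinForm.toMatrix_compRight b o J).symm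
    have e3 : j.transpose * K * j = LinearMap.BilinForm.toMatrix b (k.comp J J) :=
      (LinearMap.BilinForm.toMatrix_comp b b k J J).symm
    rw [e1, e2, e3]
    simp only [Matrix.add_apply, Matrix.sub_apply, hK, LinearMap.BilinForm.toMatrix_apply]
    change _ = h (B (b a)) (B (b c)) + h (J' (B (J (b a)))) (B (b c))
      - h (J' (B (b a))) (B (J (b c))) + h (B (J (b a))) (B (J (b c)))
    rw [map_add, map_add, LinearMap.add_apply, LinearMap.add_apply, hJ, hanti (B (b a))]
    ring
  have hl : ∑ a, ∑ c, G⁻¹ a c * h (B (b a) + J' (B (J (b a)))) (B (b c) + J' (B (J (b c))))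
      = (G⁻¹ * (K + j.transpose * O - O * j + j.transpose * K * j)).trace := by
    simp only [hsq]
    exact sum_sum_eq_trace hIt
  have hr1 : ∑ a, ∑ c, G⁻¹ a c * h (B (b a)) (B (b c)) = (G⁻¹ * K).trace := by
    rw [← sum_sum_eq_trace hIt]
    simp [hK, LinearMap.BilinForm.toMatrix_apply, k]
  have hr2 : ∑ a, ∑ c, (∑ d, ∑ e, g (J (b d)) (b e) * G⁻¹ d a * G⁻¹ e c)
      * h (J' (B (b a))) (B (b c)) = -(G⁻¹ * j.transpose * O).trace := by
    rw [← hR, ← Matrix.trace_neg, ← Matrix.mul_neg, ← hOt]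
    simp [Matrix.trace, Matrix.mul_apply, hO, LinearMap.BilinForm.toMatrix_apply, o]
  have hT : (G⁻¹ * (O * j)).trace = -(G⁻¹ * j.transpose * O).trace := by
    rw [← Matrix.trace_transpose, Matrix.transpose_mul, Matrix.transpose_mul, hIt, hOt,
      Matrix.mul_neg, Matrix.neg_mul, Matrix.trace_neg, Matrix.trace_mul_comm, mul_assoc]
  have hU : (G⁻¹ * (j.transpose * K * j)).trace = (G⁻¹ * K).trace := by
    conv_rhs => rw [← hjI]
    rw [← mul_assoc, Matrix.trace_mul_comm, ← mul_assoc, ← mul_assoc]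
  rw [hl]
  simp only [Finset.sum_sub_distrib]
  rw [hr1, hr2, mul_add, mul_sub, mul_add, Matrix.trace_add, Matrix.trace_sub, Matrix.trace_add, hT,
    hU, ← mul_assoc]
  ring

end QuadraticForm

/-! ### Coordinate expressions on an almost Hermitian manifold -/

/-- The standard basis of `ℝᵐ`, as a basis of a tangent space. -/
def stdBasis {m : ℕ} {M : Type*} [TopologicalSpace M] [ChartedSpace (Model m) M] (x : M) :
    Module.Basis (Fin m) ℝ (TangentSpace (𝓡 m) x) :=
  (EuclideanSpace.basisFun (Fin m) ℝ).toBasis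

theorem stdBasis_apply {m : ℕ} {M : Type*} [TopologicalSpace M] [ChartedSpace (Model m) M] (x : M)
    (i : Fin m) : stdBasis x i = (stdVec i : Model m) := by
  change (EuclideanSpace.basisFun (Fin m) ℝ).toBasis i = _
  simp [stdVec]

section Coordinates

set_option linter.unusedSectionVars false

variable {m n : ℕ}
  {M : Type*} [TopologicalSpace M] [ChartedSpace (Model m) M] [IsManifold (𝓡 m) ∞ M]
  {N : Type*} [TopologicalSpace N] [ChartedSpace (Model n) N] [IsManifold (𝓡 n) ∞ N]

/-- The coordinate vector fields of a chart, as a basis of the tangent space. -/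
def coordBasis (x₀ : M) {y : Model m} (hy : y ∈ (chartAt (Model m) x₀).target) :
    Module.Basis (Fin m) ℝ (TangentSpace (𝓡 m) ((chartAt (Model m) x₀).symm y)) :=
  (stdBasis y).map (LinearEquiv.ofBijective
      (mfderiv (𝓡 m) (𝓡 m) (chartAt (Model m) x₀).symm y).toLinearMap
      (OpenPartialHomeomorph.MDifferentiable.mfderiv_bijective
        (OpenPartialHomeomorph.MDifferentiable.symm (mdifferentiable_chart x₀)) hy))

theorem coordBasis_apply (x₀ : M) {y : Model m} (hy : y ∈ (chartAt (Model m) x₀).target)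
    (i : Fin m) : coordBasis x₀ hy i = coordVec (chartAt (Model m) x₀) y i := by
  rw [coordBasis, Module.Basis.map_apply, stdBasis_apply]
  rfl

variable (g : AlmostHermitian m M) (h : AlmostHermitian n N)

namespace AlmostHermitian

/-- The metric at a point, as a bilinear form. -/
def bilin (x : M) : LinearMap.BilinForm ℝ (TangentSpace (𝓡 m) x) :=
  LinearMap.mk₂ ℝ (fun X Y => g.metric.inner x X Y) (by simp) (by simp) (by simp) (by simp)

theorem bilin_apply (x : M) (X Y : TangentSpace (𝓡 m) x) :
    g.bilin x X Y = g.metric.inner x X Y := rfl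

theorem bilin_symm (x : M) (X Y : TangentSpace (𝓡 m) x) : g.bilin x X Y = g.bilin x Y X :=
  g.metric.symm x X Y

theorem bilin_pos (x : M) (X : TangentSpace (𝓡 m) x) (hX : X ≠ 0) : 0 < g.bilin x X X :=
  g.metric.pos x X hX

theorem metricLoc_eq_toMatrix (x₀ : M) {y : Model m} (hy : y ∈ (chartAt (Model m) x₀).target) :
    g.metricLoc (chartAt (Model m) x₀) y
      = LinearMap.BilinForm.toMatrix (coordBasis x₀ hy) (g.bilin _) := by
  ext i j
  rw [LinearMap.BilinForm.toMatrix_apply, coordBasis_apply, coordBasis_apply]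
  rfl

theorem form_antisymm (x : M) (X Y : TangentSpace (𝓡 m) x) : g.form x X Y = -g.form x Y X := by
  rw [form, form, ← g.metric_J x (g.J x X) Y, g.J_J, map_neg, neg_apply, g.metric.symm]

theorem posDef_metricLoc (x₀ : M) {y : Model m} (hy : y ∈ (chartAt (Model m) x₀).target) :
    (g.metricLoc (chartAt (Model m) x₀) y).PosDef := by
  rw [g.metricLoc_eq_toMatrix x₀ hy]
  exact posDef_toMatrix _ (g.bilin_symm _) (g.bilin_pos _)

theorem isLocalHermitian (x₀ : M) : IsLocalHermitian (chartAt (Model m) x₀).target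
    (g.metricLoc (chartAt (Model m) x₀)) (g.formLoc (chartAt (Model m) x₀)) where
  isOpen := (chartAt (Model m) x₀).open_target
  contDiffOn_metric := g.contDiffOn_metricLoc x₀
  contDiffOn_form := g.contDiffOn_formLoc x₀
  symm _ _ _ _ := g.metric.symm _ _ _
  det_pos _ hy := (g.posDef_metricLoc x₀ hy).det_pos
  antisymm _ _ _ _ := g.form_antisymm _ _ _

end AlmostHermitian

/-- The components of a tangent vector in the chart at `x₀`. -/
def components (x₀ : M) (x : M) (X : TangentSpace (𝓡 m) x) : Model m :=
  mfderiv (𝓡 m) (𝓡 m) (chartAt (Model m) x₀) x X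

theorem toLp_eq_sum_stdVec (c : Fin m → ℝ) :
    (WithLp.toLp 2 c : Model m) = ∑ i, c i • stdVec i := by
  ext j
  simp [stdVec, Finset.sum_apply, Pi.single_apply]

/-- A tangent vector at a point with coordinates `y` in terms of the coordinate frame. The point
is allowed to be only propositionally equal to the one at which the frame lives. -/
theorem sum_components_smul_coordVec (x₀ : M) {x : M} (hx : x ∈ (chartAt (Model m) x₀).source)
    (X : TangentSpace (𝓡 m) x) :
    (∑ i, components x₀ x X i • (coordVec (chartAt (Model m) x₀) (chartAt (Model m) x₀ x) i
      : Model m)) = (X : Model m) := by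
  have h1 := (mdifferentiable_chart (I := 𝓡 m) x₀).symm_comp_deriv hx
  have h2 := DFunLike.congr_fun h1 X
  change (mfderiv (𝓡 m) (𝓡 m) (chartAt (Model m) x₀).symm (chartAt (Model m) x₀ x)
    (mfderiv (𝓡 m) (𝓡 m) (chartAt (Model m) x₀) x X)) = X at h2
  have h3 : ∀ (T : Model m →L[ℝ] Model m) (z : Model m), T z = ∑ i, z i • T (stdVec i) := by
    intro T z
    conv_lhs => rw [show z = ∑ i, z i • stdVec i from toLp_eq_sum_stdVec fun i => z i]
    rw [map_sum]
    exact Finset.sum_congr rfl fun i _ => map_smul _ _ _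
  exact (h3 (mfderiv (𝓡 m) (𝓡 m) (chartAt (Model m) x₀).symm (chartAt (Model m) x₀ x))
    (components x₀ x X)).symm.trans h2

namespace AlmostHermitian

theorem inner_congr {p q : M} (hpq : p = q) (X Y : Model m) :
    g.metric.inner p X Y = g.metric.inner q X Y := by
  subst hpq; rfl

theorem form_congr {p q : M} (hpq : p = q) (X Y : Model m) : g.form p X Y = g.form q X Y := by
  subst hpq; rfl

theorem inner_sum_sum (x : M) (c d : Fin m → ℝ) (X Y : Fin m → TangentSpace (𝓡 m) x) :
    g.metric.inner x (∑ i, c i • X i) (∑ j, d j • Y j)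
      = ∑ i, ∑ j, g.metric.inner x (X i) (Y j) * c i * d j := by
  simp only [← g.bilin_apply]
  rw [LinearMap.map_sum₂]
  refine Finset.sum_congr rfl fun i _ => ?_
  rw [map_sum]
  refine Finset.sum_congr rfl fun j _ => ?_
  rw [map_smul, map_smul, LinearMap.smul_apply, smul_eq_mul, smul_eq_mul]
  ring

theorem inner_eq_sum (x₀ : M) {x : M} (hx : x ∈ (chartAt (Model m) x₀).source)
    (X Y : TangentSpace (𝓡 m) x) :
    g.metric.inner x X Y = ∑ i, ∑ j, g.metricLoc (chartAt (Model m) x₀) (chartAt (Model m) x₀ x) i j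
      * components x₀ x X i * components x₀ x Y j := by
  refine (g.inner_congr ((chartAt (Model m) x₀).left_inv hx) X Y).symm.trans ?_
  refine (congrArg₂ (fun X Y : Model m => g.metric.inner _ X Y)
    (sum_components_smul_coordVec x₀ hx X).symm
    (sum_components_smul_coordVec x₀ hx Y).symm).trans ?_
  exact g.inner_sum_sum _ _ _ _ _

theorem form_eq_sum (x₀ : M) {x : M} (hx : x ∈ (chartAt (Model m) x₀).source)
    (X Y : TangentSpace (𝓡 m) x) :
    g.form x X Y = ∑ i, ∑ j, g.formLoc (chartAt (Model m) x₀) i j (chartAt (Model m) x₀ x)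
      * components x₀ x X i * components x₀ x Y j := by
  refine (g.form_congr ((chartAt (Model m) x₀).left_inv hx) X Y).symm.trans ?_
  refine (congrArg₂ (fun X Y : Model m => g.form _ X Y)
    (sum_components_smul_coordVec x₀ hx X).symm
    (sum_components_smul_coordVec x₀ hx Y).symm).trans ?_
  have : ∀ p (c : Fin m → ℝ) (X : Fin m → TangentSpace (𝓡 m) p),
      g.J p (∑ i, c i • X i) = ∑ i, c i • g.J p (X i) := fun p c X => by
    rw [map_sum]; exact Finset.sum_congr rfl fun i _ => map_smul _ _ _
  refine (congrArg (fun Z => g.metric.inner _ Z _) (this _ _ _)).trans ?_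
  exact g.inner_sum_sum _ _ _ _ _

end AlmostHermitian

theorem components_ofComponents (q : N) (c : Fin n → ℝ) :
    components q q (ofComponents q c) = WithLp.toLp 2 c := by
  have h1 := (mdifferentiable_chart (I := 𝓡 n) q).comp_symm_deriv
    ((chartAt (Model n) q).map_source (mem_chart_source _ q))
  rw [(chartAt (Model n) q).left_inv (mem_chart_source _ q)] at h1
  exact DFunLike.congr_fun h1 (WithLp.toLp 2 c : Model n)

/-- The components of a map in the charts at `x₀` and `q₀`. -/
def mapComp (f : M → N) (x₀ : M) (q₀ : N) (i : Fin n) (y : Model m) : ℝ :=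
  (chartAt (Model n) q₀ (f ((chartAt (Model m) x₀).symm y)) : Model n) i

theorem toLp_mapComp (f : M → N) (x₀ : M) (q₀ : N) (y : Model m) :
    (WithLp.toLp 2 fun i => mapComp f x₀ q₀ i y : Model n)
      = chartAt (Model n) q₀ (f ((chartAt (Model m) x₀).symm y)) := rfl

theorem components_mfderiv_coordVec {f : M → N} {x₀ : M} {q₀ : N} {y : Model m}
    (hy : y ∈ (chartAt (Model m) x₀).target)
    (hf : MDifferentiableAt (𝓡 m) (𝓡 n) f ((chartAt (Model m) x₀).symm y))
    (hfy : f ((chartAt (Model m) x₀).symm y) ∈ (chartAt (Model n) q₀).source) (a : Fin m)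
    (i : Fin n) :
    components q₀ _ (mfderiv (𝓡 m) (𝓡 n) f ((chartAt (Model m) x₀).symm y)
      (coordVec (chartAt (Model m) x₀) y a)) i = pd a (mapComp f x₀ q₀ i) y := by
  have h1 : MDifferentiableAt (𝓡 m) (𝓡 m) (chartAt (Model m) x₀).symm y :=
    (mdifferentiable_chart x₀).mdifferentiableAt_symm hy
  have h2 : MDifferentiableAt (𝓡 n) (𝓡 n) (chartAt (Model n) q₀)
      (f ((chartAt (Model m) x₀).symm y)) := (mdifferentiable_chart q₀).mdifferentiableAt hfy
  have h3 := (h2.hasMFDerivAt.comp _ hf.hasMFDerivAt).comp y h1.hasMFDerivAt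
  have h4 := hasMFDerivAt_iff_hasFDerivAt.1 h3
  have h5 := (EuclideanSpace.proj (𝕜 := ℝ) (ι := Fin n) i).hasFDerivAt.comp y h4
  have h6 : fderiv ℝ (mapComp f x₀ q₀ i) y = _ := h5.fderiv
  rw [pd, h6]
  rfl

namespace AlmostHermitian

/-- The energy density in any pair of charts. -/
theorem energyDensity_eq_energyLoc {f : M → N} {x₀ : M} {q₀ : N} {y : Model m}
    (hy : y ∈ (chartAt (Model m) x₀).target)
    (hf : MDifferentiableAt (𝓡 m) (𝓡 n) f ((chartAt (Model m) x₀).symm y))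
    (hfy : f ((chartAt (Model m) x₀).symm y) ∈ (chartAt (Model n) q₀).source) :
    energyDensity g h f ((chartAt (Model m) x₀).symm y)
      = energyLoc (g.metricLoc (chartAt (Model m) x₀)) (g.formLoc (chartAt (Model m) x₀))
        (h.metricLoc (chartAt (Model n) q₀)) (h.formLoc (chartAt (Model n) q₀))
        (mapComp f x₀ q₀) y := by
  set x := (chartAt (Model m) x₀).symm y with hx
  set B : TangentSpace (𝓡 m) x →ₗ[ℝ] TangentSpace (𝓡 n) (f x) :=
    (mfderiv (𝓡 m) (𝓡 n) f x).toLinearMap with hB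
  set C : TangentSpace (𝓡 m) x →ₗ[ℝ] TangentSpace (𝓡 n) (f x) :=
    B + (h.J (f x)).toLinearMap.comp (B.comp (g.J x).toLinearMap) with hC
  set G := LinearMap.BilinForm.toMatrix (coordBasis x₀ hy) (g.bilin x) with hG
  have hGl : g.metricLoc (chartAt (Model m) x₀) y = G := g.metricLoc_eq_toMatrix x₀ hy
  let k : LinearMap.BilinForm ℝ (TangentSpace (𝓡 m) x) := (h.bilin (f x)).comp C C
  have hb : ∀ b : Module.Basis (Fin m) ℝ (TangentSpace (𝓡 m) x),
      ∑ a, ∑ c, (LinearMap.BilinForm.toMatrix b (g.bilin x))⁻¹ a c * k (b a) (b c)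
      = ((LinearMap.BilinForm.toMatrix b (g.bilin x))⁻¹ * LinearMap.BilinForm.toMatrix b k).trace := by
    intro b
    rw [← sum_sum_eq_trace (inv_transpose_of_symm (toMatrix_transpose b (g.bilin_symm x)))]
    simp only [LinearMap.BilinForm.toMatrix_apply]
  have h1 : energyDensity g h f x = (1 / 4) * ∑ a, ∑ c,
      (LinearMap.BilinForm.toMatrix (stdBasis x) (g.bilin x))⁻¹ a c
        * k (stdBasis x a) (stdBasis x c) := by
    rw [energyDensity, normSq]
    have : LinearMap.BilinForm.toMatrix (stdBasis x) (g.bilin x)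
        = Matrix.of fun a c => g.metric.inner x (stdVec a : Model m) (stdVec c : Model m) := by
      ext a c
      rw [LinearMap.BilinForm.toMatrix_apply, stdBasis_apply, stdBasis_apply]; rfl
    rw [this]
    simp only [stdBasis_apply]
    rfl
  have h2 : ∀ a i, components q₀ (f x) (B (coordBasis x₀ hy a)) i = pd a (mapComp f x₀ q₀ i) y := by
    intro a i
    rw [coordBasis_apply]
    exact components_mfderiv_coordVec hy hf hfy a i
  rw [h1, hb, trace_inv_mul_toMatrix (coordBasis x₀ hy), ← hb]
  refine (quarter_normSq_add (coordBasis x₀ hy) (J := (g.J x).toLinearMap)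
    (J' := (h.J (f x)).toLinearMap) B (g.bilin_symm x) (g.bilin_pos x) (g.metric_J x)
    (h.bilin_symm (f x)) (h.metric_J (f x)) (h.J_J (f x))).trans ?_
  rw [energyLoc]
  congr 1
  refine Finset.sum_congr rfl fun a _ => Finset.sum_congr rfl fun c _ => ?_
  have e1 : h.bilin (f x) (B (coordBasis x₀ hy a)) (B (coordBasis x₀ hy c)) = _ :=
    h.inner_eq_sum q₀ hfy _ _
  have e2 : h.bilin (f x) ((h.J (f x)).toLinearMap (B (coordBasis x₀ hy a)))
      (B (coordBasis x₀ hy c)) = _ := h.form_eq_sum q₀ hfy _ _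
  rw [e1, e2, Finset.mul_sum, Finset.mul_sum, ← Finset.sum_sub_distrib]
  refine Finset.sum_congr rfl fun i _ => ?_
  rw [Finset.mul_sum, Finset.mul_sum, ← Finset.sum_sub_distrib]
  refine Finset.sum_congr rfl fun j _ => ?_
  rw [h2, h2, energyCoeff, hGl, toLp_mapComp, raise, hGl]
  simp only [coordBasis_apply]
  have e3 : ∀ d e, (g.bilin x) ((g.J x).toLinearMap (coordVec (chartAt (Model m) x₀) y d))
      (coordVec (chartAt (Model m) x₀) y e) = g.formLoc (chartAt (Model m) x₀) d e y := fun _ _ => rfl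
  simp only [e3]
  ring

end AlmostHermitian

end Coordinates

/-! ### Variations in coordinates -/

section VariationCoordinates

set_option linter.unusedSectionVars false

variable {m n : ℕ}
  {M : Type*} [TopologicalSpace M] [ChartedSpace (Model m) M] [IsManifold (𝓡 m) ∞ M]
  {N : Type*} [TopologicalSpace N] [ChartedSpace (Model n) N] [IsManifold (𝓡 n) ∞ N]

theorem two_le_infty : (2 : WithTop ℕ∞) ≤ ((⊤ : ℕ∞) : WithTop ℕ∞) :=
  WithTop.coe_le_coe.2 (le_top : (2 : ℕ∞) ≤ ⊤)

theorem contDiffOn_of_contMDiffOn_prod {f : Model m × ℝ → Model n} {s : Set (Model m × ℝ)}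
    (hf : ContMDiffOn ((𝓡 m).prod 𝓘(ℝ, ℝ)) (𝓡 n) 2 f s) : ContDiffOn ℝ 2 f s := by
  rwa [← modelWithCornersSelf_prod, chartedSpaceSelf_prod, contMDiffOn_iff_contDiffOn] at hf

/-- The components of the variation `F` in the charts at `x₀` and `q₀`, as functions of space and
time. -/
def varComp (F : ℝ → M → N) (x₀ : M) (q₀ : N) (i : Fin n) (p : Model m × ℝ) : ℝ :=
  mapComp (F p.2) x₀ q₀ i p.1

/-- The components of the velocity of `F`. -/
def velComp (F : ℝ → M → N) (x₀ : M) (q₀ : N) (i : Fin n) (p : Model m × ℝ) : ℝ :=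
  components q₀ _ (velocity F p.2 ((chartAt (Model m) x₀).symm p.1)) i

/-- The set of points and times at which the charts at `x₀` and `q₀` can be used. -/
def varDomain (m n : ℕ) {M : Type*} [TopologicalSpace M] [ChartedSpace (Model m) M]
    {N : Type*} [TopologicalSpace N] [ChartedSpace (Model n) N]
    (F : ℝ → M → N) (ε : ℝ) (x₀ : M) (q₀ : N) : Set (Model m × ℝ) :=
  ((chartAt (Model m) x₀).target ×ˢ Ioo (-ε) ε) ∩
    (fun p => F p.2 ((chartAt (Model m) x₀).symm p.1)) ⁻¹' (chartAt (Model n) q₀).source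

namespace IsCompactVariation

variable {F : ℝ → M → N} {K : Set M} {ε : ℝ} (hF : IsCompactVariation m n F K ε)
include hF

theorem contMDiffOn_comp_symm (x₀ : M) : ContMDiffOn ((𝓡 m).prod 𝓘(ℝ, ℝ)) (𝓡 n) 2
    (fun p : Model m × ℝ => F p.2 ((chartAt (Model m) x₀).symm p.1))
    ((chartAt (Model m) x₀).target ×ˢ Ioo (-ε) ε) := by
  refine hF.contMDiffOn.comp (t := univ ×ˢ Ioo (-ε) ε)
    (f := fun p : Model m × ℝ => ((chartAt (Model m) x₀).symm p.1, p.2)) ?_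
      fun p hp => ⟨mem_univ _, hp.2⟩
  exact ((contMDiffOn_chart_symm (n := 2)).comp contMDiffOn_fst fun p hp => hp.1).prodMk
    contMDiffOn_snd

theorem isOpen_varDomain (x₀ : M) (q₀ : N) : IsOpen (varDomain m n F ε x₀ q₀) :=
  (hF.contMDiffOn_comp_symm x₀).continuousOn.isOpen_inter_preimage
    ((chartAt (Model m) x₀).open_target.prod isOpen_Ioo) (chartAt (Model n) q₀).open_source

theorem contDiffOn_varComp (x₀ : M) (q₀ : N) (i : Fin n) :
    ContDiffOn ℝ 2 (varComp F x₀ q₀ i) (varDomain m n F ε x₀ q₀) := by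
  have h1 : ContMDiffOn ((𝓡 m).prod 𝓘(ℝ, ℝ)) (𝓡 n) 2 (fun p : Model m × ℝ =>
      chartAt (Model n) q₀ (F p.2 ((chartAt (Model m) x₀).symm p.1))) (varDomain m n F ε x₀ q₀) :=
    (contMDiffOn_chart (n := 2)).comp ((hF.contMDiffOn_comp_symm x₀).mono inter_subset_left)
      fun p hp => hp.2
  exact (EuclideanSpace.proj (𝕜 := ℝ) (ι := Fin n) i).contDiff.comp_contDiffOn
    (contDiffOn_of_contMDiffOn_prod h1)

theorem contDiffOn_velComp (x₀ : M) (q₀ : N) (i : Fin n) :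
    ContDiffOn ℝ 2 (velComp F x₀ q₀ i) (varDomain m n F ε x₀ q₀) := by
  have h0 : ContMDiffOn ((𝓡 m).prod 𝓘(ℝ, ℝ)) (𝓡 n).tangent 2
      (fun p : Model m × ℝ => (⟨F p.2 ((chartAt (Model m) x₀).symm p.1),
        velocity F p.2 ((chartAt (Model m) x₀).symm p.1)⟩ : TangentBundle (𝓡 n) N))
      ((chartAt (Model m) x₀).target ×ˢ Ioo (-ε) ε) := by
    refine hF.contMDiffOn_velocity.comp (t := univ ×ˢ Ioo (-ε) ε)
      (f := fun p : Model m × ℝ => ((chartAt (Model m) x₀).symm p.1, p.2)) ?_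
      fun p hp => ⟨mem_univ _, hp.2⟩
    exact ((contMDiffOn_chart_symm (n := 2)).comp contMDiffOn_fst fun p hp => hp.1).prodMk
      contMDiffOn_snd
  have h1 := (((contMDiffOn_chart (I := 𝓡 n) (n := ∞) (x := q₀)).contMDiffOn_tangentMapWithin (m := ∞)
    (by simp) (chartAt (Model n) q₀).open_source.uniqueMDiffOn).of_le two_le_infty).comp
      (h0.mono inter_subset_left) (s := varDomain m n F ε x₀ q₀) fun p hp => hp.2
  have h2 : ContMDiffOn ((𝓡 m).prod 𝓘(ℝ, ℝ)) (𝓡 n) 2 (fun p : Model m × ℝ =>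
      (mfderivWithin (𝓡 n) (𝓡 n) (chartAt (Model n) q₀) (chartAt (Model n) q₀).source
        (F p.2 ((chartAt (Model m) x₀).symm p.1))
        (velocity F p.2 ((chartAt (Model m) x₀).symm p.1)) : Model n)) (varDomain m n F ε x₀ q₀) :=
    (contMDiff_snd_tangentBundle_modelSpace (Model n) (𝓡 n) (n := 2)).comp_contMDiffOn h1
  refine ((EuclideanSpace.proj (𝕜 := ℝ) (ι := Fin n) i).contDiff.comp_contDiffOn
    (contDiffOn_of_contMDiffOn_prod h2)).congr
    fun p hp => ?_
  have e := mfderivWithin_of_isOpen (I := 𝓡 n) (I' := 𝓡 n) (f := chartAt (Model n) q₀)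
    (chartAt (Model n) q₀).open_source hp.2
  exact congrArg (fun T : Model n →L[ℝ] Model n =>
    T (velocity F p.2 ((chartAt (Model m) x₀).symm p.1)) i) e.symm

theorem contMDiffAt {x : M} {t : ℝ} (ht : t ∈ Ioo (-ε) ε) :
    ContMDiffAt ((𝓡 m).prod 𝓘(ℝ, ℝ)) (𝓡 n) 2 (fun p : M × ℝ => F p.2 p.1) (x, t) :=
  (hF.contMDiffOn (x, t) ⟨mem_univ _, ht⟩).contMDiffAt
    ((isOpen_univ.prod isOpen_Ioo).mem_nhds ⟨mem_univ _, ht⟩)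

/-- The variation with a time that depends on the point. -/
theorem mdifferentiableAt_comp {x : M} {τ : M → ℝ} (ht : τ x ∈ Ioo (-ε) ε)
    (hτ : MDifferentiableAt (𝓡 m) 𝓘(ℝ, ℝ) τ x) :
    MDifferentiableAt (𝓡 m) (𝓡 n) (fun x => F (τ x) x) x :=
  ((hF.contMDiffAt ht).mdifferentiableAt (by norm_num)).comp x
    (f := fun x => (x, τ x)) (mdifferentiableAt_id.prodMk hτ)

theorem mdifferentiableAt {x : M} {t : ℝ} (ht : t ∈ Ioo (-ε) ε) :
    MDifferentiableAt (𝓡 m) (𝓡 n) (F t) x :=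
  hF.mdifferentiableAt_comp (τ := fun _ => t) ht mdifferentiableAt_const

theorem hasDerivAt_varComp {x₀ : M} {q₀ : N} {p : Model m × ℝ} (hp : p ∈ varDomain m n F ε x₀ q₀)
    (i : Fin n) : HasDerivAt (fun s => varComp F x₀ q₀ i (p.1, s)) (velComp F x₀ q₀ i p) p.2 := by
  have h1 : MDifferentiableAt 𝓘(ℝ, ℝ) (𝓡 n) (fun s => F s ((chartAt (Model m) x₀).symm p.1)) p.2 :=
    ((hF.contMDiffAt hp.1.2).mdifferentiableAt (by norm_num)).comp p.2
      (f := fun s => ((chartAt (Model m) x₀).symm p.1, s))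
      (mdifferentiableAt_const.prodMk mdifferentiableAt_id)
  have h2 : MDifferentiableAt (𝓡 n) (𝓡 n) (chartAt (Model n) q₀)
      (F p.2 ((chartAt (Model m) x₀).symm p.1)) := (mdifferentiable_chart q₀).mdifferentiableAt hp.2
  have h3 := hasMFDerivAt_iff_hasFDerivAt.1
    (HasMFDerivAt.comp (I' := 𝓡 n) p.2 h2.hasMFDerivAt h1.hasMFDerivAt)
  exact ((EuclideanSpace.proj (𝕜 := ℝ) (ι := Fin n) i).hasFDerivAt.comp p.2 h3).hasDerivAt

theorem hasDerivAt_spd_varComp {x₀ : M} {q₀ : N} {p : Model m × ℝ}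
    (hp : p ∈ varDomain m n F ε x₀ q₀) (a : Fin m) (i : Fin n) :
    HasDerivAt (fun s => spd a (varComp F x₀ q₀ i) (p.1, s))
      (spd a (velComp F x₀ q₀ i) p) p.2 :=
  hasDerivAt_spd (hF.isOpen_varDomain x₀ q₀)
    ((hF.contDiffOn_varComp x₀ q₀ i).of_le (by norm_num))
    ((hF.contDiffOn_velComp x₀ q₀ i).of_le (by norm_num))
    (fun _ hq => hF.hasDerivAt_varComp hq i) a hp

theorem hasDerivAt_spd_spd_varComp {x₀ : M} {q₀ : N} {p : Model m × ℝ}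
    (hp : p ∈ varDomain m n F ε x₀ q₀) (a b : Fin m) (i : Fin n) :
    HasDerivAt (fun s => spd a (spd b (varComp F x₀ q₀ i)) (p.1, s))
      (spd a (spd b (velComp F x₀ q₀ i)) p) p.2 :=
  hasDerivAt_spd (hF.isOpen_varDomain x₀ q₀)
    (contDiffOn_spd (hF.isOpen_varDomain x₀ q₀) (hF.contDiffOn_varComp x₀ q₀ i) (by norm_num) b)
    (contDiffOn_spd (hF.isOpen_varDomain x₀ q₀) (hF.contDiffOn_velComp x₀ q₀ i) (by norm_num) b)
    (fun _ hq => hF.hasDerivAt_spd_varComp hq b i) a hp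

theorem isParamC1_varComp (x₀ : M) (q₀ : N) (i : Fin n) :
    IsParamC1 (varDomain m n F ε x₀ q₀) (varComp F x₀ q₀ i) :=
  ⟨(hF.contDiffOn_varComp x₀ q₀ i).continuousOn, _, (hF.contDiffOn_velComp x₀ q₀ i).continuousOn,
    fun _ hq => hF.hasDerivAt_varComp hq i⟩

theorem isParamC1_spd_varComp (x₀ : M) (q₀ : N) (a : Fin m) (i : Fin n) :
    IsParamC1 (varDomain m n F ε x₀ q₀) (spd a (varComp F x₀ q₀ i)) :=
  ⟨(contDiffOn_spd (hF.isOpen_varDomain x₀ q₀) (hF.contDiffOn_varComp x₀ q₀ i)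
      (l := 1) (by norm_num) a).continuousOn, _,
    (contDiffOn_spd (hF.isOpen_varDomain x₀ q₀) (hF.contDiffOn_velComp x₀ q₀ i)
      (l := 1) (by norm_num) a).continuousOn, fun _ hq => hF.hasDerivAt_spd_varComp hq a i⟩

theorem isParamC1_spd_spd_varComp (x₀ : M) (q₀ : N) (a b : Fin m) (i : Fin n) :
    IsParamC1 (varDomain m n F ε x₀ q₀) (spd a (spd b (varComp F x₀ q₀ i))) :=
  ⟨(contDiffOn_spd (hF.isOpen_varDomain x₀ q₀) (contDiffOn_spd (hF.isOpen_varDomain x₀ q₀)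
      (hF.contDiffOn_varComp x₀ q₀ i) (l := 1) (by norm_num) b) (l := 0) (by norm_num) a).continuousOn,
    _, (contDiffOn_spd (hF.isOpen_varDomain x₀ q₀) (contDiffOn_spd (hF.isOpen_varDomain x₀ q₀)
      (hF.contDiffOn_velComp x₀ q₀ i) (l := 1) (by norm_num) b) (l := 0) (by norm_num) a).continuousOn,
    fun _ hq => hF.hasDerivAt_spd_spd_varComp hq a b i⟩

theorem isParamC1_velComp (x₀ : M) (q₀ : N) (i : Fin n) :
    IsParamC1 (varDomain m n F ε x₀ q₀) (velComp F x₀ q₀ i) := by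
  have hD := hF.isOpen_varDomain x₀ q₀
  have hV := hF.contDiffOn_velComp x₀ q₀ i
  refine ⟨hV.continuousOn, fun q => fderiv ℝ (velComp F x₀ q₀ i) q (0, 1),
    (hV.continuousOn_fderiv_of_isOpen hD (by norm_num)).clm_apply continuousOn_const,
    fun q hq => ?_⟩
  have h1 : HasDerivAt (fun s : ℝ => ((q.1, s) : Model m × ℝ)) (0, 1) q.2 :=
    (hasDerivAt_const q.2 q.1).prodMk (hasDerivAt_id q.2)
  exact (((hV q hq).contDiffAt (hD.mem_nhds hq)).differentiableAt
    (by norm_num)).hasFDerivAt.comp_hasDerivAt q.2 h1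

end IsCompactVariation

end VariationCoordinates

/-! ### The first variation of the energy density -/

section FirstVariation

set_option linter.unusedSectionVars false

variable {m n : ℕ}

section Local

variable {G : Model m → Matrix (Fin m) (Fin m) ℝ} {w : Fin m → Fin m → Model m → ℝ}
  {H : Model n → Matrix (Fin n) (Fin n) ℝ} {o : Fin n → Fin n → Model n → ℝ}
  {u : Fin n → Model m → ℝ} {y : Model m}

theorem firstVarLoc_congr {W W' : Fin n → Model m → ℝ} (hW : ∀ i, W i =ᶠ[𝓝 y] W' i) :
    firstVarLoc G w H o u W y = firstVarLoc G w H o u W' y := by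
  simp only [firstVarLoc, fun i => (hW i).eq_of_nhds, fun a i => pd_congr (hW i) a]

theorem firstVarLoc_zero : firstVarLoc G w H o u (fun _ _ => 0) y = 0 := by
  simp [firstVarLoc, pd]

theorem firstVarLoc_add {W W' : Fin n → Model m → ℝ} (hW : ∀ i, DifferentiableAt ℝ (W i) y)
    (hW' : ∀ i, DifferentiableAt ℝ (W' i) y) :
    firstVarLoc G w H o u (fun i y => W i y + W' i y) y
      = firstVarLoc G w H o u W y + firstVarLoc G w H o u W' y := by
  simp only [firstVarLoc, fun a i => pd_add (hW i) (hW' i) a]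
  simp only [mul_add, add_mul, Finset.sum_add_distrib]
  ring

theorem firstVarLoc_sum {ι : Type*} (s : Finset ι) {W : ι → Fin n → Model m → ℝ}
    (hW : ∀ k ∈ s, ∀ i, DifferentiableAt ℝ (W k i) y) :
    firstVarLoc G w H o u (fun i y => ∑ k ∈ s, W k i y) y
      = ∑ k ∈ s, firstVarLoc G w H o u (W k) y := by
  classical
  induction s using Finset.induction_on with
  | empty => simpa using firstVarLoc_zero
  | insert k s hk ih =>
    rw [Finset.sum_insert hk, ← ih fun l hl => hW l (by simp [hl]), ← firstVarLoc_add
      (hW k (by simp)) fun i => DifferentiableAt.fun_sum fun l hl => hW l (by simp [hl]) i]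
    simp only [Finset.sum_insert hk]

end Local

variable
  {M : Type*} [TopologicalSpace M] [ChartedSpace (Model m) M] [IsManifold (𝓡 m) ∞ M]
  {N : Type*} [TopologicalSpace N] [ChartedSpace (Model n) N] [IsManifold (𝓡 n) ∞ N]
  (g : AlmostHermitian m M) (h : AlmostHermitian n N)

theorem energyDensity_congr {f f' : M → N} {x : M} (hf : f =ᶠ[𝓝 x] f') :
    energyDensity g h f x = energyDensity g h f' x := by
  have key : ∀ (q q' : N) (B : TangentSpace (𝓡 m) x →L[ℝ] TangentSpace (𝓡 n) q)
      (B' : TangentSpace (𝓡 m) x →L[ℝ] TangentSpace (𝓡 n) q'), q = q' → B ≍ B' →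
      (1 / 4) * normSq g h x q (B + (h.J q).comp (B.comp (g.J x)))
        = (1 / 4) * normSq g h x q' (B' + (h.J q').comp (B'.comp (g.J x))) := by
    rintro q _ B _ rfl hB
    rw [eq_of_heq hB]
  refine key _ _ _ _ hf.eq_of_nhds ?_
  exact @heq_of_eq (Model m →L[ℝ] Model n) _ _ hf.mfderiv_eq

/-- The first variation of the energy density in the direction `φ ∂ₜF`, where `φ` is a function on
`M`. It is defined without reference to charts, by varying `F t` along the family itself. -/
def firstVarDensity (F : ℝ → M → N) (t : ℝ) (φ : M → ℝ) (x : M) : ℝ :=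
  deriv (fun σ => energyDensity g h (fun x => F (t + σ * φ x) x) x) 0

/-- The components of `⟨τ₊(F t), ∂ₜF⟩`, computed in the charts at `x₀` and `q₀`. -/
def varPair (F : ℝ → M → N) (x₀ : M) (q₀ : N) (p : Model m × ℝ) : ℝ :=
  tensionPairLoc (g.metricLoc (chartAt (Model m) x₀)) (g.formLoc (chartAt (Model m) x₀))
    (h.metricLoc (chartAt (Model n) q₀)) (h.formLoc (chartAt (Model n) q₀))
    (fun i y => varComp F x₀ q₀ i (y, p.2)) (fun i y => velComp F x₀ q₀ i (y, p.2)) p.1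

/-- The first variation of the energy density at `F t` in the direction `φ ∂ₜF`, computed in the
charts at `x₀` and `q₀`; here `φ` is a function of the coordinates. -/
def varFirst (F : ℝ → M → N) (x₀ : M) (q₀ : N) (φ : Model m → ℝ) (p : Model m × ℝ) : ℝ :=
  firstVarLoc (g.metricLoc (chartAt (Model m) x₀)) (g.formLoc (chartAt (Model m) x₀))
    (h.metricLoc (chartAt (Model n) q₀)) (h.formLoc (chartAt (Model n) q₀))
    (fun i y => varComp F x₀ q₀ i (y, p.2)) (fun i y => φ y * velComp F x₀ q₀ i (y, p.2)) p.1

theorem differentiableAt_comp_symm {φ : M → ℝ} {x₀ : M} {y : Model m}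
    (hy : y ∈ (chartAt (Model m) x₀).target)
    (hφ : MDifferentiableAt (𝓡 m) 𝓘(ℝ, ℝ) φ ((chartAt (Model m) x₀).symm y)) :
    DifferentiableAt ℝ (fun y => φ ((chartAt (Model m) x₀).symm y)) y :=
  mdifferentiableAt_iff_differentiableAt.1
    (hφ.comp y ((mdifferentiable_chart x₀).mdifferentiableAt_symm hy))

namespace IsCompactVariation

variable {F : ℝ → M → N} {K : Set M} {ε : ℝ} (hF : IsCompactVariation m n F K ε)
include hF

theorem toLp_varComp_mem {x₀ : M} {q₀ : N} {p : Model m × ℝ} (hp : p ∈ varDomain m n F ε x₀ q₀) :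
    (WithLp.toLp 2 fun i => varComp F x₀ q₀ i p : Model n) ∈ (chartAt (Model n) q₀).target :=
  (chartAt (Model n) q₀).map_source hp.2

theorem differentiableAt_varComp {x₀ : M} {q₀ : N} {p : Model m × ℝ}
    (hp : p ∈ varDomain m n F ε x₀ q₀) (i : Fin n) : DifferentiableAt ℝ (varComp F x₀ q₀ i) p :=
  ((hF.contDiffOn_varComp x₀ q₀ i).contDiffAt
    ((hF.isOpen_varDomain x₀ q₀).mem_nhds hp)).differentiableAt (by norm_num)

theorem differentiableAt_velComp {x₀ : M} {q₀ : N} {p : Model m × ℝ}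
    (hp : p ∈ varDomain m n F ε x₀ q₀) (i : Fin n) : DifferentiableAt ℝ (velComp F x₀ q₀ i) p :=
  ((hF.contDiffOn_velComp x₀ q₀ i).contDiffAt
    ((hF.isOpen_varDomain x₀ q₀).mem_nhds hp)).differentiableAt (by norm_num)

theorem isParamC1_varPair (x₀ : M) (q₀ : N) :
    IsParamC1 (varDomain m n F ε x₀ q₀) (varPair g h F x₀ q₀) :=
  IsParamC1.tensionPairLoc (g.isLocalHermitian x₀) (h.isLocalHermitian q₀)
    (U := varComp F x₀ q₀) (W := velComp F x₀ q₀) (fun _ hq => hq.1.1)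
    (fun _ hq => hF.toLp_varComp_mem hq) (hF.isParamC1_varComp x₀ q₀)
    (hF.isParamC1_spd_varComp x₀ q₀) (hF.isParamC1_spd_spd_varComp x₀ q₀)
    (hF.isParamC1_velComp x₀ q₀)

theorem energyDensity_eq {x₀ : M} {q₀ : N} {p : Model m × ℝ} (hp : p ∈ varDomain m n F ε x₀ q₀) :
    energyDensity g h (F p.2) ((chartAt (Model m) x₀).symm p.1)
      = energyLoc (g.metricLoc (chartAt (Model m) x₀)) (g.formLoc (chartAt (Model m) x₀))
        (h.metricLoc (chartAt (Model n) q₀)) (h.formLoc (chartAt (Model n) q₀))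
        (fun i y => varComp F x₀ q₀ i (y, p.2)) p.1 :=
  AlmostHermitian.energyDensity_eq_energyLoc g h hp.1.1 (hF.mdifferentiableAt hp.1.2) hp.2

theorem hasDerivAt_energyDensity {x₀ : M} {q₀ : N} {p : Model m × ℝ}
    (hp : p ∈ varDomain m n F ε x₀ q₀) :
    HasDerivAt (fun s => energyDensity g h (F s) ((chartAt (Model m) x₀).symm p.1))
      (varFirst g h F x₀ q₀ (fun _ => 1) p) p.2 := by
  have h1 := hasDerivAt_energyLoc (g.isLocalHermitian x₀) (h.isLocalHermitian q₀)
    (u := fun s i y => varComp F x₀ q₀ i (y, s)) (W := fun i y => velComp F x₀ q₀ i (y, p.2))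
    hp.1.1 (hF.toLp_varComp_mem hp) (hF.hasDerivAt_varComp hp)
    (fun a i => hF.hasDerivAt_spd_varComp hp a i)
  simp only [varFirst, one_mul]
  refine h1.congr_of_eventuallyEq ?_
  have hc : ContinuousAt (fun s : ℝ => ((p.1, s) : Model m × ℝ)) p.2 := by fun_prop
  filter_upwards [hc.preimage_mem_nhds ((hF.isOpen_varDomain x₀ q₀).mem_nhds hp)] with s hs
  exact hF.energyDensity_eq g h hs

/-- The spatial derivatives of a variation whose time depends on the point. -/
theorem pd_varComp_comp {x₀ : M} {q₀ : N} {y : Model m} {τ : Model m → ℝ}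
    (hp : (y, τ y) ∈ varDomain m n F ε x₀ q₀) (hτ : DifferentiableAt ℝ τ y) (a : Fin m)
    (i : Fin n) : pd a (fun y => varComp F x₀ q₀ i (y, τ y)) y
      = spd a (varComp F x₀ q₀ i) (y, τ y) + velComp F x₀ q₀ i (y, τ y) * pd a τ y := by
  have h0 := hF.differentiableAt_varComp hp i
  have h1 : HasFDerivAt (fun y => (y, τ y)) _ y := (hasFDerivAt_id y).prodMk hτ.hasFDerivAt
  have h2 := (HasFDerivAt.comp (g := varComp F x₀ q₀ i) (f := fun y => (y, τ y)) y
    h0.hasFDerivAt h1).fderiv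
  rw [show varComp F x₀ q₀ i ∘ (fun y => (y, τ y)) = fun y => varComp F x₀ q₀ i (y, τ y) from rfl]
    at h2
  have h3 : HasDerivAt (fun s : ℝ => ((y, s) : Model m × ℝ)) (0, 1) (τ y) :=
    (hasDerivAt_const _ y).prodMk (hasDerivAt_id _)
  have h4 : velComp F x₀ q₀ i (y, τ y) = fderiv ℝ (varComp F x₀ q₀ i) (y, τ y) (0, 1) :=
    (hF.hasDerivAt_varComp hp i).unique (h0.hasFDerivAt.comp_hasDerivAt (τ y) h3)
  have h5 : ((stdVec a, fderiv ℝ τ y (stdVec a)) : Model m × ℝ)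
      = (stdVec a, 0) + fderiv ℝ τ y (stdVec a) • (0, 1) := by simp
  rw [pd, h2, spd_eq_fderiv h0, h4, pd]
  change fderiv ℝ (varComp F x₀ q₀ i) (y, τ y) (stdVec a, fderiv ℝ τ y (stdVec a)) = _
  rw [h5, map_add, map_smul, smul_eq_mul, mul_comm]

/-- In charts, `firstVarDensity` is the first variation of the local energy density. -/
theorem hasDerivAt_energyDensity_comp {x₀ : M} {q₀ : N} {p : Model m × ℝ}
    (hp : p ∈ varDomain m n F ε x₀ q₀) {φ : M → ℝ} (hφ : MDifferentiable (𝓡 m) 𝓘(ℝ, ℝ) φ) :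
    HasDerivAt (fun σ => energyDensity g h (fun x => F (p.2 + σ * φ x) x)
        ((chartAt (Model m) x₀).symm p.1))
      (varFirst g h F x₀ q₀ (fun y => φ ((chartAt (Model m) x₀).symm y)) p) 0 := by
  obtain ⟨y, t⟩ := p
  set e := chartAt (Model m) x₀ with he
  have hψ : DifferentiableAt ℝ (fun y => φ (e.symm y)) y := differentiableAt_comp_symm hp.1.1 (hφ _)
  set ψ : Model m → ℝ := fun y => φ (e.symm y) with hψdef
  have hline : HasDerivAt (fun σ : ℝ => t + σ * ψ y) (ψ y) 0 := by
    simpa using ((hasDerivAt_id (0 : ℝ)).mul_const (ψ y)).const_add t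
  have hev : ∀ᶠ σ : ℝ in 𝓝 0, (y, t + σ * ψ y) ∈ varDomain m n F ε x₀ q₀ := by
    have hc : ContinuousAt (fun σ : ℝ => ((y, t + σ * ψ y) : Model m × ℝ)) 0 := by fun_prop
    exact hc.preimage_mem_nhds ((hF.isOpen_varDomain x₀ q₀).mem_nhds (by simpa using hp))
  have hcomp : ∀ {c : ℝ → ℝ} {c' : ℝ}, HasDerivAt c c' t →
      HasDerivAt (fun σ => c (t + σ * ψ y)) (c' * ψ y) 0 := fun {c c'} hc =>
    HasDerivAt.comp (0 : ℝ) (h₂ := c) (by simpa using hc) hline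
  have hpd : ∀ σ : ℝ, (y, t + σ * ψ y) ∈ varDomain m n F ε x₀ q₀ → ∀ (a : Fin m) (i : Fin n),
      pd a (fun y => varComp F x₀ q₀ i (y, t + σ * ψ y)) y
        = spd a (varComp F x₀ q₀ i) (y, t + σ * ψ y)
          + velComp F x₀ q₀ i (y, t + σ * ψ y) * (σ * pd a ψ y) := by
    intro σ hσ a i
    rw [hF.pd_varComp_comp (τ := fun y => t + σ * ψ y) hσ ((hψ.const_mul σ).const_add t) a i]
    congr 2
    have : HasFDerivAt (fun y => t + σ * ψ y) (σ • fderiv ℝ ψ y) y :=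
      (hψ.hasFDerivAt.const_mul σ).const_add t
    rw [pd, this.fderiv]
    rfl
  have h1 := hasDerivAt_energyLoc (g.isLocalHermitian x₀) (h.isLocalHermitian q₀)
    (u := fun σ i y => varComp F x₀ q₀ i (y, t + σ * ψ y))
    (W := fun i y => ψ y * velComp F x₀ q₀ i (y, t)) (t := 0)
    hp.1.1 (by simpa using hF.toLp_varComp_mem hp)
    (fun i => (hcomp (hF.hasDerivAt_varComp hp i)).congr_deriv (mul_comm _ _))
    (fun a i => by
      obtain ⟨_, v', _, hv'⟩ := hF.isParamC1_velComp x₀ q₀ i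
      have hV := hcomp (hv' _ hp)
      have hs := hcomp (hF.hasDerivAt_spd_varComp hp a i)
      have hl : HasDerivAt (fun σ : ℝ => σ * pd a ψ y) (pd a ψ y) 0 := by
        simpa using (hasDerivAt_id (0 : ℝ)).mul_const (pd a ψ y)
      refine ((hs.fun_add (hV.fun_mul hl)).congr_deriv ?_).congr_of_eventuallyEq
        (hev.mono fun σ hσ => hpd σ hσ a i)
      have hv : DifferentiableAt ℝ (fun y => velComp F x₀ q₀ i (y, t)) y :=
        DifferentiableAt.comp (g := velComp F x₀ q₀ i) y (hF.differentiableAt_velComp hp i)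
          (by fun_prop)
      rw [pd_mul hψ hv a]
      simp only [zero_mul, mul_zero, add_zero, zero_add, spd]
      ring)
  simp only [zero_mul, add_zero] at h1
  refine h1.congr_of_eventuallyEq (hev.mono fun σ hσ => ?_)
  refine AlmostHermitian.energyDensity_eq_energyLoc g h hp.1.1 ?_ hσ.2
  exact hF.mdifferentiableAt_comp (τ := fun x => t + σ * φ x) hσ.1.2
    (mdifferentiableAt_const.add (mdifferentiableAt_const.mul (hφ _)))

theorem firstVarDensity_eq {x₀ : M} {q₀ : N} {p : Model m × ℝ}
    (hp : p ∈ varDomain m n F ε x₀ q₀) {φ : M → ℝ} (hφ : MDifferentiable (𝓡 m) 𝓘(ℝ, ℝ) φ) :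
    firstVarDensity g h F p.2 φ ((chartAt (Model m) x₀).symm p.1)
      = varFirst g h F x₀ q₀ (fun y => φ ((chartAt (Model m) x₀).symm y)) p :=
  (hF.hasDerivAt_energyDensity_comp g h hp hφ).deriv

theorem continuousOn_varFirst (x₀ : M) (q₀ : N) {φ : Model m → ℝ}
    (hφ : ContDiffOn ℝ 1 φ (chartAt (Model m) x₀).target) :
    ContinuousOn (varFirst g h F x₀ q₀ φ) (varDomain m n F ε x₀ q₀) := by
  have hg := g.isLocalHermitian x₀
  have hh := h.isLocalHermitian q₀
  have hu : ContinuousOn (fun q => (WithLp.toLp 2 fun i => varComp F x₀ q₀ i q : Model n))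
      (varDomain m n F ε x₀ q₀) := (PiLp.continuous_toLp 2 _).comp_continuousOn
    (continuousOn_pi.2 fun i => (hF.contDiffOn_varComp x₀ q₀ i).continuousOn)
  have hfst' : ∀ {c : Model m → ℝ}, ContinuousOn c (chartAt (Model m) x₀).target →
      ContinuousOn (fun q : Model m × ℝ => c q.1) (varDomain m n F ε x₀ q₀) := fun hc =>
    hc.comp continuousOn_fst fun _ hq => hq.1.1
  have hfst : ∀ {c : Model m → ℝ}, ContDiffOn ℝ ∞ c (chartAt (Model m) x₀).target →
      ContinuousOn (fun q : Model m × ℝ => c q.1) (varDomain m n F ε x₀ q₀) := fun hc =>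
    hfst' hc.continuousOn
  have hsnd : ∀ {c : Model n → ℝ}, ContinuousOn c (chartAt (Model n) q₀).target →
      ContinuousOn (fun q : Model m × ℝ => c (WithLp.toLp 2 fun i => varComp F x₀ q₀ i q))
        (varDomain m n F ε x₀ q₀) := fun hc => hc.comp hu fun _ hq => hF.toLp_varComp_mem hq
  have hpd : ∀ {c : Model n → ℝ}, ContDiffOn ℝ ∞ c (chartAt (Model n) q₀).target → ∀ p,
      ContinuousOn (pd p c) (chartAt (Model n) q₀).target := fun hc p =>
    (contDiffOn_pd hh.isOpen hc (l := ∞) (by simp) p).continuousOn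
  have hk : ∀ a b i j, ContinuousOn (fun q : Model m × ℝ => energyCoeff
      (g.metricLoc (chartAt (Model m) x₀)) (g.formLoc (chartAt (Model m) x₀))
      (h.metricLoc (chartAt (Model n) q₀)) (h.formLoc (chartAt (Model n) q₀)) a b i j q.1
      (WithLp.toLp 2 fun i => varComp F x₀ q₀ i q)) (varDomain m n F ε x₀ q₀) := fun a b i j =>
    ((hfst (hg.contDiffOn_inv a b)).mul (hsnd (hh.contDiffOn_metric i j).continuousOn)).sub
      ((hfst (hg.contDiffOn_raise a b)).mul (hsnd (hh.contDiffOn_form i j).continuousOn))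
  have hkp : ∀ a b i j p, ContinuousOn (fun q : Model m × ℝ => pd p (energyCoeff
      (g.metricLoc (chartAt (Model m) x₀)) (g.formLoc (chartAt (Model m) x₀))
      (h.metricLoc (chartAt (Model n) q₀)) (h.formLoc (chartAt (Model n) q₀)) a b i j q.1)
      (WithLp.toLp 2 fun i => varComp F x₀ q₀ i q)) (varDomain m n F ε x₀ q₀) := fun a b i j p =>
    (((hfst (hg.contDiffOn_inv a b)).mul (hsnd (hpd (hh.contDiffOn_metric i j) p))).sub
      ((hfst (hg.contDiffOn_raise a b)).mul (hsnd (hpd (hh.contDiffOn_form i j) p)))).congr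
      fun q hq => pd_energyCoeff hh (hF.toLp_varComp_mem hq) a b i j p
  have hU := fun a i => (hF.isParamC1_spd_varComp x₀ q₀ a i).1
  have hV := fun i => (hfst' hφ.continuousOn).mul (hF.contDiffOn_velComp x₀ q₀ i).continuousOn
  have hV' : ∀ (a : Fin m) (i : Fin n), ContinuousOn (fun q : Model m × ℝ =>
      pd a (fun y => φ y * velComp F x₀ q₀ i (y, q.2)) q.1) (varDomain m n F ε x₀ q₀) := by
    intro a i
    refine (((hfst' (contDiffOn_pd hg.isOpen hφ (l := 0) (by norm_num) a).continuousOn).mul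
      (hF.contDiffOn_velComp x₀ q₀ i).continuousOn).add ((hfst' hφ.continuousOn).mul
      (contDiffOn_spd (hF.isOpen_varDomain x₀ q₀) (hF.contDiffOn_velComp x₀ q₀ i) (l := 1)
      (by norm_num) a).continuousOn)).congr fun q hq => ?_
    have hv : DifferentiableAt ℝ (fun y => velComp F x₀ q₀ i (y, q.2)) q.1 :=
      DifferentiableAt.comp (g := velComp F x₀ q₀ i) q.1 (hF.differentiableAt_velComp hq i)
        (by fun_prop)
    exact pd_mul (((hφ _ hq.1.1).contDiffAt (hg.isOpen.mem_nhds hq.1.1)).differentiableAt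
      (by norm_num)) hv a
  unfold varFirst firstVarLoc
  refine ContinuousOn.add ?_ (ContinuousOn.mul continuousOn_const ?_)
  · exact continuousOn_finsetSum _ fun a _ => continuousOn_finsetSum _ fun b _ =>
      continuousOn_finsetSum _ fun i _ => continuousOn_finsetSum _ fun j _ =>
        ((hk a b i j).mul (hV' a i)).mul (hU b j)
  · exact continuousOn_finsetSum _ fun a _ => continuousOn_finsetSum _ fun b _ =>
      continuousOn_finsetSum _ fun i _ => continuousOn_finsetSum _ fun j _ =>
        ((continuousOn_finsetSum _ fun p _ => (hkp a b i j p).mul (hV p)).mul (hU a i)).mul (hU b j)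

theorem continuousOn_energyDensity (x₀ : M) (q₀ : N) : ContinuousOn
    (fun p : Model m × ℝ => energyDensity g h (F p.2) ((chartAt (Model m) x₀).symm p.1))
    (varDomain m n F ε x₀ q₀) := by
  have hg := g.isLocalHermitian x₀
  have hh := h.isLocalHermitian q₀
  have hu : ContinuousOn (fun q => (WithLp.toLp 2 fun i => varComp F x₀ q₀ i q : Model n))
      (varDomain m n F ε x₀ q₀) := (PiLp.continuous_toLp 2 _).comp_continuousOn
    (continuousOn_pi.2 fun i => (hF.contDiffOn_varComp x₀ q₀ i).continuousOn)
  have hfst : ∀ {c : Model m → ℝ}, ContDiffOn ℝ ∞ c (chartAt (Model m) x₀).target →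
      ContinuousOn (fun q : Model m × ℝ => c q.1) (varDomain m n F ε x₀ q₀) := fun hc =>
    hc.continuousOn.comp continuousOn_fst fun _ hq => hq.1.1
  have hsnd : ∀ {c : Model n → ℝ}, ContDiffOn ℝ ∞ c (chartAt (Model n) q₀).target →
      ContinuousOn (fun q : Model m × ℝ => c (WithLp.toLp 2 fun i => varComp F x₀ q₀ i q))
        (varDomain m n F ε x₀ q₀) := fun hc =>
    hc.continuousOn.comp hu fun _ hq => hF.toLp_varComp_mem hq
  refine ContinuousOn.congr ?_ fun q hq => hF.energyDensity_eq g h hq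
  unfold energyLoc
  exact continuousOn_const.mul <| continuousOn_finsetSum _ fun a _ =>
    continuousOn_finsetSum _ fun b _ => continuousOn_finsetSum _ fun i _ =>
      continuousOn_finsetSum _ fun j _ =>
        ((((hfst (hg.contDiffOn_inv a b)).mul (hsnd (hh.contDiffOn_metric i j))).sub
          ((hfst (hg.contDiffOn_raise a b)).mul (hsnd (hh.contDiffOn_form i j)))).mul
          (hF.isParamC1_spd_varComp x₀ q₀ a i).1).mul (hF.isParamC1_spd_varComp x₀ q₀ b j).1

end IsCompactVariation

theorem firstVarDensity_eq_zero {F : ℝ → M → N} {t : ℝ} {φ : M → ℝ} {x : M} (hx : x ∉ tsupport φ) :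
    firstVarDensity g h F t φ x = 0 := by
  have : ∀ σ : ℝ, energyDensity g h (fun x => F (t + σ * φ x) x) x = energyDensity g h (F t) x := by
    intro σ
    refine energyDensity_congr g h ?_
    filter_upwards [(isClosed_tsupport φ).isOpen_compl.mem_nhds hx] with z hz
    rw [image_eq_zero_of_notMem_tsupport hz, mul_zero, add_zero]
  simp only [firstVarDensity, this, deriv_const]

end FirstVariation

/-! ### The Riemannian volume in a chart -/

section Volume

set_option linter.unusedSectionVars false

variable {m : ℕ} {M : Type*} [TopologicalSpace M] [ChartedSpace (Model m) M]
  [IsManifold (𝓡 m) ∞ M] (g : AlmostHermitian m M)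

namespace AlmostHermitian

/-- The density `√(det g)` is multiplied by the Jacobian determinant under a change of charts. -/
theorem sqrt_det_metricLoc (x x' : M) {y : Model m} (hy : y ∈ (chartAt (Model m) x).target)
    (hy' : (chartAt (Model m) x).symm y ∈ (chartAt (Model m) x').source) :
    √(g.metricLoc (chartAt (Model m) x) y).det
      = |(fderiv ℝ (fun y => chartAt (Model m) x' ((chartAt (Model m) x).symm y)) y).det|
        * √(g.metricLoc (chartAt (Model m) x')
          (chartAt (Model m) x' ((chartAt (Model m) x).symm y))).det := by
  set z := (chartAt (Model m) x).symm y with hz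
  set D := fderiv ℝ (fun y => chartAt (Model m) x' ((chartAt (Model m) x).symm y)) y with hD
  set P : Matrix (Fin m) (Fin m) ℝ := Matrix.of fun i a =>
    components x' z (coordVec (chartAt (Model m) x) y a) i with hP
  have hdiff : DifferentiableAt ℝ
      (fun y => chartAt (Model m) x' ((chartAt (Model m) x).symm y)) y :=
    mdifferentiableAt_iff_differentiableAt.1
      (MDifferentiableAt.comp (I' := 𝓡 m) y ((mdifferentiable_chart x').mdifferentiableAt hy')
        ((mdifferentiable_chart x).mdifferentiableAt_symm hy))
  have hPpd : ∀ i a, P i a = D (stdVec a) i := by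
    intro i a
    have h1 := components_mfderiv_coordVec (f := (id : M → M)) hy mdifferentiableAt_id hy' a i
    rw [mfderiv_id] at h1
    refine Eq.trans h1 ?_
    have h2 := ((EuclideanSpace.proj (𝕜 := ℝ) (ι := Fin m) i).hasFDerivAt.comp y
      hdiff.hasFDerivAt).fderiv
    exact DFunLike.congr_fun h2 (stdVec a)
  have hdet : D.det = P.det := by
    have h1 : LinearMap.toMatrix (EuclideanSpace.basisFun (Fin m) ℝ).toBasis
        (EuclideanSpace.basisFun (Fin m) ℝ).toBasis (D : Model m →ₗ[ℝ] Model m) = P := by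
      ext i a
      rw [LinearMap.toMatrix_apply, hPpd]
      simp [stdVec]
    rw [← h1, LinearMap.det_toMatrix]
  have hG : g.metricLoc (chartAt (Model m) x) y
      = P.transpose * g.metricLoc (chartAt (Model m) x') (chartAt (Model m) x' z) * P := by
    ext a b
    have h1 : g.metricLoc (chartAt (Model m) x) y a b = _ := g.inner_eq_sum x' hy'
      (coordVec (chartAt (Model m) x) y a) (coordVec (chartAt (Model m) x) y b)
    rw [h1]
    simp only [Matrix.mul_apply, Finset.sum_mul, Matrix.transpose_apply, hP, Matrix.of_apply]
    rw [Finset.sum_comm]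
    exact Finset.sum_congr rfl fun _ _ => Finset.sum_congr rfl fun _ _ => by ring
  rw [hG, Matrix.det_mul, Matrix.det_mul, Matrix.det_transpose, hdet,
    show P.det * (g.metricLoc (chartAt (Model m) x') (chartAt (Model m) x' z)).det * P.det
      = P.det ^ 2 * (g.metricLoc (chartAt (Model m) x') (chartAt (Model m) x' z)).det by ring,
    Real.sqrt_mul (sq_nonneg _), Real.sqrt_sq_eq_abs]

variable [MeasurableSpace M] [BorelSpace M]

theorem measurableSet_symm_preimage (x : M) {A : Set M} (hA : MeasurableSet A) :
    MeasurableSet ((chartAt (Model m) x).symm ⁻¹' A ∩ (chartAt (Model m) x).target) := by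
  classical
  have h1 : Measurable ((chartAt (Model m) x).target.piecewise (chartAt (Model m) x).symm
      fun _ => x) := (chartAt (Model m) x).continuousOn_symm.measurable_piecewise
    continuousOn_const (chartAt (Model m) x).open_target.measurableSet
  convert (h1 hA).inter (chartAt (Model m) x).open_target.measurableSet using 1
  ext y
  simp only [mem_inter_iff, mem_preimage]
  refine and_congr_left fun hy => ?_
  rw [Set.piecewise_eq_of_mem _ _ _ hy]

theorem aemeasurable_symm (x : M) : AEMeasurable (chartAt (Model m) x).symm
    (((volume : Measure (Model m)).restrict (chartAt (Model m) x).target).withDensity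
    fun y => ENNReal.ofReal (√(g.metricLoc (chartAt (Model m) x) y).det)) :=
  ((chartAt (Model m) x).continuousOn_symm.aemeasurable
    (chartAt (Model m) x).open_target.measurableSet).mono_ac (withDensity_absolutelyContinuous _ _)

theorem chartVolume_apply (x : M) {A : Set M} (hA : MeasurableSet A) :
    g.chartVolume (chartAt (Model m) x) A
      = ∫⁻ y in (chartAt (Model m) x).symm ⁻¹' A ∩ (chartAt (Model m) x).target,
        ENNReal.ofReal (√(g.metricLoc (chartAt (Model m) x) y).det) := by
  rw [chartVolume, Measure.map_apply_of_aemeasurable (g.aemeasurable_symm x) hA, withDensity_apply',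
    Measure.restrict_restrict' (chartAt (Model m) x).open_target.measurableSet]

theorem chartVolume_inter_source (x : M) {A : Set M} (hA : MeasurableSet A) :
    g.chartVolume (chartAt (Model m) x) (A ∩ (chartAt (Model m) x).source)
      = g.chartVolume (chartAt (Model m) x) A := by
  rw [g.chartVolume_apply x hA,
    g.chartVolume_apply x (hA.inter (chartAt (Model m) x).open_source.measurableSet)]
  congr 2
  ext y
  simp only [mem_inter_iff, mem_preimage]
  exact and_congr_left fun hy => and_iff_left ((chartAt (Model m) x).map_target hy)

/-- The chart volumes agree on overlaps. -/
theorem chartVolume_eq_of_subset (x x' : M) {A : Set M} (hA : MeasurableSet A)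
    (hx : A ⊆ (chartAt (Model m) x).source) (hx' : A ⊆ (chartAt (Model m) x').source) :
    g.chartVolume (chartAt (Model m) x) A = g.chartVolume (chartAt (Model m) x') A := by
  rw [g.chartVolume_apply x hA, g.chartVolume_apply x' hA]
  set T := (chartAt (Model m) x).symm ⁻¹' A ∩ (chartAt (Model m) x).target with hT
  set ψ : Model m → Model m := fun y => chartAt (Model m) x' ((chartAt (Model m) x).symm y) with hψ
  have himg : (chartAt (Model m) x').symm ⁻¹' A ∩ (chartAt (Model m) x').target = ψ '' T := by
    ext z
    constructor
    · rintro ⟨hz, hz'⟩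
      refine ⟨chartAt (Model m) x ((chartAt (Model m) x').symm z), ⟨?_, ?_⟩, ?_⟩
      · rw [mem_preimage, (chartAt (Model m) x).left_inv (hx hz)]; exact hz
      · exact (chartAt (Model m) x).map_source (hx hz)
      · rw [hψ]
        dsimp only
        rw [(chartAt (Model m) x).left_inv (hx hz), (chartAt (Model m) x').right_inv hz']
    · rintro ⟨y, ⟨hy, hy'⟩, rfl⟩
      refine ⟨?_, (chartAt (Model m) x').map_source (hx' hy)⟩
      rw [mem_preimage, hψ]
      dsimp only
      rw [(chartAt (Model m) x').left_inv (hx' hy)]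
      exact hy
  have hinj : InjOn ψ T := by
    rintro y ⟨hy, hyt⟩ z ⟨hz, hzt⟩ hyz
    have h1 := (chartAt (Model m) x').injOn (hx' hy) (hx' hz) hyz
    exact (chartAt (Model m) x).symm.injOn hyt hzt h1
  have hder : ∀ y ∈ T, HasFDerivWithinAt ψ (fderiv ℝ ψ y) T y := fun y hy =>
    (mdifferentiableAt_iff_differentiableAt.1
      (MDifferentiableAt.comp (I' := 𝓡 m) y
        ((mdifferentiable_chart x').mdifferentiableAt (hx' hy.1))
        ((mdifferentiable_chart x).mdifferentiableAt_symm hy.2))).hasFDerivAt.hasFDerivWithinAt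
  rw [himg, lintegral_image_eq_lintegral_abs_det_fderiv_mul volume
    (measurableSet_symm_preimage x hA) hder hinj]
  refine setLIntegral_congr_fun (measurableSet_symm_preimage x hA) fun y hy => ?_
  rw [g.sqrt_det_metricLoc x x' hy.2 (hx' hy.1), ENNReal.ofReal_mul (abs_nonneg _)]

/-- A supremum of measures is not computed setwise, but as the chart volumes agree on overlaps, all
of them are bounded by a measure that agrees with the one of the given chart on its domain. -/
theorem vol_apply_of_subset_source (x : M) {A : Set M} (hA : MeasurableSet A)
    (hx : A ⊆ (chartAt (Model m) x).source) : g.vol A = g.chartVolume (chartAt (Model m) x) A := by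
  refine le_antisymm ?_ (le_iSup (fun x => g.chartVolume (chartAt (Model m) x)) x A)
  have hS : MeasurableSet (chartAt (Model m) x).source :=
    (chartAt (Model m) x).open_source.measurableSet
  -- an upper bound of all chart volumes that is infinite off the domain of the chart at `x`
  have key : g.vol ≤ g.chartVolume (chartAt (Model m) x)
      + (⊤ : Measure M).restrict (chartAt (Model m) x).sourceᶜ := by
    refine iSup_le fun x' => Measure.le_iff.2 fun B hB => ?_
    rw [Measure.add_apply, ← measure_inter_add_sdiff B hS]
    refine add_le_add ?_ ?_
    · rw [← g.chartVolume_inter_source x' (hB.inter hS), ← g.chartVolume_eq_of_subset x x'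
        ((hB.inter hS).inter (chartAt (Model m) x').open_source.measurableSet)
        (fun z hz => hz.1.2) (fun z hz => hz.2)]
      exact measure_mono fun z hz => hz.1.1
    · rw [Measure.restrict_apply hB]
      exact (le_top : g.chartVolume (chartAt (Model m) x') ≤ ⊤) _
  refine (key A).trans ?_
  rw [Measure.add_apply, Measure.restrict_apply hA,
    (disjoint_compl_right_iff_subset.2 hx).inter_eq, measure_empty, add_zero]

/-- On the domain of a chart the volume measure has the density `√(det g)` in that chart. -/
theorem vol_restrict_source (x : M) :
    g.vol.restrict (chartAt (Model m) x).source = g.chartVolume (chartAt (Model m) x) := by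
  ext A hA
  rw [Measure.restrict_apply hA, g.vol_apply_of_subset_source x
    (hA.inter (chartAt (Model m) x).open_source.measurableSet) inter_subset_right,
    g.chartVolume_inter_source x hA]

instance isLocallyFiniteMeasure_vol : IsLocallyFiniteMeasure g.vol where
  finiteAtNhds x := by
    set e := chartAt (Model m) x with he
    obtain ⟨r, hr, hball⟩ := Metric.nhds_basis_closedBall.mem_iff.1
      (e.open_target.mem_nhds (mem_chart_target (Model m) x))
    refine ⟨e.source ∩ e ⁻¹' Metric.ball (e x) r,
      (e.isOpen_inter_preimage Metric.isOpen_ball).mem_nhds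
        ⟨mem_chart_source _ x, Metric.mem_ball_self hr⟩, ?_⟩
    have hA : MeasurableSet (e.source ∩ e ⁻¹' Metric.ball (e x) r) :=
      (e.isOpen_inter_preimage Metric.isOpen_ball).measurableSet
    rw [g.vol_apply_of_subset_source x hA inter_subset_left, g.chartVolume_apply x hA]
    refine lt_of_le_of_lt (lintegral_mono_set (t := Metric.closedBall (e x) r) ?_) ?_
    · rintro y ⟨⟨_, hy⟩, hyt⟩
      rw [mem_preimage, e.right_inv hyt] at hy
      exact Metric.ball_subset_closedBall hy
    · refine Integrable.lintegral_lt_top ?_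
      exact ((g.isLocalHermitian x).contDiffOn_sqrt_det.continuousOn.mono
        hball).integrableOn_compact (isCompact_closedBall _ _)

/-- Integration over `M` of a function supported in the domain of a chart. -/
theorem integral_vol_eq (x : M) {f : M → ℝ}
    (hf : ContinuousOn f (chartAt (Model m) x).source)
    (hs : ∀ z ∉ (chartAt (Model m) x).source, f z = 0) :
    ∫ z, f z ∂g.vol = ∫ y in (chartAt (Model m) x).target,
      √(g.metricLoc (chartAt (Model m) x) y).det * f ((chartAt (Model m) x).symm y) := by
  have hS : MeasurableSet (chartAt (Model m) x).source :=
    (chartAt (Model m) x).open_source.measurableSet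
  have hfm : AEStronglyMeasurable f (g.chartVolume (chartAt (Model m) x)) := by
    rw [← g.vol_restrict_source x]
    exact hf.aemeasurable hS |>.aestronglyMeasurable
  have hm : AEMeasurable (fun y => ENNReal.ofReal (√(g.metricLoc (chartAt (Model m) x) y).det))
      ((volume : Measure (Model m)).restrict (chartAt (Model m) x).target) :=
    ((g.isLocalHermitian x).contDiffOn_sqrt_det.continuousOn.aemeasurable
      (chartAt (Model m) x).open_target.measurableSet).ennreal_ofReal
  rw [← setIntegral_eq_integral_of_forall_compl_eq_zero hs, g.vol_restrict_source x, chartVolume,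
    integral_map (g.aemeasurable_symm x) hfm,
    integral_withDensity_eq_integral_toReal_smul₀ hm (.of_forall fun _ => ENNReal.ofReal_lt_top)]
  simp only [ENNReal.toReal_ofReal (Real.sqrt_nonneg _), smul_eq_mul]

end AlmostHermitian

end Volume

/-! ### The first variation formula in a chart -/

theorem IsParamC1.comp_prodMap {X Y : Type*} [TopologicalSpace X] [TopologicalSpace Y]
    {D : Set (X × ℝ)} {D' : Set (Y × ℝ)} {f : X × ℝ → ℝ} (hf : IsParamC1 D f) {e : Y → X}
    (he : ContinuousOn (fun p : Y × ℝ => (e p.1, p.2)) D') (hD : ∀ p ∈ D', (e p.1, p.2) ∈ D) :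
    IsParamC1 D' fun p => f (e p.1, p.2) := by
  obtain ⟨c, f', c', d⟩ := hf
  exact ⟨c.comp he hD, fun p => f' (e p.1, p.2), c'.comp he hD, fun p hp => d _ (hD p hp)⟩

theorem continuous_of_eq_zero_off {X : Type*} [TopologicalSpace X] {f : X → ℝ} {s C : Set X}
    (hs : IsOpen s) (hC : IsClosed C) (hCs : C ⊆ s) (hf : ContinuousOn f s)
    (h0 : ∀ x ∉ C, f x = 0) : Continuous f := by
  rw [continuous_iff_continuousAt]
  intro x
  by_cases hx : x ∈ s
  · exact hf.continuousAt (hs.mem_nhds hx)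
  · have : f =ᶠ[𝓝 x] fun _ => 0 := by
      filter_upwards [hC.isOpen_compl.mem_nhds fun h => hx (hCs h)] with z hz using h0 z hz
    exact continuousAt_const.congr this.symm

section VariationNhd

set_option linter.unusedSectionVars false

variable {m n : ℕ}
  {M : Type*} [TopologicalSpace M] [ChartedSpace (Model m) M] [IsManifold (𝓡 m) ∞ M]
  {N : Type*} [TopologicalSpace N] [ChartedSpace (Model n) N] [IsManifold (𝓡 n) ∞ N]
  (g : AlmostHermitian m M) (h : AlmostHermitian n N)

/-- The set of `(x, t)` such that `x` lies in the chart at `x₀` and `F t x` in the chart at `q₀`. -/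
def varNhd (m n : ℕ) {M : Type*} [TopologicalSpace M] [ChartedSpace (Model m) M]
    {N : Type*} [TopologicalSpace N] [ChartedSpace (Model n) N]
    (F : ℝ → M → N) (ε : ℝ) (x₀ : M) (q₀ : N) : Set (M × ℝ) :=
  ((chartAt (Model m) x₀).source ×ˢ Ioo (-ε) ε) ∩
    (fun p => F p.2 p.1) ⁻¹' (chartAt (Model n) q₀).source

/-- The function `⟨τ₊(F t), ∂ₜF⟩` on the domain of the charts at `x₀` and `q₀`. -/
def pairAt (F : ℝ → M → N) (x₀ : M) (q₀ : N) (p : M × ℝ) : ℝ :=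
  varPair g h F x₀ q₀ (chartAt (Model m) x₀ p.1, p.2)

theorem contDiffOn_comp_symm {φ : M → ℝ} (hφ : ContMDiff (𝓡 m) 𝓘(ℝ, ℝ) 1 φ) (x₀ : M) :
    ContDiffOn ℝ 1 (fun y => φ ((chartAt (Model m) x₀).symm y)) (chartAt (Model m) x₀).target := by
  rw [← contMDiffOn_iff_contDiffOn]
  exact hφ.comp_contMDiffOn (contMDiffOn_chart_symm (n := 1))

namespace IsCompactVariation

variable {F : ℝ → M → N} {K : Set M} {ε : ℝ} (hF : IsCompactVariation m n F K ε)
include hF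

theorem isOpen_varNhd (x₀ : M) (q₀ : N) : IsOpen (varNhd m n F ε x₀ q₀) :=
  (hF.contMDiffOn.continuousOn.mono (prod_mono (subset_univ _) Subset.rfl)).isOpen_inter_preimage
    ((chartAt (Model m) x₀).open_source.prod isOpen_Ioo) (chartAt (Model n) q₀).open_source

theorem mem_varNhd_self {x : M} {t : ℝ} (ht : t ∈ Ioo (-ε) ε) :
    (x, t) ∈ varNhd m n F ε x (F t x) :=
  ⟨⟨mem_chart_source _ x, ht⟩, mem_chart_source _ (F t x)⟩

theorem mem_varDomain {x₀ : M} {q₀ : N} {p : M × ℝ} (hp : p ∈ varNhd m n F ε x₀ q₀) :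
    (chartAt (Model m) x₀ p.1, p.2) ∈ varDomain m n F ε x₀ q₀ := by
  refine ⟨⟨(chartAt (Model m) x₀).map_source hp.1.1, hp.1.2⟩, ?_⟩
  rw [mem_preimage]
  dsimp only
  rw [(chartAt (Model m) x₀).left_inv hp.1.1]
  exact hp.2

theorem continuousOn_prodMap (x₀ : M) (q₀ : N) :
    ContinuousOn (fun p : M × ℝ => (chartAt (Model m) x₀ p.1, p.2)) (varNhd m n F ε x₀ q₀) :=
  ((chartAt (Model m) x₀).continuousOn.comp continuousOn_fst fun _ hp => hp.1.1).prodMk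
    continuousOn_snd

theorem isParamC1_pairAt (x₀ : M) (q₀ : N) :
    IsParamC1 (varNhd m n F ε x₀ q₀) (pairAt g h F x₀ q₀) :=
  (hF.isParamC1_varPair g h x₀ q₀).comp_prodMap (hF.continuousOn_prodMap x₀ q₀)
    fun _ hp => hF.mem_varDomain hp

theorem continuousOn_energyDensity_univ :
    ContinuousOn (fun p : M × ℝ => energyDensity g h (F p.2) p.1) (univ ×ˢ Ioo (-ε) ε) := by
  rintro ⟨x, t⟩ ⟨-, ht⟩
  refine ContinuousAt.continuousWithinAt ?_
  have h1 := (hF.continuousOn_energyDensity g h x (F t x)).comp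
    (hF.continuousOn_prodMap x (F t x)) fun _ hp => hF.mem_varDomain hp
  refine ((h1.congr fun p hp => ?_).continuousAt
    ((hF.isOpen_varNhd x (F t x)).mem_nhds (hF.mem_varNhd_self ht)))
  simp only [Function.comp_apply]
  rw [(chartAt (Model m) x).left_inv hp.1.1]

theorem hasDerivAt_energyDensity_of_mem {x₀ : M} {q₀ : N} {p : M × ℝ}
    (hp : p ∈ varNhd m n F ε x₀ q₀) : HasDerivAt (fun s => energyDensity g h (F s) p.1)
      (varFirst g h F x₀ q₀ (fun _ => 1) (chartAt (Model m) x₀ p.1, p.2)) p.2 := by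
  have h1 := hF.hasDerivAt_energyDensity g h (hF.mem_varDomain hp)
  rwa [(chartAt (Model m) x₀).left_inv hp.1.1] at h1

theorem hasDerivAt_energyDensity_deriv {x : M} {t : ℝ} (ht : t ∈ Ioo (-ε) ε) :
    HasDerivAt (fun s => energyDensity g h (F s) x)
      (deriv (fun s => energyDensity g h (F s) x) t) t :=
  (hF.hasDerivAt_energyDensity_of_mem g h
    (hF.mem_varNhd_self (x := x) ht)).differentiableAt.hasDerivAt

theorem continuousOn_deriv_energyDensity :
    ContinuousOn (fun p : M × ℝ => deriv (fun s => energyDensity g h (F s) p.1) p.2)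
      (univ ×ˢ Ioo (-ε) ε) := by
  rintro ⟨x, t⟩ ⟨-, ht⟩
  refine ContinuousAt.continuousWithinAt ?_
  have h1 := (hF.continuousOn_varFirst g h x (F t x) (φ := fun _ => 1) contDiffOn_const).comp
    (hF.continuousOn_prodMap x (F t x)) fun _ hp => hF.mem_varDomain hp
  exact ((h1.congr fun p hp => (hF.hasDerivAt_energyDensity_of_mem g h hp).deriv).continuousAt
    ((hF.isOpen_varNhd x (F t x)).mem_nhds (hF.mem_varNhd_self ht)))

theorem energyDensity_eq_of_notMem [T2Space M] {x : M} (hx : x ∉ K) {t : ℝ}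
    (ht : t ∈ Ioo (-ε) ε) : energyDensity g h (F t) x = energyDensity g h (F 0) x := by
  refine energyDensity_congr g h ?_
  filter_upwards [hF.isCompact.isClosed.isOpen_compl.mem_nhds hx] with z hz
  exact hF.stationary t ht z hz

theorem velocity_eq_zero {x : M} (hx : x ∉ K) {t : ℝ} (ht : t ∈ Ioo (-ε) ε) :
    (velocity F t x : TangentSpace (𝓡 n) (F t x)) = 0 := by
  have h1 : (fun s => F s x) =ᶠ[𝓝 t] fun _ => F 0 x := by
    filter_upwards [isOpen_Ioo.mem_nhds ht] with s hs using hF.stationary s hs x hx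
  have h2 : mfderiv 𝓘(ℝ, ℝ) (𝓡 n) (fun s => F s x) t
      = (mfderiv 𝓘(ℝ, ℝ) (𝓡 n) (fun _ => F 0 x) t : ℝ →L[ℝ] Model n) := h1.mfderiv_eq
  rw [mfderiv_const] at h2
  exact DFunLike.congr_fun h2 (1 : ℝ)

theorem firstVarDensity_eq_of_mem {x₀ : M} {q₀ : N} {p : M × ℝ} {φ : M → ℝ}
    (hφ : ContMDiff (𝓡 m) 𝓘(ℝ, ℝ) 1 φ) (hp : p ∈ varNhd m n F ε x₀ q₀) :
    firstVarDensity g h F p.2 φ p.1 = varFirst g h F x₀ q₀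
      (fun y => φ ((chartAt (Model m) x₀).symm y)) (chartAt (Model m) x₀ p.1, p.2) := by
  have h2 := hF.firstVarDensity_eq g h (hF.mem_varDomain hp) (hφ.mdifferentiable (by norm_num))
  rw [(chartAt (Model m) x₀).left_inv hp.1.1] at h2
  exact h2

theorem continuous_firstVarDensity {x₀ : M} {q₀ : N} {t : ℝ} {φ : M → ℝ}
    (hφ : ContMDiff (𝓡 m) 𝓘(ℝ, ℝ) 1 φ)
    (hsub : ∀ x ∈ tsupport φ, (x, t) ∈ varNhd m n F ε x₀ q₀) :
    Continuous (firstVarDensity g h F t φ) := by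
  refine continuous_of_eq_zero_off (s := {x | (x, t) ∈ varNhd m n F ε x₀ q₀})
    ((hF.isOpen_varNhd x₀ q₀).preimage (by fun_prop)) (isClosed_tsupport φ) hsub ?_
    fun x hx => firstVarDensity_eq_zero g h hx
  have h1 := (hF.continuousOn_varFirst g h x₀ q₀ (contDiffOn_comp_symm hφ x₀)).comp
    (hF.continuousOn_prodMap x₀ q₀) fun _ hp => hF.mem_varDomain hp
  refine (h1.comp (f := fun x : M => ((x, t) : M × ℝ))
    (s := {x | (x, t) ∈ varNhd m n F ε x₀ q₀}) (by fun_prop) fun x hx => hx).congr fun x hx => ?_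
  exact hF.firstVarDensity_eq_of_mem g h (p := (x, t)) hφ hx

/-- Integration by parts for the first variation in a direction supported in a chart. -/
theorem integral_firstVarDensity [T2Space M] [MeasurableSpace M] [BorelSpace M] {x₀ : M} {q₀ : N}
    {t : ℝ} {φ : M → ℝ} (hφ : ContMDiff (𝓡 m) 𝓘(ℝ, ℝ) 1 φ) (hc : HasCompactSupport φ)
    (hsub : ∀ x ∈ tsupport φ, (x, t) ∈ varNhd m n F ε x₀ q₀) :
    ∫ x, firstVarDensity g h F t φ x ∂g.vol
      = -∫ x, φ x * pairAt g h F x₀ q₀ (x, t) ∂g.vol := by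
  set e := chartAt (Model m) x₀ with he
  have hφd : MDifferentiable (𝓡 m) 𝓘(ℝ, ℝ) φ := hφ.mdifferentiable (by norm_num)
  set s : Set (Model m) := {y | (y, t) ∈ varDomain m n F ε x₀ q₀} with hs
  have hso : IsOpen s := (hF.isOpen_varDomain x₀ q₀).preimage (by fun_prop)
  have hse : s ⊆ e.target := fun y hy => hy.1.1
  set S : Set M := {x | (x, t) ∈ varNhd m n F ε x₀ q₀} with hS
  have hSo : IsOpen S := (hF.isOpen_varNhd x₀ q₀).preimage (by fun_prop)
  have hSe : S ⊆ e.source := fun x hx => hx.1.1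
  have hφe : ContDiffOn ℝ 1 (fun y => φ (e.symm y)) e.target := contDiffOn_comp_symm hφ x₀
  -- the function `φ` in the chart, extended by zero
  set ψ : Model m → ℝ := e.target.indicator fun y => φ (e.symm y) with hψ
  have hψe : ∀ y ∈ e.target, ψ y = φ (e.symm y) := fun y hy => indicator_of_mem hy _
  have hψs : ∀ y ∉ e '' tsupport φ, ψ y = 0 := by
    intro y hy
    by_cases hyt : y ∈ e.target
    · rw [hψe y hyt]
      refine image_eq_zero_of_notMem_tsupport fun hmem => hy ⟨_, hmem, e.right_inv hyt⟩
    · exact indicator_of_notMem hyt _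
  have hcomp : IsCompact (e '' tsupport φ) :=
    hc.isCompact.image_of_continuousOn (e.continuousOn.mono fun x hx => hSe (hsub x hx))
  have hψt : tsupport ψ ⊆ e '' tsupport φ :=
    closure_minimal (fun y hy => by_contra fun h => hy (hψs y h)) hcomp.isClosed
  have himg : e '' tsupport φ ⊆ s := by
    rintro _ ⟨x, hx, rfl⟩
    exact hF.mem_varDomain (hsub x hx)
  have hψ1 : ContDiff ℝ 1 ψ := by
    rw [contDiff_iff_contDiffAt]
    intro y
    by_cases hy : y ∈ s
    · refine ((hφe y (hse hy)).contDiffAt (e.open_target.mem_nhds (hse hy))).congr_of_eventuallyEq ?_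
      filter_upwards [e.open_target.mem_nhds (hse hy)] with z hz using hψe z hz
    · have h0 : ψ =ᶠ[𝓝 y] fun _ => 0 := by
        filter_upwards [hcomp.isClosed.isOpen_compl.mem_nhds fun h => hy (himg h)] with z hz
        exact hψs z hz
      exact contDiffAt_const.congr_of_eventuallyEq h0
  have hslice : ∀ {k : WithTop ℕ∞} {c : Model m × ℝ → ℝ},
      ContDiffOn ℝ k c (varDomain m n F ε x₀ q₀) → ContDiffOn ℝ k (fun y => c (y, t)) s :=
    fun hc => hc.comp (contDiff_id.prodMk contDiff_const).contDiffOn fun y hy => hy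
  set W : Fin n → Model m → ℝ := fun i y => velComp F x₀ q₀ i (y, t) * ψ y with hW
  have hWts : ∀ i, tsupport (W i) ⊆ tsupport ψ := fun i => tsupport_mul_subset_right
  have hW1 : ∀ i, ContDiff ℝ 1 (W i) := fun i => contDiff_mul_of_tsupport_subset hso
    ((hslice (hF.contDiffOn_velComp x₀ q₀ i)).of_le (by norm_num)) hψ1 (hψt.trans himg)
  have hψc : HasCompactSupport ψ := hcomp.of_isClosed_subset (isClosed_tsupport ψ) hψt
  have key := integral_firstVarLoc (g.isLocalHermitian x₀) (h.isLocalHermitian q₀) hso hse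
    (u := fun i y => varComp F x₀ q₀ i (y, t)) (W := W)
    (fun i => hslice (hF.contDiffOn_varComp x₀ q₀ i)) (fun y hy => hF.toLp_varComp_mem hy) hW1
    (fun i => hψc.mul_left) (fun i => (hWts i).trans (hψt.trans himg))
  -- both integrands vanish off the support of `φ`, in the chart and on the manifold
  have hW0 : ∀ y ∉ e '' tsupport φ, ∀ i, W i =ᶠ[𝓝 y] fun _ => 0 := by
    intro y hy i
    filter_upwards [hcomp.isClosed.isOpen_compl.mem_nhds hy] with z hz
    rw [hW]
    dsimp only
    rw [hψs z hz, mul_zero]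
  have hpt : ∀ y ∈ e.target, e.symm y ∉ tsupport φ → y ∉ e '' tsupport φ := by
    rintro y hy hn ⟨x, hx, rfl⟩
    rw [e.left_inv (hSe (hsub x hx))] at hn
    exact hn hx
  have hL : ∫ x, firstVarDensity g h F t φ x ∂g.vol
      = ∫ y, √(g.metricLoc e y).det * firstVarLoc (g.metricLoc e) (g.formLoc e)
        (h.metricLoc (chartAt (Model n) q₀)) (h.formLoc (chartAt (Model n) q₀))
        (fun i y => varComp F x₀ q₀ i (y, t)) W y := by
    have hcont := hF.continuous_firstVarDensity g h hφ hsub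
    rw [g.integral_vol_eq x₀ hcont.continuousOn fun z hz =>
      firstVarDensity_eq_zero g h fun hmem => hz (hSe (hsub z hmem))]
    refine Eq.trans ?_ (setIntegral_eq_integral_of_forall_compl_eq_zero (s := e.target) ?_)
    · refine setIntegral_congr_fun e.open_target.measurableSet fun y hy => ?_
      congr 1
      by_cases hyt : e.symm y ∈ tsupport φ
      · have hys : y ∈ s := himg ⟨_, hyt, e.right_inv hy⟩
        refine (hF.firstVarDensity_eq g h (p := (y, t)) hys hφd).trans
          (firstVarLoc_congr fun i => ?_)
        filter_upwards [e.open_target.mem_nhds hy] with z hz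
        rw [hW]
        dsimp only
        rw [hψe z hz, mul_comm]
      · rw [firstVarDensity_eq_zero g h hyt, firstVarLoc_congr (hW0 y (hpt y hy hyt)),
          firstVarLoc_zero]
    · intro y hy
      rw [firstVarLoc_congr (hW0 y fun hmem => hy (hse (himg hmem))), firstVarLoc_zero, mul_zero]
  have hR : ∫ x, φ x * pairAt g h F x₀ q₀ (x, t) ∂g.vol
      = ∫ y, √(g.metricLoc e y).det * tensionPairLoc (g.metricLoc e) (g.formLoc e)
        (h.metricLoc (chartAt (Model n) q₀)) (h.formLoc (chartAt (Model n) q₀))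
        (fun i y => varComp F x₀ q₀ i (y, t)) W y := by
    have hpair : ∀ y, tensionPairLoc (g.metricLoc e) (g.formLoc e)
        (h.metricLoc (chartAt (Model n) q₀)) (h.formLoc (chartAt (Model n) q₀))
        (fun i y => varComp F x₀ q₀ i (y, t)) W y = ψ y * varPair g h F x₀ q₀ (y, t) := by
      intro y
      rw [varPair, tensionPairLoc, tensionPairLoc, Finset.mul_sum]
      exact Finset.sum_congr rfl fun i _ => by rw [hW]; ring
    have hcont : Continuous fun x => φ x * pairAt g h F x₀ q₀ (x, t) := by
      have h1 := (hF.isParamC1_pairAt g h x₀ q₀).1.comp (f := fun x => (x, t)) (s := S)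
        (by fun_prop) fun x hx => hx
      exact (continuous_mul_of_tsupport_subset hSo h1 hφ.continuous.continuousOn hsub).congr
        fun x => mul_comm _ _
    rw [g.integral_vol_eq x₀ hcont.continuousOn fun z hz => by
      rw [image_eq_zero_of_notMem_tsupport fun hmem => hz (hSe (hsub z hmem)), zero_mul]]
    refine Eq.trans ?_ (setIntegral_eq_integral_of_forall_compl_eq_zero (s := e.target) ?_)
    · refine setIntegral_congr_fun e.open_target.measurableSet fun y hy => ?_
      rw [hpair, hψe y hy, pairAt]
      dsimp only
      rw [(chartAt (Model m) x₀).right_inv hy]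
    · intro y hy
      rw [hpair, hψs y fun hmem => hy (hse (himg hmem)), zero_mul, mul_zero]
  rw [hL, hR, key]

end IsCompactVariation

end VariationNhd

/-! ### Integrals over compact sets and test functions -/

/-- Differentiation under the integral sign over a compact set. -/
theorem hasDerivAt_setIntegral_of_continuousOn {X : Type*} [TopologicalSpace X] [T2Space X]
    [MeasurableSpace X] [BorelSpace X] {μ : Measure X} [IsFiniteMeasureOnCompacts μ] {C : Set X}
    (hC : IsCompact C) {a b t : ℝ} (ht : t ∈ Ioo a b) {f f' : X × ℝ → ℝ}
    (hf : ContinuousOn f (C ×ˢ Ioo a b)) (hf' : ContinuousOn f' (C ×ˢ Ioo a b))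
    (hd : ∀ x ∈ C, ∀ s ∈ Ioo a b, HasDerivAt (fun s => f (x, s)) (f' (x, s)) s) :
    HasDerivAt (fun s => ∫ x in C, f (x, s) ∂μ) (∫ x in C, f' (x, t) ∂μ) t := by
  obtain ⟨r, hr, hball⟩ := Metric.nhds_basis_closedBall.mem_iff.1 (isOpen_Ioo.mem_nhds ht)
  have hint : ∀ {c : X × ℝ → ℝ} {s : ℝ}, ContinuousOn c (C ×ˢ Ioo a b) → s ∈ Ioo a b →
      IntegrableOn (fun x => c (x, s)) C μ := fun hc hs =>
    (hc.comp (f := fun x => (x, _)) (by fun_prop) fun x hx => ⟨hx, hs⟩).integrableOn_compact hC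
  obtain ⟨B, hB⟩ := (hC.prod (isCompact_closedBall t r)).exists_bound_of_continuousOn
    (hf'.mono (prod_mono Subset.rfl hball))
  refine (hasDerivAt_integral_of_dominated_loc_of_deriv_le (μ := μ.restrict C)
    (F := fun s x => f (x, s)) (F' := fun s x => f' (x, s)) (bound := fun _ => B)
    (Metric.closedBall_mem_nhds t hr) ?_ (hint hf ht) (hint hf' ht).aestronglyMeasurable ?_ ?_ ?_).2
  · filter_upwards [isOpen_Ioo.mem_nhds ht] with s hs using (hint hf hs).aestronglyMeasurable
  · exact ae_restrict_of_forall_mem hC.measurableSet fun x hx s hs => hB (x, s) ⟨hx, hs⟩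
  · exact integrableOn_const hC.measure_lt_top.ne
  · exact ae_restrict_of_forall_mem hC.measurableSet fun x hx s hs => hd x hx s (hball hs)

section TestFunctions

set_option linter.unusedSectionVars false

variable {m : ℕ} {M : Type*} [TopologicalSpace M] [T2Space M] [SecondCountableTopology M]
  [ChartedSpace (Model m) M] [IsManifold (𝓡 m) ∞ M] [MeasurableSpace M] [BorelSpace M]
  (g : AlmostHermitian m M)

instance AlmostHermitian.isOpenPosMeasure_vol : g.vol.IsOpenPosMeasure where
  open_pos U hU := by
    rintro ⟨x, hx⟩ h0
    set e := chartAt (Model m) x with he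
    have hA : MeasurableSet (U ∩ e.source) := (hU.inter e.open_source).measurableSet
    have h1 := measure_mono_null (μ := g.vol) inter_subset_left h0 (s := U ∩ e.source)
    rw [g.vol_apply_of_subset_source x hA inter_subset_right, g.chartVolume_apply x hA] at h1
    have hT : e.symm ⁻¹' (U ∩ e.source) ∩ e.target = e.target ∩ e.symm ⁻¹' U := by
      ext y
      simp only [mem_inter_iff, mem_preimage]
      exact ⟨fun h => ⟨h.2, h.1.1⟩, fun h => ⟨⟨h.2, e.map_target h.1⟩, h.1⟩⟩
    have hTo : IsOpen (e.target ∩ e.symm ⁻¹' U) := e.symm.isOpen_inter_preimage hU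
    rw [hT] at h1
    have hm : AEMeasurable (fun y => ENNReal.ofReal (√(g.metricLoc e y).det))
        (volume.restrict (e.target ∩ e.symm ⁻¹' U)) :=
      (((g.isLocalHermitian x).contDiffOn_sqrt_det.continuousOn.mono
        inter_subset_left).aemeasurable hTo.measurableSet).ennreal_ofReal
    rw [lintegral_eq_zero_iff' hm, Filter.EventuallyEq, ae_restrict_iff' hTo.measurableSet] at h1
    refine hTo.measure_ne_zero volume ⟨e x, mem_chart_target _ x, ?_⟩ (measure_mono_null ?_ h1)
    · rw [mem_preimage, e.left_inv (mem_chart_source _ x)]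
      exact hx
    · intro y hy hn
      have h2 := hn hy
      simp only [Pi.zero_apply, ENNReal.ofReal_eq_zero] at h2
      exact absurd (Real.sqrt_pos.2 ((g.isLocalHermitian x).det_pos y hy.1)) (not_lt.2 h2)

theorem exists_contMDiff_tsupport_subset {x : M} {s : Set M} (hs : s ∈ 𝓝 x) :
    ∃ φ : M → ℝ, ContMDiff (𝓡 m) 𝓘(ℝ, ℝ) ∞ φ ∧ HasCompactSupport φ ∧ tsupport φ ⊆ s ∧
      (∀ z, 0 ≤ φ z) ∧ φ x = 1 := by
  obtain ⟨b, -, hb⟩ := (SmoothBumpFunction.nhds_basis_tsupport (I := 𝓡 m) x).mem_iff.1 hs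
  exact ⟨b, b.contMDiff, b.hasCompactSupport, hb, fun _ => b.nonneg, b.eq_one⟩

/-- The fundamental lemma of the calculus of variations. -/
theorem eq_zero_of_integral_mul_eq_zero {A : M → ℝ} {U : Set M} (hU : IsOpen U)
    (hA : ContinuousOn A U)
    (h0 : ∀ φ : M → ℝ, ContMDiff (𝓡 m) 𝓘(ℝ, ℝ) ∞ φ → HasCompactSupport φ → tsupport φ ⊆ U →
      ∫ x, φ x * A x ∂g.vol = 0) {x : M} (hx : x ∈ U) : A x = 0 := by
  by_contra hne
  have hpos : {z | z ∈ U ∧ 0 < A x * A z} ∈ 𝓝 x := by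
    have h1 : ContinuousAt (fun z => A x * A z) x :=
      continuousAt_const.mul (hA.continuousAt (hU.mem_nhds hx))
    exact Filter.inter_mem (hU.mem_nhds hx)
      (h1.preimage_mem_nhds (lt_mem_nhds (mul_self_pos.2 hne)))
  obtain ⟨φ, hφ, hc, hsub, hnn, h1⟩ := exists_contMDiff_tsupport_subset (m := m) hpos
  have hsU : tsupport φ ⊆ U := fun z hz => (hsub hz).1
  have hcont : Continuous fun z => A z * φ z :=
    continuous_mul_of_tsupport_subset hU hA hφ.continuous.continuousOn hsU
  have h2 : 0 < ∫ z, A x * (A z * φ z) ∂g.vol := by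
    refine (continuous_const.mul hcont).integral_pos_of_hasCompactSupport_nonneg_nonzero
      (x := x) (hc.mul_left.mul_left) (fun z => ?_) ?_
    · by_cases hz : z ∈ tsupport φ
      · rw [Pi.zero_apply, ← mul_assoc]
        exact mul_nonneg (hsub hz).2.le (hnn z)
      · rw [image_eq_zero_of_notMem_tsupport hz, mul_zero, mul_zero, Pi.zero_apply]
    · rw [h1, mul_one]
      exact (mul_self_pos.2 hne).ne'
  rw [integral_const_mul] at h2
  have h3 := h0 φ hφ hc hsU
  simp only [mul_comm (φ _)] at h3
  rw [h3, mul_zero] at h2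
  exact lt_irrefl _ h2

end TestFunctions

/-! ### The first variation of the energy -/

section FirstVariationFormula

set_option linter.unusedSectionVars false

variable {m n : ℕ}
  {M : Type*} [TopologicalSpace M] [T2Space M] [SecondCountableTopology M]
  [ChartedSpace (Model m) M] [IsManifold (𝓡 m) ∞ M] [MeasurableSpace M] [BorelSpace M]
  {N : Type*} [TopologicalSpace N] [ChartedSpace (Model n) N] [IsManifold (𝓡 n) ∞ N]
  (g : AlmostHermitian m M) (h : AlmostHermitian n N)

namespace IsCompactVariation

variable {F : ℝ → M → N} {K : Set M} {ε : ℝ} (hF : IsCompactVariation m n F K ε)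
include hF

theorem continuous_mul_pairAt {x₀ : M} {q₀ : N} {t : ℝ} {φ : M → ℝ} (hφ : Continuous φ)
    (hsub : ∀ x ∈ tsupport φ, (x, t) ∈ varNhd m n F ε x₀ q₀) :
    Continuous fun x => φ x * pairAt g h F x₀ q₀ (x, t) := by
  have h1 := (hF.isParamC1_pairAt g h x₀ q₀).1.comp (f := fun x : M => ((x, t) : M × ℝ))
    (s := {x | (x, t) ∈ varNhd m n F ε x₀ q₀}) (by fun_prop) fun x hx => hx
  exact (continuous_mul_of_tsupport_subset ((hF.isOpen_varNhd x₀ q₀).preimage (by fun_prop)) h1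
    hφ.continuousOn hsub).congr fun x => mul_comm _ _

/-- The pairing `⟨τ₊(F t), ∂ₜF⟩` does not depend on the charts in which it is computed. This
follows from the first variation formula: both expressions have the same integrals against all
test functions, as the first variation of the energy density is defined without charts. -/
theorem pairAt_eq {x₀ x₁ : M} {q₀ q₁ : N} {p : M × ℝ} (h₀ : p ∈ varNhd m n F ε x₀ q₀)
    (h₁ : p ∈ varNhd m n F ε x₁ q₁) : pairAt g h F x₀ q₀ p = pairAt g h F x₁ q₁ p := by
  obtain ⟨x, t⟩ := p
  set U : Set M := {x | (x, t) ∈ varNhd m n F ε x₀ q₀ ∩ varNhd m n F ε x₁ q₁} with hU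
  have hUo : IsOpen U :=
    ((hF.isOpen_varNhd x₀ q₀).inter (hF.isOpen_varNhd x₁ q₁)).preimage (by fun_prop)
  have hc : ∀ x' q', U ⊆ {x | (x, t) ∈ varNhd m n F ε x' q'} →
      ContinuousOn (fun x => pairAt g h F x' q' (x, t)) U := fun x' q' hsub =>
    (hF.isParamC1_pairAt g h x' q').1.comp (f := fun x : M => ((x, t) : M × ℝ))
      (by fun_prop) fun x hx => hsub hx
  refine sub_eq_zero.1 (eq_zero_of_integral_mul_eq_zero g hUo
    (A := fun x => pairAt g h F x₀ q₀ (x, t) - pairAt g h F x₁ q₁ (x, t))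
    ((hc x₀ q₀ fun x hx => hx.1).sub (hc x₁ q₁ fun x hx => hx.2)) ?_ (x := x) ⟨h₀, h₁⟩)
  intro φ hφ hcs hsub
  have hφ1 : ContMDiff (𝓡 m) 𝓘(ℝ, ℝ) 1 φ := hφ.of_le (by simp)
  have e₀ := hF.integral_firstVarDensity g h hφ1 hcs (x₀ := x₀) (q₀ := q₀) fun x hx => (hsub hx).1
  have e₁ := hF.integral_firstVarDensity g h hφ1 hcs (x₀ := x₁) (q₀ := q₁) fun x hx => (hsub hx).2
  have i₀ := (hF.continuous_mul_pairAt g h (x₀ := x₀) (q₀ := q₀) hφ.continuous fun x hx =>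
    (hsub hx).1).integrable_of_hasCompactSupport (μ := g.vol) hcs.mul_right
  have i₁ := (hF.continuous_mul_pairAt g h (x₀ := x₁) (q₀ := q₁) hφ.continuous fun x hx =>
    (hsub hx).2).integrable_of_hasCompactSupport (μ := g.vol) hcs.mul_right
  simp only [mul_sub]
  rw [integral_sub i₀ i₁]
  linarith

theorem velComp_eventuallyEq_zero {x₀ : M} {q₀ : N} {p : M × ℝ}
    (hp : p ∈ varNhd m n F ε x₀ q₀) (hK : p.1 ∉ K) (i : Fin n) :
    (fun y => velComp F x₀ q₀ i (y, p.2)) =ᶠ[𝓝 (chartAt (Model m) x₀ p.1)] fun _ => 0 := by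
  have hc : ContinuousAt (chartAt (Model m) x₀).symm (chartAt (Model m) x₀ p.1) :=
    (chartAt (Model m) x₀).continuousAt_symm ((chartAt (Model m) x₀).map_source hp.1.1)
  have hn : Kᶜ ∈ 𝓝 ((chartAt (Model m) x₀).symm (chartAt (Model m) x₀ p.1)) := by
    rw [(chartAt (Model m) x₀).left_inv hp.1.1]
    exact hF.isCompact.isClosed.isOpen_compl.mem_nhds hK
  filter_upwards [hc.preimage_mem_nhds hn] with y hy
  rw [velComp, hF.velocity_eq_zero hy hp.1.2, components, map_zero]
  rfl

theorem varFirst_eq_zero {x₀ : M} {q₀ : N} {p : M × ℝ} (hp : p ∈ varNhd m n F ε x₀ q₀)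
    (hK : p.1 ∉ K) (φ : Model m → ℝ) :
    varFirst g h F x₀ q₀ φ (chartAt (Model m) x₀ p.1, p.2) = 0 := by
  rw [varFirst, firstVarLoc_congr (W' := fun _ _ => 0), firstVarLoc_zero]
  intro i
  filter_upwards [hF.velComp_eventuallyEq_zero hp hK i] with y hy
  rw [hy, mul_zero]

theorem deriv_energyDensity_eq_zero {x : M} (hx : x ∉ K) {t : ℝ} (ht : t ∈ Ioo (-ε) ε) :
    deriv (fun s => energyDensity g h (F s) x) t = 0 := by
  have hp : (x, t) ∈ varNhd m n F ε x (F t x) := hF.mem_varNhd_self ht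
  rw [(hF.hasDerivAt_energyDensity_of_mem g h hp).deriv]
  exact hF.varFirst_eq_zero g h hp hx _

theorem deriv_energyDensity_eq_sum {ι : Type*} [Fintype ι] {φ : ι → M → ℝ}
    (hφ : ∀ k, ContMDiff (𝓡 m) 𝓘(ℝ, ℝ) 1 (φ k)) (hsum : ∀ x ∈ K, ∀ᶠ z in 𝓝 x, ∑ k, φ k z = 1)
    {t : ℝ} (ht : t ∈ Ioo (-ε) ε) (x : M) :
    deriv (fun s => energyDensity g h (F s) x) t = ∑ k, firstVarDensity g h F t (φ k) x := by
  have hp : (x, t) ∈ varNhd m n F ε x (F t x) := hF.mem_varNhd_self ht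
  have h1 : ∀ k, firstVarDensity g h F t (φ k) x = varFirst g h F x (F t x)
      (fun y => φ k ((chartAt (Model m) x).symm y)) (chartAt (Model m) x x, t) := fun k =>
    hF.firstVarDensity_eq_of_mem g h (p := (x, t)) (hφ k) hp
  have h2 : deriv (fun s => energyDensity g h (F s) x) t
      = varFirst g h F x (F t x) (fun _ => 1) (chartAt (Model m) x x, t) :=
    (hF.hasDerivAt_energyDensity_of_mem g h (p := (x, t)) hp).deriv
  rw [h2, Finset.sum_congr rfl fun k _ => h1 k]
  by_cases hx : x ∈ K
  · simp only [varFirst]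
    have hd := hF.mem_varDomain hp
    rw [← firstVarLoc_sum Finset.univ]
    · refine firstVarLoc_congr fun i => ?_
      have hc : ContinuousAt (chartAt (Model m) x).symm (chartAt (Model m) x x) :=
        (chartAt (Model m) x).continuousAt_symm (mem_chart_target _ x)
      have hn : ∀ᶠ z in 𝓝 ((chartAt (Model m) x).symm (chartAt (Model m) x x)),
          ∑ k, φ k z = 1 := by
        rw [(chartAt (Model m) x).left_inv (mem_chart_source _ x)]
        exact hsum x hx
      filter_upwards [hc.eventually hn] with y hy
      rw [← Finset.sum_mul, hy]
    · intro k _ i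
      refine DifferentiableAt.mul ?_ (DifferentiableAt.comp (g := velComp F x (F t x) i) _
        (hF.differentiableAt_velComp hd i) (by fun_prop))
      exact differentiableAt_comp_symm (mem_chart_target _ x)
        ((hφ k).mdifferentiable (by norm_num) _)
  · have h3 : ∀ ψ : Model m → ℝ,
        varFirst g h F x (F t x) ψ (chartAt (Model m) x x, t) = 0 := fun ψ =>
      hF.varFirst_eq_zero g h (p := (x, t)) hp hx ψ
    rw [h3, Finset.sum_congr rfl fun k _ => h3 _, Finset.sum_const_zero]

theorem hasDerivAt_energyPlus {t : ℝ} (ht : t ∈ Ioo (-ε) ε) :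
    HasDerivAt (fun s => energyPlus g h K (F s))
      (∫ x in K, deriv (fun s => energyDensity g h (F s) x) t ∂g.vol) t :=
  hasDerivAt_setIntegral_of_continuousOn hF.isCompact ht
    (f := fun p => energyDensity g h (F p.2) p.1)
    (f' := fun p => deriv (fun s => energyDensity g h (F s) p.1) p.2)
    ((hF.continuousOn_energyDensity_univ g h).mono (prod_mono (subset_univ _) Subset.rfl))
    ((hF.continuousOn_deriv_energyDensity g h).mono (prod_mono (subset_univ _) Subset.rfl))
    fun _ _ _ hs => hF.hasDerivAt_energyDensity_deriv g h hs

/-- The first variation formula, localized by a finite partition of unity. -/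
theorem integral_deriv_energyDensity {ι : Type*} [Fintype ι] {φ : ι → M → ℝ}
    (hφ : ∀ k, ContMDiff (𝓡 m) 𝓘(ℝ, ℝ) 1 (φ k)) (hc : ∀ k, HasCompactSupport (φ k))
    (hsum : ∀ x ∈ K, ∀ᶠ z in 𝓝 x, ∑ k, φ k z = 1) {t : ℝ} (ht : t ∈ Ioo (-ε) ε)
    {c : ι → M} {q : ι → N} (hsub : ∀ k, ∀ x ∈ tsupport (φ k), (x, t) ∈ varNhd m n F ε (c k) (q k)) :
    ∫ x in K, deriv (fun s => energyDensity g h (F s) x) t ∂g.vol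
      = -∑ k, ∫ x, φ k x * pairAt g h F (c k) (q k) (x, t) ∂g.vol := by
  rw [setIntegral_eq_integral_of_forall_compl_eq_zero fun x hx =>
    hF.deriv_energyDensity_eq_zero g h hx ht]
  simp only [hF.deriv_energyDensity_eq_sum g h hφ hsum ht]
  rw [integral_finsetSum, ← Finset.sum_neg_distrib]
  · exact Finset.sum_congr rfl fun k _ => hF.integral_firstVarDensity g h (hφ k) (hc k) (hsub k)
  · intro k _
    refine (hF.continuous_firstVarDensity g h (hφ k) (hsub k)).integrable_of_hasCompactSupport ?_
    exact HasCompactSupport.intro (hc k) fun x hx => firstVarDensity_eq_zero g h hx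

/-- A finite partition of unity near `K`, such that on the support of each of its members the
charts at some point can be used for all times close to zero. -/
theorem exists_partition : ∃ (δ : ℝ) (s : Finset M) (φ : s → M → ℝ), 0 < δ ∧ δ ≤ ε ∧
    (∀ k, ContMDiff (𝓡 m) 𝓘(ℝ, ℝ) ∞ (φ k)) ∧ (∀ k, HasCompactSupport (φ k)) ∧
    (∀ x ∈ K, ∀ᶠ z in 𝓝 x, ∑ k, φ k z = 1) ∧
    ∀ k, ∀ x ∈ tsupport (φ k), ∀ t ∈ Ioo (-δ) δ, (x, t) ∈ varNhd m n F ε k.1 (F 0 k.1) := by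
  have : LocallyCompactSpace M := ChartedSpace.locallyCompactSpace (Model m) M
  have h0 : (0 : ℝ) ∈ Ioo (-ε) ε := ⟨neg_lt_zero.2 hF.pos, hF.pos⟩
  have hloc : ∀ x : M, ∃ C : Set M, ∃ δ : ℝ, C ∈ 𝓝 x ∧ IsCompact C ∧ 0 < δ ∧
      ∀ z ∈ C, ∀ t ∈ Ioo (-δ) δ, (z, t) ∈ varNhd m n F ε x (F 0 x) := by
    intro x
    obtain ⟨u, hu, v, hv, huv⟩ := mem_nhds_prod_iff.1
      ((hF.isOpen_varNhd x (F 0 x)).mem_nhds (hF.mem_varNhd_self h0))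
    obtain ⟨C, hC, hCu, hCc⟩ := local_compact_nhds hu
    obtain ⟨δ, hδ, hball⟩ := Metric.mem_nhds_iff.1 hv
    refine ⟨C, δ, hC, hCc, hδ, fun z hz t ht => huv ⟨hCu hz, hball ?_⟩⟩
    rw [Real.ball_eq_Ioo, zero_sub, zero_add]
    exact ht
  choose C δ hC hCc hδ hCδ using hloc
  obtain ⟨K', hK', hKK'⟩ := exists_compact_superset hF.isCompact
  obtain ⟨s, -, hs⟩ := hK'.elim_nhds_subcover (fun x => interior (C x)) fun x _ =>
    interior_mem_nhds.2 (hC x)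
  obtain ⟨f, hf⟩ := SmoothPartitionOfUnity.exists_isSubordinate (𝓡 m) hK'.isClosed
    (fun k : s => interior (C k.1)) (fun _ => isOpen_interior) (by
      intro x hx
      obtain ⟨y, hy, hxy⟩ := mem_iUnion₂.1 (hs hx)
      exact mem_iUnion.2 ⟨⟨y, hy⟩, hxy⟩)
  have hsubC : ∀ k : s, tsupport (f k) ⊆ C k.1 := fun k => (hf k).trans interior_subset
  have hδ' : ∃ δ' : ℝ, 0 < δ' ∧ δ' ≤ ε ∧ ∀ k ∈ s, δ' ≤ δ k := by
    rcases s.eq_empty_or_nonempty with hemp | hne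
    · exact ⟨ε, hF.pos, le_rfl, by simp [hemp]⟩
    · refine ⟨min ε (s.inf' hne δ), lt_min hF.pos ?_, min_le_left _ _, fun k hk =>
        (min_le_right _ _).trans (Finset.inf'_le _ hk)⟩
      rw [Finset.lt_inf'_iff]
      exact fun k _ => hδ k
  obtain ⟨δ', hδ'0, hδ'ε, hδ'k⟩ := hδ'
  refine ⟨δ', s, fun k => f k, hδ'0, hδ'ε, fun k => (f k).contMDiff, fun k =>
    (hCc k.1).of_isClosed_subset (isClosed_tsupport _) (hsubC k), ?_, ?_⟩
  · intro x hx
    filter_upwards [mem_interior_iff_mem_nhds.1 (hKK' hx)] with z hz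
    rw [← finsum_eq_sum_of_fintype]
    exact f.sum_eq_one hz
  · intro k x hx t ht
    refine hCδ k.1 x (hsubC k hx) t ⟨?_, ?_⟩
    · linarith [ht.1, hδ'k k.1 k.2]
    · linarith [ht.2, hδ'k k.1 k.2]

/-- The first variation formula at time zero. -/
theorem hasDerivAt_energyPlus_zero : HasDerivAt (fun s => energyPlus g h K (F s))
    (-∫ x, pairAt g h F x (F 0 x) (x, 0) ∂g.vol) 0 := by
  have h0 : (0 : ℝ) ∈ Ioo (-ε) ε := ⟨neg_lt_zero.2 hF.pos, hF.pos⟩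
  obtain ⟨δ, s, φ, hδ, -, hφ, hc, hsum, hsub⟩ := hF.exists_partition
  have hδ0 : (0 : ℝ) ∈ Ioo (-δ) δ := ⟨neg_lt_zero.2 hδ, hδ⟩
  refine (hF.hasDerivAt_energyPlus g h h0).congr_deriv ?_
  rw [hF.integral_deriv_energyDensity g h (fun k => (hφ k).of_le (by simp)) hc hsum h0
    (c := fun k => k.1) (q := fun k => F 0 k.1) fun k x hx => hsub k x hx 0 hδ0,
    ← integral_finsetSum]
  · congr 2
    funext x
    have h1 : ∀ k : s, φ k x * pairAt g h F k.1 (F 0 k.1) (x, 0)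
        = φ k x * pairAt g h F x (F 0 x) (x, 0) := by
      intro k
      by_cases hx : x ∈ tsupport (φ k)
      · rw [hF.pairAt_eq g h (hsub k x hx 0 hδ0) (hF.mem_varNhd_self h0)]
      · rw [image_eq_zero_of_notMem_tsupport hx, zero_mul, zero_mul]
    simp only [h1]
    rw [← Finset.sum_mul]
    by_cases hx : x ∈ K
    · rw [(hsum x hx).self_of_nhds, one_mul]
    · have h2 : pairAt g h F x (F 0 x) (x, 0) = 0 := by
        rw [pairAt, varPair, tensionPairLoc]
        refine Finset.sum_eq_zero fun i _ => ?_
        have h3 : velComp F x (F 0 x) i (chartAt (Model m) x x, 0) = 0 :=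
          (hF.velComp_eventuallyEq_zero (hF.mem_varNhd_self h0) hx i).eq_of_nhds
        simp only [h3, mul_zero]
      rw [h2, mul_zero]
  · intro k _
    exact (hF.continuous_mul_pairAt g h (hφ k).continuous fun x hx =>
      hsub k x hx 0 hδ0).integrable_of_hasCompactSupport (hc k).mul_right

end IsCompactVariation

end FirstVariationFormula

/-! ### Criticality and the vanishing of `τ₊` -/

section Critical

set_option linter.unusedSectionVars false

variable {m n : ℕ}
  {M : Type*} [TopologicalSpace M] [ChartedSpace (Model m) M] [IsManifold (𝓡 m) ∞ M]
  {N : Type*} [TopologicalSpace N] [ChartedSpace (Model n) N] [IsManifold (𝓡 n) ∞ N]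

theorem isOpen_source_inter_preimage {f : M → N} (hf : Continuous f) (x₀ : M) (q₀ : N) :
    IsOpen ((chartAt (Model m) x₀).source ∩ f ⁻¹' (chartAt (Model n) q₀).source) :=
  (chartAt (Model m) x₀).open_source.inter ((chartAt (Model n) q₀).open_source.preimage hf)

open Classical in
/-- The variation of `f` that moves the coordinates of `f x` in the chart at `q₀` with constant
speed `b x • c`, where `b` is a function supported in the domain of the charts. -/
def chartVariation (m : ℕ) {n : ℕ} {M : Type*} [TopologicalSpace M] [ChartedSpace (Model m) M]
    {N : Type*} [TopologicalSpace N] [ChartedSpace (Model n) N] (f : M → N) (x₀ : M) (q₀ : N)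
    (b : M → ℝ) (c : Model n) (t : ℝ) (x : M) : N :=
  if x ∈ (chartAt (Model m) x₀).source ∩ f ⁻¹' (chartAt (Model n) q₀).source then
    (chartAt (Model n) q₀).symm (chartAt (Model n) q₀ (f x) + (t * b x) • c)
  else f x

variable {f : M → N} {x₀ : M} {q₀ : N} {b : M → ℝ} {c : Model n}

theorem chartVariation_of_mem {x : M}
    (hx : x ∈ (chartAt (Model m) x₀).source ∩ f ⁻¹' (chartAt (Model n) q₀).source) (t : ℝ) :
    chartVariation m f x₀ q₀ b c t x
      = (chartAt (Model n) q₀).symm (chartAt (Model n) q₀ (f x) + (t * b x) • c) :=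
  if_pos hx

theorem chartVariation_of_mul_eq_zero {x : M} {t : ℝ} (hx : t * b x = 0) :
    chartVariation m f x₀ q₀ b c t x = f x := by
  by_cases h : x ∈ (chartAt (Model m) x₀).source ∩ f ⁻¹' (chartAt (Model n) q₀).source
  · rw [chartVariation_of_mem h, hx, zero_smul, add_zero, (chartAt (Model n) q₀).left_inv h.2]
  · exact if_neg h

theorem chartVariation_zero : chartVariation m f x₀ q₀ b c 0 = f :=
  funext fun _ => chartVariation_of_mul_eq_zero (zero_mul _)

/-- The velocities of equal curves, as points of the tangent bundle: the tangent spaces depend on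
the curves. -/
theorem totalSpace_mk_mfderiv_congr {γ γ' : ℝ → N} (hγ : γ = γ') (t : ℝ) :
    (⟨γ t, mfderiv 𝓘(ℝ, ℝ) (𝓡 n) γ t (1 : ℝ)⟩ : TangentBundle (𝓡 n) N)
      = ⟨γ' t, mfderiv 𝓘(ℝ, ℝ) (𝓡 n) γ' t (1 : ℝ)⟩ := by
  subst hγ; rfl

/-- By compactness of the support of `b`, the moved points stay in the chart at `q₀` for small
times. -/
theorem exists_isCompactVariation_chartVariation (hf : ContMDiff (𝓡 m) (𝓡 n) 2 f)
    (hb : ContMDiff (𝓡 m) 𝓘(ℝ, ℝ) ∞ b) (hbc : HasCompactSupport b)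
    (hbs : tsupport b ⊆ (chartAt (Model m) x₀).source ∩ f ⁻¹' (chartAt (Model n) q₀).source) :
    ∃ ε, IsCompactVariation m n (chartVariation m f x₀ q₀ b c) (tsupport b) ε := by
  set e := chartAt (Model m) x₀ with he
  set e' := chartAt (Model n) q₀ with he'
  set S := e.source ∩ f ⁻¹' e'.source with hS
  have hSo : IsOpen S := isOpen_source_inter_preimage hf.continuous x₀ q₀
  have hb2 : ContMDiff (𝓡 m) 𝓘(ℝ, ℝ) 2 b := hb.of_le two_le_infty
  set Φ : M × ℝ → Model n := fun p => e' (f p.1) + (p.2 * b p.1) • c with hΦ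
  have hΦs : ContMDiffOn ((𝓡 m).prod 𝓘(ℝ, ℝ)) (𝓡 n) 2 Φ (S ×ˢ univ) := by
    have h1 : ContMDiffOn ((𝓡 m).prod 𝓘(ℝ, ℝ)) (𝓡 n) 2 (fun p : M × ℝ => e' (f p.1))
        (S ×ˢ univ) :=
      (contMDiffOn_chart (n := 2)).comp (hf.comp_contMDiffOn contMDiffOn_fst) fun p hp => hp.1.2
    have h2 : ContMDiffOn ((𝓡 m).prod 𝓘(ℝ, ℝ)) 𝓘(ℝ, ℝ) 2 (fun p : M × ℝ => p.2 * b p.1)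
        (S ×ˢ univ) := contMDiffOn_snd.mul (hb2.comp_contMDiffOn contMDiffOn_fst)
    exact h1.add (h2.smul contMDiffOn_const)
  have hW : IsOpen ((S ×ˢ univ) ∩ Φ ⁻¹' e'.target) :=
    hΦs.continuousOn.isOpen_inter_preimage (hSo.prod isOpen_univ) e'.open_target
  obtain ⟨u, v, -, hv, hKu, h0v, huv⟩ := generalized_tube_lemma hbc.isCompact
    (isCompact_singleton (x := (0 : ℝ))) hW (by
      rintro ⟨x, t⟩ ⟨hx, ht⟩
      obtain rfl : t = 0 := ht
      refine ⟨⟨hbs hx, mem_univ _⟩, ?_⟩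
      simp only [hΦ, mem_preimage, zero_mul, zero_smul, add_zero]
      exact e'.map_source (hbs hx).2)
  obtain ⟨ε, hε, hball⟩ := Metric.mem_nhds_iff.1 (hv.mem_nhds (singleton_subset_iff.1 h0v))
  rw [Real.ball_eq_Ioo, zero_sub, zero_add] at hball
  have hmem : ∀ x ∈ S, ∀ t ∈ Ioo (-ε) ε, Φ (x, t) ∈ e'.target := by
    intro x hx t ht
    by_cases hxK : x ∈ tsupport b
    · exact (huv ⟨hKu hxK, hball ht⟩).2
    · simp only [hΦ, image_eq_zero_of_notMem_tsupport hxK, mul_zero, zero_smul, add_zero]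
      exact e'.map_source hx.2
  have hoff : ∀ x ∉ tsupport b, ∀ t, chartVariation m f x₀ q₀ b c t x = f x := fun x hx t =>
    chartVariation_of_mul_eq_zero (by rw [image_eq_zero_of_notMem_tsupport hx, mul_zero])
  have hKo : IsOpen (tsupport b)ᶜ := (isClosed_tsupport b).isOpen_compl
  have hΦε : ContMDiffOn ((𝓡 m).prod 𝓘(ℝ, ℝ)) (𝓡 n) 2 Φ (S ×ˢ Ioo (-ε) ε) :=
    hΦs.mono (prod_mono Subset.rfl (subset_univ _))
  refine ⟨ε, hε, hbc.isCompact, fun t _ x hx => by rw [hoff x hx, hoff x hx], ?_, ?_⟩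
  · rintro ⟨x, t⟩ ⟨-, ht⟩
    refine ContMDiffAt.contMDiffWithinAt ?_
    by_cases hx : x ∈ S
    · have h1 : ContMDiffOn ((𝓡 m).prod 𝓘(ℝ, ℝ)) (𝓡 n) 2
          (fun p : M × ℝ => chartVariation m f x₀ q₀ b c p.2 p.1) (S ×ˢ Ioo (-ε) ε) :=
        ((contMDiffOn_chart_symm (n := 2)).comp hΦε fun p hp => hmem p.1 hp.1 p.2 hp.2).congr
          fun p hp => chartVariation_of_mem hp.1 p.2
      exact h1.contMDiffAt ((hSo.prod isOpen_Ioo).mem_nhds ⟨hx, ht⟩)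
    · have h1 : ContMDiffOn ((𝓡 m).prod 𝓘(ℝ, ℝ)) (𝓡 n) 2
          (fun p : M × ℝ => chartVariation m f x₀ q₀ b c p.2 p.1) ((tsupport b)ᶜ ×ˢ univ) :=
        (hf.comp_contMDiffOn contMDiffOn_fst).congr fun p hp => hoff p.1 hp.1 p.2
      exact h1.contMDiffAt ((hKo.prod isOpen_univ).mem_nhds ⟨fun h => hx (hbs h), mem_univ _⟩)
  · rintro ⟨x, t⟩ ⟨-, ht⟩
    refine ContMDiffAt.contMDiffWithinAt ?_
    by_cases hx : x ∈ S
    · -- the velocity is the image under the chart of the vector `b x • c` at `Φ (x, t)`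
      have h0 : ContMDiffOn ((𝓡 m).prod 𝓘(ℝ, ℝ)) (𝓡 n).tangent 2
          (fun p : M × ℝ => (⟨Φ p, b p.1 • c⟩ : TangentBundle (𝓡 n) (Model n)))
          (S ×ˢ Ioo (-ε) ε) := by
        have hΨ : ContMDiffOn ((𝓡 m).prod 𝓘(ℝ, ℝ)) (𝓡 n).tangent 2
            (fun p : M × ℝ => ((Φ p, b p.1 • c) : ModelProd (Model n) (Model n)))
            (S ×ˢ Ioo (-ε) ε) :=
          hΦε.prodMk ((hb2.comp_contMDiffOn contMDiffOn_fst).smul contMDiffOn_const)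
        rw [chartedSpaceSelf_prod] at hΨ
        exact (contMDiff_tangentBundleModelSpaceHomeomorph_symm (I := 𝓡 n)
          (n := 2)).comp_contMDiffOn hΨ
      have h1 := (((contMDiffOn_chart_symm (I := 𝓡 n) (n := ∞)
        (x := q₀)).contMDiffOn_tangentMapWithin (m := ∞) (by simp)
        e'.open_target.uniqueMDiffOn).of_le two_le_infty).comp h0
          fun p hp => hmem p.1 hp.1 p.2 hp.2
      refine (h1.congr fun p hp => ?_).contMDiffAt ((hSo.prod isOpen_Ioo).mem_nhds ⟨hx, ht⟩)
      refine (totalSpace_mk_mfderiv_congr (γ' := fun s => e'.symm (Φ (p.1, s)))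
        (funext fun s => chartVariation_of_mem hp.1 s) p.2).trans ?_
      have hd : HasDerivAt (fun s : ℝ => Φ (p.1, s)) (b p.1 • c) p.2 := by
        have := (((hasDerivAt_id p.2).mul_const (b p.1)).smul_const c).const_add (e' (f p.1))
        exact (show HasDerivAt (fun s : ℝ => Φ (p.1, s)) _ _ from this).congr_deriv (by simp)
      have h2 := (mdifferentiable_chart (I := 𝓡 n) q₀).mdifferentiableAt_symm (x := Φ p)
        (hmem p.1 hp.1 p.2 hp.2)
      have h3 := HasMFDerivAt.comp (I' := 𝓡 n) (f := fun s : ℝ => Φ (p.1, s)) p.2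
        (show HasMFDerivAt (𝓡 n) (𝓡 n) e'.symm (Φ (p.1, p.2)) _ from h2.hasMFDerivAt)
        (hasMFDerivAt_iff_hasFDerivAt.2 hd.hasFDerivAt)
      have h4 := mfderivWithin_of_isOpen (I := 𝓡 n) (I' := 𝓡 n) (f := e'.symm) e'.open_target
        (hmem p.1 hp.1 p.2 hp.2)
      have h5 : (mfderiv 𝓘(ℝ, ℝ) (𝓡 n) (fun s => e'.symm (Φ (p.1, s))) p.2 (1 : ℝ) : Model n)
          = (mfderivWithin (𝓡 n) (𝓡 n) e'.symm e'.target (Φ p) (b p.1 • c : Model n) : Model n) := by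
        have h6 := DFunLike.congr_fun h3.mfderiv (1 : ℝ)
        refine Eq.trans h6 ?_
        have h7 : (ContinuousLinearMap.toSpanSingleton ℝ (b p.1 • c)) (1 : ℝ) = b p.1 • c := by simp
        refine Eq.trans (congrArg (fun z : Model n => (mfderiv (𝓡 n) (𝓡 n) e'.symm (Φ p) z : Model n))
          h7) ?_
        exact congrArg (fun T : Model n →L[ℝ] Model n => T (b p.1 • c)) h4.symm
      exact congrArg (TotalSpace.mk' (Model n) (E := fun q : N => TangentSpace (𝓡 n) q)
        (e'.symm (Φ p))) h5
    · have h1 : ContMDiffOn ((𝓡 m).prod 𝓘(ℝ, ℝ)) (𝓡 n).tangent 2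
          (fun p : M × ℝ => (⟨chartVariation m f x₀ q₀ b c p.2 p.1,
            velocity (chartVariation m f x₀ q₀ b c) p.2 p.1⟩ : TangentBundle (𝓡 n) N))
          ((tsupport b)ᶜ ×ˢ univ) := by
        refine (((Bundle.contMDiff_zeroSection ℝ (fun q : N => TangentSpace (𝓡 n) q)
          (IB := 𝓡 n) (n := 2)).comp hf).comp_contMDiffOn contMDiffOn_fst).congr fun p hp => ?_
        refine (totalSpace_mk_mfderiv_congr (γ' := fun _ => f p.1)
          (funext fun s => hoff p.1 hp.1 s) p.2).trans ?_
        rw [mfderiv_const]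
        rfl
      exact h1.contMDiffAt ((hKo.prod isOpen_univ).mem_nhds ⟨fun h => hx (hbs h), mem_univ _⟩)

theorem velComp_chartVariation {ε : ℝ} {K : Set M}
    (hF : IsCompactVariation m n (chartVariation m f x₀ q₀ b c) K ε) {y : Model m}
    (hy : y ∈ (chartAt (Model m) x₀).target)
    (hfy : f ((chartAt (Model m) x₀).symm y) ∈ (chartAt (Model n) q₀).source) (i : Fin n) :
    velComp (chartVariation m f x₀ q₀ b c) x₀ q₀ i (y, 0)
      = b ((chartAt (Model m) x₀).symm y) * c i := by
  set x := (chartAt (Model m) x₀).symm y with hx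
  have h0 : (0 : ℝ) ∈ Ioo (-ε) ε := ⟨neg_lt_zero.2 hF.pos, hF.pos⟩
  have hxS : x ∈ (chartAt (Model m) x₀).source ∩ f ⁻¹' (chartAt (Model n) q₀).source :=
    ⟨(chartAt (Model m) x₀).map_target hy, hfy⟩
  have hmem : (y, (0 : ℝ)) ∈ varDomain m n (chartVariation m f x₀ q₀ b c) ε x₀ q₀ := by
    refine ⟨⟨hy, h0⟩, ?_⟩
    rw [mem_preimage, chartVariation_zero]
    exact hfy
  have h1 := hF.hasDerivAt_varComp hmem i
  have h2 : HasDerivAt (fun s : ℝ => chartAt (Model n) q₀ (f x) i + s * b x * c i)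
      (b x * c i) 0 := by
    have := (((hasDerivAt_id (0 : ℝ)).mul_const (b x)).mul_const (c i)).const_add
      (chartAt (Model n) q₀ (f x) i)
    simpa using this
  refine h1.unique (h2.congr_of_eventuallyEq ?_)
  have hc : ContinuousAt (fun s : ℝ => chartAt (Model n) q₀ (f x) + (s * b x) • c) 0 := by fun_prop
  have ht : (chartAt (Model n) q₀).target ∈ 𝓝 (chartAt (Model n) q₀ (f x) + ((0 : ℝ) * b x) • c) := by
    rw [zero_mul, zero_smul, add_zero]
    exact (chartAt (Model n) q₀).open_target.mem_nhds ((chartAt (Model n) q₀).map_source hfy)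
  filter_upwards [hc.preimage_mem_nhds ht] with s hs
  change (chartAt (Model n) q₀ (chartVariation m f x₀ q₀ b c s x) : Model n) i = _
  rw [chartVariation_of_mem hxS, (chartAt (Model n) q₀).right_inv hs]
  rfl

variable [T2Space M] [SecondCountableTopology M] [MeasurableSpace M] [BorelSpace M]
  {g : AlmostHermitian m M} {h : AlmostHermitian n N}

/-- Otherwise moving `f` in the direction of `τ₊(f)(x₀)` near `x₀` would change the energy to first
order. -/
theorem IsCriticalPoint.tensionPlusLoc_eq_zero (hf : IsCriticalPoint g h f) (x₀ : M) (l : Fin n) :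
    tensionPlusLoc (g.metricLoc (chartAt (Model m) x₀)) (g.formLoc (chartAt (Model m) x₀))
      (h.metricLoc (chartAt (Model n) (f x₀))) (h.formLoc (chartAt (Model n) (f x₀)))
      (mapLoc f x₀) l (chartAt (Model m) x₀ x₀) = 0 := by
  set e := chartAt (Model m) x₀ with he
  set e' := chartAt (Model n) (f x₀) with he'
  set τ : Fin n → Model m → ℝ := tensionPlusLoc (g.metricLoc e) (g.formLoc e) (h.metricLoc e')
    (h.formLoc e') (mapLoc f x₀) with hτ
  set S := e.source ∩ f ⁻¹' e'.source with hS
  have hSo : IsOpen S := isOpen_source_inter_preimage hf.contMDiff.continuous x₀ (f x₀)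
  have hx₀ : x₀ ∈ S := ⟨mem_chart_source _ x₀, mem_chart_source _ (f x₀)⟩
  -- move `f` in the direction of `τ₊(f)(x₀)`
  set c : Model n := WithLp.toLp 2 fun i => τ i (e x₀) with hc
  set κ : M → ℝ := fun x => ∑ i, (∑ l, h.metricLoc e' (e' (f x)) i l * τ l (e x)) * c i with hκ
  have hκc : ContinuousOn κ S := by
    set s : Set (Model m) := e.target ∩ e.symm ⁻¹' (f ⁻¹' e'.source) with hs
    have hso : IsOpen s :=
      e.symm.isOpen_inter_preimage (e'.open_source.preimage hf.contMDiff.continuous)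
    have hu : ∀ i : Fin n, ContDiffOn ℝ 2 (mapLoc f x₀ i) s := by
      intro i
      have h1 : ContMDiffOn (𝓡 m) (𝓡 n) 2 (fun y => e' (f (e.symm y))) s :=
        (contMDiffOn_chart (n := 2)).comp (hf.contMDiff.comp_contMDiffOn
          ((contMDiffOn_chart_symm (n := 2)).mono inter_subset_left)) fun y hy => hy.2
      exact (EuclideanSpace.proj (𝕜 := ℝ) (ι := Fin n) i).contDiff.comp_contDiffOn
        (contMDiffOn_iff_contDiffOn.1 h1)
    have hτc := continuousOn_tensionPlusLoc (g.isLocalHermitian x₀) (h.isLocalHermitian (f x₀)) hso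
      inter_subset_left hu fun y hy => e'.map_source hy.2
    refine continuousOn_finsetSum _ fun i _ => ContinuousOn.mul
      (continuousOn_finsetSum _ fun l _ => ContinuousOn.mul ?_ ?_) continuousOn_const
    · exact ((h.isLocalHermitian (f x₀)).contDiffOn_metric i l).continuousOn.comp
        (e'.continuousOn.comp hf.contMDiff.continuous.continuousOn fun x hx => hx.2)
        fun x hx => e'.map_source hx.2
    · exact (hτc l).comp (e.continuousOn.mono inter_subset_left) fun x hx =>
        ⟨e.map_source hx.1, by rw [mem_preimage, e.left_inv hx.1]; exact hx.2⟩
  by_contra hne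
  have hκ0 : 0 < κ x₀ := by
    have hpd := h.posDef_metricLoc (f x₀) (mem_chart_target (Model n) (f x₀))
    have hne' : (fun i => τ i (e x₀)) ≠ 0 := fun h0 => hne (congrFun h0 l)
    have h1 := (Matrix.posDef_iff_dotProduct_mulVec.1 hpd).2 hne'
    rw [star_trivial] at h1
    refine h1.trans_eq ?_
    simp only [dotProduct, Matrix.mulVec, hκ, hc]
    exact Finset.sum_congr rfl fun i _ => mul_comm _ _
  have hnhds : {x | x ∈ S ∧ 0 < κ x} ∈ 𝓝 x₀ := Filter.inter_mem (hSo.mem_nhds hx₀)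
    ((hκc.continuousAt (hSo.mem_nhds hx₀)).preimage_mem_nhds (lt_mem_nhds hκ0))
  obtain ⟨b, hb, hbc, hbs, hb0, hb1⟩ := exists_contMDiff_tsupport_subset (m := m) hnhds
  have hbS : tsupport b ⊆ S := fun x hx => (hbs hx).1
  obtain ⟨ε, hF⟩ := exists_isCompactVariation_chartVariation (c := c) hf.contMDiff hb hbc hbS
  have h0 : (0 : ℝ) ∈ Ioo (-ε) ε := ⟨neg_lt_zero.2 hF.pos, hF.pos⟩
  have hderiv := (hF.hasDerivAt_energyPlus_zero g h).unique
    (hf.hasDerivAt _ _ _ hF chartVariation_zero)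
  have hP : ∀ x, pairAt g h (chartVariation m f x₀ (f x₀) b c) x
      (chartVariation m f x₀ (f x₀) b c 0 x) (x, 0) = κ x * b x := by
    intro x
    have hself : (x, (0 : ℝ)) ∈ varNhd m n (chartVariation m f x₀ (f x₀) b c) ε x
      (chartVariation m f x₀ (f x₀) b c 0 x) := hF.mem_varNhd_self h0
    by_cases hx : x ∈ tsupport b
    · have hmem : (x, (0 : ℝ)) ∈ varNhd m n (chartVariation m f x₀ (f x₀) b c) ε x₀ (f x₀) := by
        refine ⟨⟨(hbS hx).1, h0⟩, ?_⟩
        rw [mem_preimage, chartVariation_zero]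
        exact (hbS hx).2
      rw [hF.pairAt_eq g h hself hmem, pairAt, varPair, tensionPairLoc, hκ]
      dsimp only
      rw [Finset.sum_mul]
      refine Finset.sum_congr rfl fun i _ => ?_
      rw [velComp_chartVariation hF (e.map_source (hbS hx).1) (by
        rw [e.left_inv (hbS hx).1]; exact (hbS hx).2), e.left_inv (hbS hx).1]
      have hv : (fun (i : Fin n) (y : Model m) =>
          varComp (chartVariation m f x₀ (f x₀) b c) x₀ (f x₀) i (y, 0))
          = mapLoc f x₀ := by
        funext i y
        rw [varComp]
        dsimp only
        rw [chartVariation_zero]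
        rfl
      have hz : (WithLp.toLp 2 fun l : Fin n => mapLoc f x₀ l (e x) : Model n) = e' (f x) := by
        change e' (f (e.symm (e x))) = _
        rw [e.left_inv (hbS hx).1]
      have hz' : (WithLp.toLp 2 fun l : Fin n =>
          varComp (chartVariation m f x₀ (f x₀) b c) x₀ (f x₀) l (e x, 0) : Model n) = e' (f x) := by
        rw [← hz, ← hv]
      rw [hv, hz', hτ]
      ring
    · rw [image_eq_zero_of_notMem_tsupport hx, mul_zero, pairAt, varPair, tensionPairLoc]
      refine Finset.sum_eq_zero fun i _ => ?_
      have h3 := (hF.velComp_eventuallyEq_zero hself hx i).eq_of_nhds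
      dsimp only at h3
      simp only [h3, mul_zero]
  simp only [hP, neg_eq_zero] at hderiv
  have hpos : 0 < ∫ x, κ x * b x ∂g.vol := by
    refine (continuous_mul_of_tsupport_subset hSo hκc hb.continuous.continuousOn
      hbS).integral_pos_of_hasCompactSupport_nonneg_nonzero (x := x₀) hbc.mul_left (fun x => ?_) ?_
    · by_cases hx : x ∈ tsupport b
      · exact mul_nonneg (hbs hx).2.le (hb0 x)
      · rw [image_eq_zero_of_notMem_tsupport hx, mul_zero, Pi.zero_apply]
    · rw [hb1, mul_one]
      exact hκ0.ne'
  exact hpos.ne' hderiv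

/-- A critical point of the energy satisfies `τ₊ = 0`. -/
theorem IsCriticalPoint.tensionPlus_eq_zero (hf : IsCriticalPoint g h f) (x : M) :
    tensionPlus g h f x = 0 := by
  have h1 : (fun l => tensionLoc (g.metricLoc (chartAt (Model m) x))
      (h.metricLoc (chartAt (Model n) (f x))) (mapLoc f x) l (chartAt (Model m) x x)
      + aTermLoc (g.metricLoc (chartAt (Model m) x)) (g.formLoc (chartAt (Model m) x))
        (h.metricLoc (chartAt (Model n) (f x))) (h.formLoc (chartAt (Model n) (f x)))
        (mapLoc f x) l (chartAt (Model m) x x)) = fun _ => 0 :=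
    funext fun l => hf.tensionPlusLoc_eq_zero x l
  change ofComponents (f x) _ = 0
  rw [h1, ofComponents]
  exact map_zero _

end Critical

/-! ### The second variation of the energy -/

section SecondVariation

set_option linter.unusedSectionVars false

variable {m n : ℕ}
  {M : Type*} [TopologicalSpace M] [T2Space M] [SecondCountableTopology M]
  [ChartedSpace (Model m) M] [IsManifold (𝓡 m) ∞ M] [MeasurableSpace M] [BorelSpace M]
  {N : Type*} [TopologicalSpace N] [ChartedSpace (Model n) N] [IsManifold (𝓡 n) ∞ N]
  (g : AlmostHermitian m M) (h : AlmostHermitian n N)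

/-- The quadratic form `⟨Lv, v⟩` of the second variation, where `v` is the initial velocity
of `F`. -/
def jacobiForm (F : ℝ → M → N) (x : M) : ℝ :=
  h.metric.inner (F 0 x) (lop g h (F 0) (velocity F 0) x) (velocity F 0 x)

theorem jacobiForm_eq_sum (F : ℝ → M → N) (x : M) :
    jacobiForm g h F x = ∑ i, ∑ l, h.metricLoc (chartAt (Model n) (F 0 x))
      (chartAt (Model n) (F 0 x) (F 0 x)) i l
      * lopLoc (g.metricLoc (chartAt (Model m) x)) (g.formLoc (chartAt (Model m) x))
        (h.metricLoc (chartAt (Model n) (F 0 x))) (h.formLoc (chartAt (Model n) (F 0 x)))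
        (mapLoc (F 0) x) (sectionLoc (F 0) (velocity F 0) x) l (chartAt (Model m) x x)
      * components (F 0 x) (F 0 x) (velocity F 0 x) i := by
  have h1 : jacobiForm g h F x
      = h.metric.inner (F 0 x) (velocity F 0 x) (lop g h (F 0) (velocity F 0) x) :=
    h.metric.symm _ _ _
  rw [h1, h.inner_eq_sum (F 0 x) (mem_chart_source _ _)]
  have h2 : components (F 0 x) (F 0 x) (lop g h (F 0) (velocity F 0) x) = _ :=
    components_ofComponents _ _
  rw [h2]
  exact Finset.sum_congr rfl fun i _ => Finset.sum_congr rfl fun l _ => by ring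

theorem jacobiForm_eq_zero {F : ℝ → M → N} {x : M}
    (hv : (velocity F 0 x : TangentSpace (𝓡 n) (F 0 x)) = 0) : jacobiForm g h F x = 0 := by
  rw [jacobiForm, hv]
  exact map_zero _

namespace IsCompactVariation

variable {F : ℝ → M → N} {K : Set M} {ε : ℝ} (hF : IsCompactVariation m n F K ε)
include hF

/-- At a critical point the operator `L` is the linearization of `-τ₊`; since `τ₊` vanishes,
neither the connection nor the derivative of the velocity enters. -/
theorem hasDerivAt_pairAt_self (hf : IsCriticalPoint g h (F 0)) (x : M) :
    HasDerivAt (fun s => pairAt g h F x (F 0 x) (x, s)) (-jacobiForm g h F x) 0 := by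
  have h0 : (0 : ℝ) ∈ Ioo (-ε) ε := ⟨neg_lt_zero.2 hF.pos, hF.pos⟩
  set e := chartAt (Model m) x with he
  set q := F 0 x with hq
  have hp : (e x, (0 : ℝ)) ∈ varDomain m n F ε x q :=
    hF.mem_varDomain (p := (x, 0)) (hF.mem_varNhd_self h0)
  have hslice : ∀ {k : WithTop ℕ∞} {c : Model m × ℝ → ℝ},
      ContDiffOn ℝ k c (varDomain m n F ε x q) → ContDiffAt ℝ k (fun y => c (y, 0)) (e x) :=
    fun hc => (hc.contDiffAt ((hF.isOpen_varDomain x q).mem_nhds hp)).comp (e x)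
      (contDiff_id.prodMk contDiff_const).contDiffAt
  have hD := hF.isOpen_varDomain x q
  have hu := hF.contDiffOn_varComp x q
  have hv := hF.contDiffOn_velComp x q
  have key := hasDerivAt_tensionPairLoc (G := g.metricLoc e) (w := g.formLoc e)
    (h.isLocalHermitian q) (u := fun s i y => varComp F x q i (y, s))
    (v := fun i y => velComp F x q i (y, 0)) (V := fun s i y => velComp F x q i (y, s))
    (y := e x) (t := 0) (hF.toLp_varComp_mem hp)
    (fun j => (hslice (hu j)).differentiableAt (by norm_num))
    (fun b j => (hslice (contDiffOn_spd hD (hu j) (l := 1) (by norm_num) b)).differentiableAt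
      (by norm_num))
    (fun j => (hslice (hv j)).differentiableAt (by norm_num))
    (fun b j => (hslice (contDiffOn_spd hD (hv j) (l := 1) (by norm_num) b)).differentiableAt
      (by norm_num))
    (hF.hasDerivAt_varComp hp) (hF.hasDerivAt_spd_varComp hp) (hF.hasDerivAt_spd_spd_varComp hp)
    (fun _ => rfl)
    (fun i => (hF.differentiableAt_velComp hp i).comp (0 : ℝ)
      (f := fun s : ℝ => ((e x, s) : Model m × ℝ)) (by fun_prop))
    (fun l => hf.tensionPlusLoc_eq_zero x l)
  refine key.congr_deriv (congrArg Neg.neg ?_)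
  rw [jacobiForm_eq_sum]
  refine Finset.sum_congr rfl fun i _ => Finset.sum_congr rfl fun l _ => ?_
  have hx : e.symm (e x) = x := e.left_inv (mem_chart_source _ x)
  have e1 : (WithLp.toLp 2 fun l : Fin n => varComp F x q l (e x, 0) : Model n)
      = chartAt (Model n) q (F 0 x) := by
    change chartAt (Model n) q (F 0 (e.symm (e x))) = _
    rw [hx]
  have e2 : velComp F x q i (e x, 0) = components q q (velocity F 0 x) i := by
    rw [velComp]
    dsimp only
    rw [← he, hx]
  dsimp only
  rw [e1, e2]
  rfl

/-- The time derivative of `⟨τ₊(F t), ∂ₜF⟩` at time zero, in any charts. -/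
theorem hasDerivAt_pairAt (hf : IsCriticalPoint g h (F 0)) {x₀ x : M} {q₀ : N}
    (hx : (x, (0 : ℝ)) ∈ varNhd m n F ε x₀ q₀) :
    HasDerivAt (fun s => pairAt g h F x₀ q₀ (x, s)) (-jacobiForm g h F x) 0 := by
  have h0 : (0 : ℝ) ∈ Ioo (-ε) ε := ⟨neg_lt_zero.2 hF.pos, hF.pos⟩
  refine (hF.hasDerivAt_pairAt_self g h hf x).congr_of_eventuallyEq ?_
  have hc : ContinuousAt (fun s : ℝ => ((x, s) : M × ℝ)) 0 := by fun_prop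
  filter_upwards [hc.preimage_mem_nhds ((hF.isOpen_varNhd x₀ q₀).mem_nhds hx),
    hc.preimage_mem_nhds ((hF.isOpen_varNhd x (F 0 x)).mem_nhds (hF.mem_varNhd_self h0))]
    with s h1 h2
  exact hF.pairAt_eq g h h1 h2

theorem continuousOn_jacobiForm (hf : IsCriticalPoint g h (F 0)) (x₀ : M) (q₀ : N) :
    ContinuousOn (jacobiForm g h F) {x | (x, (0 : ℝ)) ∈ varNhd m n F ε x₀ q₀} := by
  obtain ⟨-, f', hf', hd⟩ := hF.isParamC1_pairAt g h x₀ q₀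
  have h1 := (hf'.comp (f := fun x : M => ((x, 0) : M × ℝ))
    (s := {x | (x, (0 : ℝ)) ∈ varNhd m n F ε x₀ q₀}) (by fun_prop) fun x hx => hx).neg
  refine h1.congr fun x hx => ?_
  have h2 := (hF.hasDerivAt_pairAt g h hf hx).unique (hd (x, 0) hx)
  change _ = -f' (x, 0)
  rw [← h2, neg_neg]

theorem continuous_jacobiForm (hf : IsCriticalPoint g h (F 0)) : Continuous (jacobiForm g h F) := by
  have h0 : (0 : ℝ) ∈ Ioo (-ε) ε := ⟨neg_lt_zero.2 hF.pos, hF.pos⟩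
  rw [continuous_iff_continuousAt]
  intro x
  exact (hF.continuousOn_jacobiForm g h hf x (F 0 x)).continuousAt
    (((hF.isOpen_varNhd x (F 0 x)).preimage (by fun_prop)).mem_nhds (hF.mem_varNhd_self h0))

theorem jacobiForm_eq_zero {x : M} (hx : x ∉ K) : jacobiForm g h F x = 0 :=
  PseudoHolo.jacobiForm_eq_zero g h
    (hF.velocity_eq_zero hx ⟨neg_lt_zero.2 hF.pos, hF.pos⟩)

theorem integrable_jacobiForm (hf : IsCriticalPoint g h (F 0)) :
    Integrable (jacobiForm g h F) g.vol :=
  (hF.continuous_jacobiForm g h hf).integrable_of_hasCompactSupport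
    (HasCompactSupport.intro hF.isCompact fun _ hx => hF.jacobiForm_eq_zero g h hx)

/-- The time derivative of the localized first variation. -/
theorem hasDerivAt_integral_mul_pairAt (hf : IsCriticalPoint g h (F 0)) {x₀ : M} {q₀ : N}
    {φ : M → ℝ} (hφ : Continuous φ) (hc : HasCompactSupport φ) {δ : ℝ} (hδ : 0 < δ)
    (hsub : ∀ x ∈ tsupport φ, ∀ t ∈ Ioo (-δ) δ, (x, t) ∈ varNhd m n F ε x₀ q₀) :
    HasDerivAt (fun s => ∫ x, φ x * pairAt g h F x₀ q₀ (x, s) ∂g.vol)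
      (-∫ x, φ x * jacobiForm g h F x ∂g.vol) 0 := by
  have hδ0 : (0 : ℝ) ∈ Ioo (-δ) δ := ⟨neg_lt_zero.2 hδ, hδ⟩
  obtain ⟨hc0, f', hc1, hd⟩ := hF.isParamC1_pairAt g h x₀ q₀
  have hmono : tsupport φ ×ˢ Ioo (-δ) δ ⊆ varNhd m n F ε x₀ q₀ := fun p hp =>
    hsub p.1 hp.1 p.2 hp.2
  have hφ1 : ContinuousOn (fun p : M × ℝ => φ p.1) (tsupport φ ×ˢ Ioo (-δ) δ) := by fun_prop
  have key := hasDerivAt_setIntegral_of_continuousOn (μ := g.vol) hc.isCompact hδ0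
    (f := fun p => φ p.1 * pairAt g h F x₀ q₀ p) (f' := fun p => φ p.1 * f' p)
    (hφ1.mul (hc0.mono hmono)) (hφ1.mul (hc1.mono hmono))
    fun x hx s hs => (hd (x, s) (hsub x hx s hs)).const_mul (φ x)
  have hset : ∀ c : M → ℝ, ∫ x in tsupport φ, φ x * c x ∂g.vol = ∫ x, φ x * c x ∂g.vol :=
    fun c => setIntegral_eq_integral_of_forall_compl_eq_zero fun x hx => by
      rw [image_eq_zero_of_notMem_tsupport hx, zero_mul]
  rw [← integral_neg]
  refine (key.congr_deriv ?_).congr_of_eventuallyEq (Filter.Eventually.of_forall fun s => ?_)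
  · rw [hset fun x => f' (x, 0)]
    refine integral_congr_ae (Filter.Eventually.of_forall fun x => ?_)
    dsimp only
    by_cases hx : x ∈ tsupport φ
    · have hm := hsub x hx 0 hδ0
      rw [(hd (x, 0) hm).unique (hF.hasDerivAt_pairAt g h hf hm), mul_neg]
    · rw [image_eq_zero_of_notMem_tsupport hx, zero_mul, zero_mul, neg_zero]
  · exact (hset fun x => pairAt g h F x₀ q₀ (x, s)).symm

/-- The second variation formula. -/
theorem hasDerivAt_deriv_energyPlus (hf : IsCriticalPoint g h (F 0)) :
    HasDerivAt (deriv fun t => energyPlus g h K (F t)) (∫ x, jacobiForm g h F x ∂g.vol) 0 := by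
  obtain ⟨δ, s, φ, hδ, hδε, hφ, hc, hsum, hsub⟩ := hF.exists_partition
  have hδ0 : (0 : ℝ) ∈ Ioo (-δ) δ := ⟨neg_lt_zero.2 hδ, hδ⟩
  have h1 := (HasDerivAt.fun_sum (u := Finset.univ) fun k _ =>
    hF.hasDerivAt_integral_mul_pairAt g h hf (hφ k).continuous (hc k) hδ (hsub k)).neg
  have hint : ∀ k, Integrable (fun x => φ k x * jacobiForm g h F x) g.vol := fun k =>
    ((hφ k).continuous.mul (hF.continuous_jacobiForm g h hf)).integrable_of_hasCompactSupport
      (hc k).mul_right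
  refine (h1.congr_deriv ?_).congr_of_eventuallyEq ?_
  · rw [Finset.sum_neg_distrib, neg_neg, ← integral_finsetSum _ fun k _ => hint k]
    refine integral_congr_ae (Filter.Eventually.of_forall fun x => ?_)
    dsimp only
    rw [← Finset.sum_mul]
    by_cases hx : x ∈ K
    · rw [(hsum x hx).self_of_nhds, one_mul]
    · rw [hF.jacobiForm_eq_zero g h hx, mul_zero]
  · filter_upwards [isOpen_Ioo.mem_nhds hδ0] with t ht
    have htε : t ∈ Ioo (-ε) ε := ⟨by linarith [ht.1], by linarith [ht.2]⟩
    rw [(hF.hasDerivAt_energyPlus g h htε).deriv]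
    exact hF.integral_deriv_energyDensity g h (fun k => (hφ k).of_le (by simp)) hc hsum htε
      (c := fun k => k.1) (q := fun k => F 0 k.1) fun k x hx => hsub k x hx t ht

theorem integrableOn_energyDensity {Ω : Set M} (hΩ : MeasurableSet Ω)
    (h0 : IntegrableOn (energyDensity g h (F 0)) Ω g.vol) {t : ℝ} (ht : t ∈ Ioo (-ε) ε) :
    IntegrableOn (energyDensity g h (F t)) Ω g.vol := by
  have hK : IntegrableOn (energyDensity g h (F t)) K g.vol := by
    refine ContinuousOn.integrableOn_compact hF.isCompact ?_
    exact (hF.continuousOn_energyDensity_univ g h).comp (f := fun x : M => ((x, t) : M × ℝ))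
      (by fun_prop) fun x _ => ⟨mem_univ _, ht⟩
  have hd : IntegrableOn (energyDensity g h (F t)) (Ω \ K) g.vol :=
    (h0.mono_set sdiff_subset).congr_fun
      (fun x hx => (hF.energyDensity_eq_of_notMem g h hx.2 ht).symm)
      (hΩ.diff hF.isCompact.measurableSet)
  exact (hK.union hd).mono_set fun x hx => by
    by_cases hxK : x ∈ K
    exacts [Or.inl hxK, Or.inr ⟨hx, hxK⟩]

/-- Over a larger set the energy changes by a constant. -/
theorem energyPlus_eq_add {Ω : Set M} (hΩ : MeasurableSet Ω) (hKΩ : K ⊆ Ω)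
    (h0 : IntegrableOn (energyDensity g h (F 0)) Ω g.vol) {t : ℝ} (ht : t ∈ Ioo (-ε) ε) :
    energyPlus g h Ω (F t)
      = energyPlus g h K (F t) + ∫ x in Ω \ K, energyDensity g h (F 0) x ∂g.vol := by
  have hKm := hF.isCompact.measurableSet
  have hi := hF.integrableOn_energyDensity g h hΩ h0 ht
  have hcongr : ∫ x in Ω \ K, energyDensity g h (F 0) x ∂g.vol
      = ∫ x in Ω \ K, energyDensity g h (F t) x ∂g.vol :=
    setIntegral_congr_fun (hΩ.diff hKm)
      fun x hx => (hF.energyDensity_eq_of_notMem g h hx.2 ht).symm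
  rw [hcongr, energyPlus, energyPlus, ← setIntegral_union disjoint_sdiff_right (hΩ.diff hKm)
    (hi.mono_set hKΩ) (hi.mono_set sdiff_subset), union_sdiff_cancel hKΩ]

theorem differentiableAt_energyPlus {Ω : Set M} (hΩ : MeasurableSet Ω) (hKΩ : K ⊆ Ω)
    (h0 : IntegrableOn (energyDensity g h (F 0)) Ω g.vol) {t : ℝ} (ht : t ∈ Ioo (-ε) ε) :
    DifferentiableAt ℝ (fun s => energyPlus g h Ω (F s)) t := by
  refine ((hF.hasDerivAt_energyPlus g h ht).differentiableAt.add_const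
    (∫ x in Ω \ K, energyDensity g h (F 0) x ∂g.vol)).congr_of_eventuallyEq ?_
  filter_upwards [isOpen_Ioo.mem_nhds ht] with s hs using hF.energyPlus_eq_add g h hΩ hKΩ h0 hs

theorem deriv_energyPlus_eventuallyEq {Ω : Set M} (hΩ : MeasurableSet Ω) (hKΩ : K ⊆ Ω)
    (h0 : IntegrableOn (energyDensity g h (F 0)) Ω g.vol) :
    (deriv fun t => energyPlus g h Ω (F t)) =ᶠ[𝓝 0] deriv fun t => energyPlus g h K (F t) := by
  have hz : (0 : ℝ) ∈ Ioo (-ε) ε := ⟨neg_lt_zero.2 hF.pos, hF.pos⟩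
  have h1 : (fun t => energyPlus g h Ω (F t)) =ᶠ[𝓝 0] fun t => energyPlus g h K (F t)
      + ∫ x in Ω \ K, energyDensity g h (F 0) x ∂g.vol := by
    filter_upwards [isOpen_Ioo.mem_nhds hz] with s hs using hF.energyPlus_eq_add g h hΩ hKΩ h0 hs
  refine h1.deriv.trans (Filter.Eventually.of_forall fun t => ?_)
  exact deriv_add_const _

end IsCompactVariation

end SecondVariation

end PseudoHolo

end

theorem proposition1p3 {m n : ℕ}
    {M : Type*} [TopologicalSpace M] [T2Space M] [SecondCountableTopology M]
    [ChartedSpace (PseudoHolo.Model m) M] [IsManifold (𝓡 m) ∞ M]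
    [MeasurableSpace M] [BorelSpace M]
    {N : Type*} [TopologicalSpace N] [T2Space N] [SecondCountableTopology N]
    [ChartedSpace (PseudoHolo.Model n) N] [IsManifold (𝓡 n) ∞ N]
    (g : PseudoHolo.AlmostHermitian m M) (h : PseudoHolo.AlmostHermitian n N)
    (f : M → N) (hf : PseudoHolo.IsCriticalPoint g h f) :
    (∀ x, PseudoHolo.tensionPlus g h f x = 0) ∧
    ∀ (F : ℝ → M → N) (K : Set M) (ε : ℝ), PseudoHolo.IsCompactVariation m n F K ε → F 0 = f →
      Integrable (fun x => h.metric.inner (F 0 x)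
        (PseudoHolo.lop g h (F 0) (PseudoHolo.velocity F 0) x) (PseudoHolo.velocity F 0 x)) g.vol ∧
      ∀ Ω : Set M, MeasurableSet Ω → K ⊆ Ω →
        IntegrableOn (PseudoHolo.energyDensity g h f) Ω g.vol →
        (∀ t ∈ Ioo (-ε) ε, IntegrableOn (PseudoHolo.energyDensity g h (F t)) Ω g.vol ∧
          DifferentiableAt ℝ (fun s => PseudoHolo.energyPlus g h Ω (F s)) t) ∧
        HasDerivAt (deriv fun t => PseudoHolo.energyPlus g h Ω (F t))
          (∫ x, h.metric.inner (F 0 x)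
            (PseudoHolo.lop g h (F 0) (PseudoHolo.velocity F 0) x)
            (PseudoHolo.velocity F 0 x) ∂g.vol) 0 := by
  refine ⟨hf.tensionPlus_eq_zero, ?_⟩
  rintro F K ε hF rfl
  refine ⟨hF.integrable_jacobiForm g h hf, fun Ω hΩ hKΩ h0 => ⟨fun t ht =>
    ⟨hF.integrableOn_energyDensity g h hΩ h0 ht, hF.differentiableAt_energyPlus g h hΩ hKΩ h0 ht⟩,
    ?_⟩⟩
  exact (hF.hasDerivAt_deriv_energyPlus g h hf).congr_of_eventuallyEq
    (hF.deriv_energyPlus_eventuallyEq g h hΩ hKΩ h0)
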